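/- An instance has $n\ge 1$ agents and $m\ge 0$ indivisible goods. It is personalized bi-valued if each agent $i$ has real numbers $a_i>b_i>0$ and values every good $g$ at $u_i(g)=a_i$ ($g$ is large for $i$) or $u_i(g)=b_i$ ($g$ is small for $i$); put $u_i(S)=\sum_{g\in S}u_i(g)$ and $r_i=a_i/b_i$. An allocation $(X_1,\dots,X_n)$ is a partition of the goods; it is EFX if $u_i(X_i)\ge u_i(X_j\setminus\{g\})$ for all agents $i,j$ and all $g\in X_j$. The Match&Modify&Freeze algorithm starts with all goods unallocated and all agents unfrozen, and works in rounds until all goods are allocated. In a round, let $V_1$ be the set of unfrozen agents, $V_2$ the set of unallocated goods, and $G$ the bipartite graph that joins $i\in V_1$ to $g\in V_2$ if $g$ is large for $i$. If $|V_2|\ge|V_1|$, the round is as follows. 1. Match: take any maximum matching $T$ of $G$. 2. Modify: as long as there is an alternating path $i_0,g_1,i_1,\dots,g_p,i_p$ (with $i_0\in V_1$ unmatched, $(i_x,g_x)\in T$ and $(i_{x-1},g_x)\in E(G)\setminus T$) with $r_{i_0}>r_{i_p}$, replace the edges $(i_x,g_x)$ of $T$, $1\le x\le p$, by $(i_{x-1},g_x)$.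 Then each matched agent receives her matched good, and every other agent of $V_1$ receives one arbitrary remaining good. 3. Freeze: every agent $i=i_x$, $x\ge 1$, on an alternating path $i_0,g_1,i_1,\dots,g_p,i_p$ is frozen for the next $s_i=\max\lfloor r_{i_0}-1\rfloor$ rounds (maximum over all alternating paths through $i$). She counts as having been frozen in this round also when $s_i=0$. If $0<|V_2|<|V_1|$, the remaining goods are given to distinct unfrozen agents, with priority for those who were never frozen and then for those who were frozen in a more recent round, and the algorithm stops. Theorem. For every personalized bi-valued instance with $n\ge1$: (a) An EFX allocation exists. Whatever choices are made, the algorithm never gets stuck before all goods are allocated, and every allocation that it returns is EFX. (b) It makes at most $m$ rounds, with at most $n^2$ modifications of the matching in each. At no time is agent $i$ to stay frozen for more than $\lfloor r_i\rfloor-1$ further rounds, and while goods remain unallocated she has missed at most $\lfloor r_i\rfloor-1$ rounds in total. (c) The algorithm runs in polynomial time: there are one random access machine program and one polynomial $P$ such that, for every instance whose ratios are rational, given as $r_i=p_i/q_i$ with natural numbers $p_i,q_i$ in binary, together with the table of large goods, the program halts after at most $P(\ell)$ steps, where $\ell=n+m+nm+\sum_i(\mathrm{size}(p_i)+\mathrm{size}(q_i))$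 is the input length (with $\mathrm{size}$ the bit length), and outputs an EFX allocation that is returned by some execution of the algorithm. -/

import Mathlib

/-! ## Fair division with personalized bi-valued additive utilities -/

/-- A personalized bi-valued instance with agents `Fin n` and goods `Fin m`: agent `i` values every
good at `a i` (a large good) or at `b i` (a small good), where `a i > b i > 0`. -/
structure BiInstance (n m : ℕ) where
  a : Fin n → ℝ
  b : Fin n → ℝ
  b_pos : ∀ i, 0 < b i
  b_lt_a : ∀ i, b i < a i
  u : Fin n → Fin m → ℝ
  bivalued : ∀ i g, u i g = a i ∨ u i g = b i

namespace BiInstance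

variable {n m : ℕ}

/-- The additive utility of a bundle. -/
noncomputable def utility (I : BiInstance n m) (i : Fin n) (B : Finset (Fin m)) : ℝ :=
  ∑ g ∈ B, I.u i g

/-- The good `g` is large for agent `i`. -/
def Large (I : BiInstance n m) (i : Fin n) (g : Fin m) : Prop := I.u i g = I.a i

/-- The ratio `r_i = a_i / b_i`. -/
noncomputable def ratio (I : BiInstance n m) (i : Fin n) : ℝ := I.a i / I.b i

/-- Envy-freeness up to any good. -/
def EFX (I : BiInstance n m) (X : Fin n → Finset (Fin m)) : Prop :=
  ∀ i j, ∀ g ∈ X j, I.utility i (X j \ {g}) ≤ I.utility i (X i)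

end BiInstance

/-- The bundles partition the set of all goods. -/
def IsAllocation {n m : ℕ} (X : Fin n → Finset (Fin m)) : Prop :=
  (∀ i j, i ≠ j → Disjoint (X i) (X j)) ∧ ∀ g, ∃ i, g ∈ X i

/-- `Steps R k x y`: `y` is reached from `x` by exactly `k` steps of `R`. -/
inductive Steps {α : Type*} (R : α → α → Prop) : ℕ → α → α → Prop
  | zero (x : α) : Steps R 0 x x
  | succ {k : ℕ} {x y z : α} : Steps R k x y → R y z → Steps R (k + 1) x z

/-! ## The Match&Modify&Freeze algorithm

The algorithm leaves several choices open (which maximum matching, which alternating path is used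
next, which good an unmatched agent gets).  It is therefore modelled as a transition system whose
steps are the rounds, with one transition for every way of making these choices. -/

/-- The state between two rounds. -/
structure MMFState (n m : ℕ) where
  /-- the goods that are not allocated yet -/
  goods : Finset (Fin m)
  /-- the bundles allocated so far -/
  bundle : Fin n → Finset (Fin m)
  /-- the number of further rounds for which an agent stays frozen; `0` means unfrozen -/
  frozen : Fin n → ℕ
  /-- the round in which an agent was most recently frozen (possibly for `0` rounds); `⊤` if never -/
  lastFrozen : Fin n → WithTop ℕ
  /-- the number of completed rounds -/
  round : ℕ

namespace MMF

variable {n m : ℕ}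

/-- The initial state: nothing is allocated, nobody is frozen. -/
def start (n m : ℕ) : MMFState n m where
  goods := Finset.univ
  bundle := fun _ => ∅
  frozen := fun _ => 0
  lastFrozen := fun _ => ⊤
  round := 0

/-- The unfrozen agents. -/
def unfrozen (S : MMFState n m) : Finset (Fin n) := Finset.univ.filter fun i => S.frozen i = 0

/-- The bipartite graph of a round: an unfrozen agent is joined to the unallocated goods that are
large for her. -/
def Edge (I : BiInstance n m) (S : MMFState n m) (i : Fin n) (g : Fin m) : Prop :=
  i ∈ unfrozen S ∧ g ∈ S.goods ∧ I.Large i g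

/-- `T` is a matching of the bipartite graph; `T i = some g` means that `i` is matched with `g`. -/
def IsMatching (I : BiInstance n m) (S : MMFState n m) (T : Fin n → Option (Fin m)) : Prop :=
  (∀ i g, T i = some g → Edge I S i g) ∧ ∀ i j g, T i = some g → T j = some g → i = j

/-- The number of edges of a matching. -/
def matchSize (T : Fin n → Option (Fin m)) : ℕ :=
  (Finset.univ.filter fun i => (T i).isSome = true).card

/-- `T` is a matching of maximum size. -/
def IsMaxMatching (I : BiInstance n m) (S : MMFState n m) (T : Fin n → Option (Fin m)) : Prop :=
  IsMatching I S T ∧ ∀ T', IsMatching I S T' → matchSize T' ≤ matchSize T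

/-- `i₀ :: l = [i₀, i₁, …, i_p]` lists the agents of an alternating path
`i₀, g₁, i₁, …, g_p, i_p`: the agent `i₀` is unfrozen and unmatched, the `i_x` are distinct, every
`(i_{x-1}, g_x)` is an edge, and `(i_x, g_x)` belongs to the matching.  (The goods are determined by
`g_x = T i_x`, and `(i_{x-1}, g_x)` is not in the matching because `i_{x-1} ≠ i_x`.) -/
def IsAltPath (I : BiInstance n m) (S : MMFState n m) (T : Fin n → Option (Fin m))
    (i₀ : Fin n) (l : List (Fin n)) : Prop :=
  i₀ ∈ unfrozen S ∧ T i₀ = none ∧ (i₀ :: l).Nodup ∧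
    (i₀ :: l).IsChain fun i j => ∃ g, Edge I S i g ∧ T j = some g

/-- Replace the matched edges `(i₁, g₁), …, (i_p, g_p)` by `(i₀, g₁), …, (i_{p-1}, g_p)` along the
agents `[i₀, i₁, …, i_p]` of an alternating path. -/
def shift (T : Fin n → Option (Fin m)) : List (Fin n) → Fin n → Option (Fin m)
  | [] => T
  | [i] => Function.update T i none
  | i :: j :: l => Function.update (shift T (j :: l)) i (T j)

/-- One modification: along an alternating path from `i₀` to `i_p` with `r_{i₀} > r_{i_p}`, the
matched edges are shifted towards `i₀`. -/
def AdjustStep (I : BiInstance n m) (S : MMFState n m) (T T' : Fin n → Option (Fin m)) : Prop :=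
  ∃ i₀ l, IsAltPath I S T i₀ l ∧
    I.ratio ((i₀ :: l).getLast (List.cons_ne_nil _ _)) < I.ratio i₀ ∧ T' = shift T (i₀ :: l)

/-- The modify step: modifications are made until none applies.  (Nothing happens if every unfrozen
agent is matched, since then there is no alternating path.) -/
def Adjusts (I : BiInstance n m) (S : MMFState n m) (T T' : Fin n → Option (Fin m)) : Prop :=
  (∃ k, Steps (AdjustStep I S) k T T') ∧ ∀ T'', ¬ AdjustStep I S T' T''

/-- Some alternating path that starts at `i₀` passes through the matched agent `i`. -/
def OnPathFrom (I : BiInstance n m) (S : MMFState n m) (T : Fin n → Option (Fin m))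
    (i₀ i : Fin n) : Prop :=
  ∃ l, IsAltPath I S T i₀ l ∧ i ∈ l

open Classical in
/-- The number `s_i` of rounds for which agent `i` is frozen: the maximum of `⌊r_{i₀} - 1⌋` over all
alternating paths through `i`, with `i₀` the start of the path. -/
noncomputable def freezeRounds (I : BiInstance n m) (S : MMFState n m)
    (T : Fin n → Option (Fin m)) (i : Fin n) : ℕ :=
  Finset.univ.sup fun i₀ => if OnPathFrom I S T i₀ i then ⌊I.ratio i₀ - 1⌋₊ else 0

/-- `A` gives at most one unallocated good to each unfrozen agent, nothing to the frozen agents, and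
no good to two agents. -/
def IsHandout (S : MMFState n m) (A : Fin n → Option (Fin m)) : Prop :=
  (∀ i g, A i = some g → i ∈ unfrozen S ∧ g ∈ S.goods) ∧
    ∀ i j g, A i = some g → A j = some g → i = j

open Classical in
/-- The state after a full round in which the goods are handed out by `A` and the agents are frozen
according to the matching `T`. -/
noncomputable def afterRound (I : BiInstance n m) (S : MMFState n m)
    (T A : Fin n → Option (Fin m)) : MMFState n m where
  goods := S.goods.filter fun g => ∀ i, A i ≠ some g
  bundle := fun i => S.bundle i ∪ (A i).toFinset
  frozen := fun i => if S.frozen i = 0 then freezeRounds I S T i else S.frozen i - 1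
  lastFrozen := fun i =>
    if ∃ i₀, OnPathFrom I S T i₀ i then ((S.round + 1 : ℕ) : WithTop ℕ) else S.lastFrozen i
  round := S.round + 1

/-- A full round, possible while there are at least as many unallocated goods as unfrozen agents:
take a maximum matching, modify it, give the matched agents their matched goods and every other
unfrozen agent an arbitrary further good, then freeze. -/
def FullRound (I : BiInstance n m) (S S' : MMFState n m) : Prop :=
  S.goods.Nonempty ∧ (unfrozen S).card ≤ S.goods.card ∧
    ∃ T₀ T A, IsMaxMatching I S T₀ ∧ Adjusts I S T₀ T ∧ IsHandout S A ∧
      (∀ i ∈ unfrozen S, A i ≠ none) ∧ (∀ i g, T i = some g → A i = some g) ∧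
      S' = afterRound I S T A

/-- The last round, when fewer goods than unfrozen agents are left: each remaining good goes to a
different unfrozen agent, with priority for the agents never frozen and then for those frozen more
recently. -/
def LastRound (S S' : MMFState n m) : Prop :=
  S.goods.Nonempty ∧ S.goods.card < (unfrozen S).card ∧
    ∃ A, IsHandout S A ∧ (∀ g ∈ S.goods, ∃ i, A i = some g) ∧
      (∀ i ∈ unfrozen S, ∀ j ∈ unfrozen S, A i ≠ none → A j = none →
        S.lastFrozen j ≤ S.lastFrozen i) ∧
      S' = { S with
        goods := ∅
        bundle := fun i => S.bundle i ∪ (A i).toFinset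
        round := S.round + 1 }

/-- One round of the algorithm. -/
def Round (I : BiInstance n m) (S S' : MMFState n m) : Prop :=
  FullRound I S S' ∨ LastRound S S'

/-- `S` occurs in some execution of the algorithm, after `k` rounds. -/
def ReachedIn (I : BiInstance n m) (k : ℕ) (S : MMFState n m) : Prop :=
  Steps (Round I) k (start n m) S

/-- Some execution of the algorithm stops, with all goods allocated, and returns `X`. -/
def Returns (I : BiInstance n m) (X : Fin n → Finset (Fin m)) : Prop :=
  ∃ k S, ReachedIn I k S ∧ S.goods = ∅ ∧ S.bundle = X

end MMF

/-! ## A random access machine with a step count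

Programs are while-programs over arrays of natural numbers (array `0, 1, 2, …`, each indexed by the
natural numbers).  Every operation costs one step, except that a multiplication also costs the bit
length of its result.  Hence numbers grow by at most one bit per step, and this machine and Turing
machines simulate each other with polynomial overhead. -/

namespace RAM

/-- The memory: `μ k x` is the content of cell `x` of array `k`. -/
abbrev Memory := ℕ → ℕ → ℕ

inductive Expr
  | const (c : ℕ)
  | read (arr : ℕ) (idx : Expr)
  | add (e f : Expr)
  | sub (e f : Expr)
  | mul (e f : Expr)
  | div (e f : Expr)
  | lt (e f : Expr)

/-- The value of an expression (with truncated subtraction, integer division, and `1` for true,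
`0` for false). -/
def Expr.eval (μ : Memory) : Expr → ℕ
  | .const c => c
  | .read arr idx => μ arr (idx.eval μ)
  | .add e f => e.eval μ + f.eval μ
  | .sub e f => e.eval μ - f.eval μ
  | .mul e f => e.eval μ * f.eval μ
  | .div e f => e.eval μ / f.eval μ
  | .lt e f => if e.eval μ < f.eval μ then 1 else 0

/-- The number of steps needed to evaluate an expression. -/
def Expr.cost (μ : Memory) : Expr → ℕ
  | .const _ => 1
  | .read _ idx => idx.cost μ + 1
  | .add e f => e.cost μ + f.cost μ + 1
  | .sub e f => e.cost μ + f.cost μ + 1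
  | .mul e f => e.cost μ + f.cost μ + 1 + (e.eval μ * f.eval μ).size
  | .div e f => e.cost μ + f.cost μ + 1
  | .lt e f => e.cost μ + f.cost μ + 1

inductive Program
  | skip
  | assign (arr : ℕ) (idx val : Expr)
  | seq (p q : Program)
  | cond (e : Expr) (p q : Program)
  | loop (e : Expr) (p : Program)

/-- Writing `v` into cell `x` of array `k`. -/
def Memory.write (μ : Memory) (k x v : ℕ) : Memory :=
  Function.update μ k (Function.update (μ k) x v)

/-- `Exec p μ t μ'`: the program `p`, started with memory `μ`, halts after exactly `t` steps with
memory `μ'`.  A condition holds if its value is not `0`; `loop e p` is "while `e` do `p`". -/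
inductive Exec : Program → Memory → ℕ → Memory → Prop
  | skip (μ : Memory) : Exec .skip μ 1 μ
  | assign (arr : ℕ) (idx val : Expr) (μ : Memory) :
      Exec (.assign arr idx val) μ (idx.cost μ + val.cost μ + 1)
        (μ.write arr (idx.eval μ) (val.eval μ))
  | seq {p q : Program} {μ μ' μ'' : Memory} {s t : ℕ} :
      Exec p μ s μ' → Exec q μ' t μ'' → Exec (.seq p q) μ (s + t) μ''
  | cond_true {e : Expr} {p q : Program} {μ μ' : Memory} {t : ℕ} :
      e.eval μ ≠ 0 → Exec p μ t μ' → Exec (.cond e p q) μ (e.cost μ + 1 + t) μ'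
  | cond_false {e : Expr} {p q : Program} {μ μ' : Memory} {t : ℕ} :
      e.eval μ = 0 → Exec q μ t μ' → Exec (.cond e p q) μ (e.cost μ + 1 + t) μ'
  | loop_false {e : Expr} {p : Program} {μ : Memory} :
      e.eval μ = 0 → Exec (.loop e p) μ (e.cost μ + 1) μ
  | loop_true {e : Expr} {p : Program} {μ μ' μ'' : Memory} {s t : ℕ} :
      e.eval μ ≠ 0 → Exec p μ s μ' → Exec (.loop e p) μ' t μ'' →
        Exec (.loop e p) μ (e.cost μ + 1 + s + t) μ''

open Classical in
/-- The input: array `0` holds `n` and `m`, arrays `1` and `2` hold the numerators and denominators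
of the ratios, and array `3` holds the `n × m` table (row by row) that marks the large goods of each
agent by `1`.  All other cells hold `0`. -/
noncomputable def input {n m : ℕ} (I : BiInstance n m) (p q : Fin n → ℕ) : Memory
  | 0, x => if x = 0 then n else if x = 1 then m else 0
  | 1, x => if h : x < n then p ⟨x, h⟩ else 0
  | 2, x => if h : x < n then q ⟨x, h⟩ else 0
  | 3, x => if ∃ (i : Fin n) (g : Fin m), x = i * m + g ∧ I.Large i g then 1 else 0
  | _, _ => 0

/-- The length of the input: one unit for each agent, each good and each entry of the table, and the
bit lengths of the numerators and denominators of the ratios. -/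
def inputLength {n : ℕ} (m : ℕ) (p q : Fin n → ℕ) : ℕ :=
  n + m + n * m + ∑ i, ((p i).size + (q i).size)

/-- The output: cell `g` of array `4` holds the agent who receives the good `g`. -/
def Outputs {n m : ℕ} (μ : Memory) (X : Fin n → Finset (Fin m)) : Prop :=
  ∀ g i, g ∈ X i ↔ μ 4 (g : ℕ) = (i : ℕ)

end RAM

/-!
# Match&Modify&Freeze returns EFX allocations, in polynomial time

**Why the bundles are EFX.**  As long as an agent is matched in every round and is not on an
alternating path, she has one large good per round and envies nobody by more than one good.  Consider
the first round in which an agent `i` is reached by an alternating path from an unmatched agent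
(possibly from `i` herself).  Since a maximum matching admits no augmenting path, every good that is
still large for `i` is matched (`MMF.IsMaxMatching.good_matched`), so after this round no large good is
left for her: all remaining goods have the value `b_i` for her.  This has two consequences.
First, she is never matched again, so she is frozen at most once.  Second, the comparison
with the bundle of an agent `j` is settled by this one round.

* If `j` did not get a good that is large for `i`, then `i` is ahead by `a_i - b_i` when she is matched,
  which pays for the at most `⌊r_i⌋ - 1` rounds in which she is frozen; here the modifications are
  needed, by which the start `i₀` of a path to `i` has `r_{i₀} ≤ r_i`.  When she is unmatched, she is
  not frozen at all, and the bound holds just as well.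
* If `j` got a good that is large for `i` while `i` was matched, she is not behind, and `j` stays frozen at
  least as long as `i`, since every path to `i` extends to `j`.
* If `j` got such a good while `i` was unmatched, then `j` is frozen for at least `⌊r_i - 1⌋` rounds, in
  which `i` catches up to less than one small good.

These three cases are `MMF.Settled`, and the invariant `MMF.Inv` says that each agent is in one of the
two phases; it is preserved by full rounds (`MMF.Inv.full`).  In the last round the third case is the
only critical one, and there the priority of the agents who were never frozen helps
(`MMF.efx_after_lastRound`).

**Why there are few rounds and modifications.**  The start of a nontrivial alternating path has not been
frozen so far, so some agent is never frozen, and every round allocates a good.  A modification replaces a matched agent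
by one with a larger ratio, so the sum of the ranks of the matched agents' ratios
(`MMF.potential`, at most `n ^ 2`) increases.

**The running time.**  The program is written in a small language (`Mini.Cmd`) in which every loop runs
over the agents or over the goods.  Hence all its commands halt within polynomial time when they are
compiled to the random access machine (`Mini.exists_exec`), and only their effect remains to be
determined.  The program finds the maximum matching by augmentation, treating the agents in the order of
decreasing ratio.  An agent for whom this fails lies in a set of agents, none of smaller ratio, to whom
all goods next to the set are matched (`Mini.Sealed`); such a set is untouched by later augmentations.
These sets show that the matching is of maximum size (`Mini.MatchInv.isMaxMatching`) and that
no modification applies to it (`Mini.MatchInv.not_adjustStep`).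

The effect of the program is determined for abstract inputs, which describe instances with arbitrary
real ratios as well (`Mini.exists_models`).  Therefore its run on the current state
(`Mini.run_oneRound`) also shows that the algorithm never gets stuck, and its whole run
(`Mini.run_main`) that an EFX allocation exists.
-/

/-! ### Alternating paths and modifications -/

namespace MMF

variable {n m : ℕ} {I : BiInstance n m} {S : MMFState n m} {T T' : Fin n → Option (Fin m)}

/-- No good is assigned to two agents. -/
def Injective (T : Fin n → Option (Fin m)) : Prop :=
  ∀ i j g, T i = some g → T j = some g → i = j

/-- The set of matched agents. -/
def dom (T : Fin n → Option (Fin m)) : Finset (Fin n) :=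
  Finset.univ.filter fun i => (T i).isSome = true

theorem mem_dom_iff_isSome {i : Fin n} : i ∈ dom T ↔ (T i).isSome = true := by
  simp [dom]

theorem mem_dom {i : Fin n} : i ∈ dom T ↔ ∃ g, T i = some g := by
  simp [dom, Option.isSome_iff_exists]

theorem shift_of_notMem : ∀ (L : List (Fin n)) (x : Fin n), x ∉ L → shift T L x = T x
  | [], _, _ => rfl
  | [i], x, h => by
    have : x ≠ i := by simpa using h
    simp [shift, this]
  | i :: j :: l, x, h => by
    have hx : x ≠ i := fun e => h (by simp [e])
    have hl : x ∉ j :: l := fun e => h (List.mem_cons_of_mem _ e)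
    simp only [shift, Function.update_of_ne hx]
    exact shift_of_notMem (j :: l) x hl

/-- Shifting keeps the assignment injective and does not use the good of the first agent. -/
theorem shift_injective (hT : Injective T) : ∀ (l : List (Fin n)) (i : Fin n), (i :: l).Nodup →
    Injective (shift T (i :: l)) ∧
      ∀ x g, shift T (i :: l) x = some g → ∃ y, y ≠ i ∧ T y = some g
  | [], i, _ => by
    have key : ∀ x g, shift T [i] x = some g → x ≠ i ∧ T x = some g := by
      intro x g h
      by_cases hx : x = i
      · simp [shift, hx] at h
      · exact ⟨hx, by simpa [shift, hx] using h⟩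
    exact ⟨fun x y g hx hy => hT x y g (key x g hx).2 (key y g hy).2,
      fun x g h => ⟨x, key x g h⟩⟩
  | j :: l, i, hn => by
    obtain ⟨inj, rng⟩ := shift_injective hT l j hn.of_cons
    have hi : i ∉ j :: l := (List.nodup_cons.1 hn).1
    have hij : j ≠ i := fun e => hi (by simp [e])
    have hsi : shift T (j :: l) i = T i := shift_of_notMem _ _ hi
    have at_i : shift T (i :: j :: l) i = T j := by simp [shift]
    have off : ∀ x, x ≠ i → shift T (i :: j :: l) x = shift T (j :: l) x := by
      intro x hx; simp [shift, hx]
    have clash : ∀ x g, T j = some g → shift T (j :: l) x ≠ some g := by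
      intro x g hj hx
      obtain ⟨y, hy, hyg⟩ := rng x g hx
      exact hy (hT _ _ _ hyg hj)
    refine ⟨?_, ?_⟩
    · intro x y g hx hy
      by_cases hxi : x = i <;> by_cases hyi : y = i
      · rw [hxi, hyi]
      · rw [hxi, at_i] at hx
        rw [off y hyi] at hy
        exact (clash y g hx hy).elim
      · rw [hyi, at_i] at hy
        rw [off x hxi] at hx
        exact (clash x g hy hx).elim
      · rw [off x hxi] at hx
        rw [off y hyi] at hy
        exact inj x y g hx hy
    · intro x g hx
      by_cases hxi : x = i
      · rw [hxi, at_i] at hx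
        exact ⟨j, hij, hx⟩
      · rw [off x hxi] at hx
        obtain ⟨y, _, hyg⟩ := rng x g hx
        refine ⟨y, fun e => hxi ?_, hyg⟩
        rw [e, ← hsi] at hyg
        exact inj _ _ _ hx hyg

/-- Shifting yields edges of the bipartite graph again. -/
theorem shift_edge (hT : ∀ i g, T i = some g → Edge I S i g) :
    ∀ (l : List (Fin n)) (i : Fin n),
      (i :: l).IsChain (fun i j => ∃ g, Edge I S i g ∧ T j = some g) →
      ∀ x g, shift T (i :: l) x = some g → Edge I S x g
  | [], i, _, x, g, h => by
    by_cases hx : x = i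
    · simp [shift, hx] at h
    · exact hT x g (by simpa [shift, hx] using h)
  | j :: l, i, hc, x, g, h => by
    rw [List.isChain_cons_cons] at hc
    by_cases hx : x = i
    · obtain ⟨g', he, hg'⟩ := hc.1
      have : T j = some g := by simpa [shift, hx] using h
      rw [this] at hg'
      cases hg'
      rwa [hx]
    · exact shift_edge hT l j hc.2 x g (by simpa [shift, hx] using h)

/-- Shifting along `i :: l` adds `i` to the matched agents and removes the last agent. -/
theorem dom_shift : ∀ (l : List (Fin n)) (i : Fin n), (i :: l).Nodup → (∀ x ∈ l, x ∈ dom T) →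
    dom (shift T (i :: l)) =
      (insert i (dom T)).erase ((i :: l).getLast (List.cons_ne_nil _ _))
  | [], i, _, _ => by
    ext x
    by_cases hx : x = i <;> simp [mem_dom_iff_isSome, shift, hx]
  | j :: l, i, hn, hl => by
    have ih := dom_shift l j hn.of_cons (fun x hx => hl x (List.mem_cons_of_mem _ hx))
    have hj : j ∈ dom T := hl j (by simp)
    rw [Finset.insert_eq_of_mem hj] at ih
    have hlast : i ≠ (j :: l).getLast (List.cons_ne_nil _ _) := by
      intro e
      exact (List.nodup_cons.1 hn).1 (e ▸ List.getLast_mem _)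
    rw [List.getLast_cons (List.cons_ne_nil j l), Finset.erase_insert_of_ne hlast, ← ih]
    ext x
    by_cases hx : x = i
    · subst hx
      simpa [mem_dom_iff_isSome, shift] using hj
    · simp [mem_dom_iff_isSome, shift, hx]

theorem IsAltPath.mem_dom {i₀ : Fin n} {l : List (Fin n)} (h : IsAltPath I S T i₀ l) :
    ∀ x ∈ l, x ∈ dom T := by
  have key : ∀ (l : List (Fin n)) (i : Fin n),
      (i :: l).IsChain (fun i j => ∃ g, Edge I S i g ∧ T j = some g) → ∀ x ∈ l, x ∈ dom T := by
    intro l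
    induction l with
    | nil => simp
    | cons j l ih =>
      intro i hc x hx
      rw [List.isChain_cons_cons] at hc
      rcases List.mem_cons.1 hx with rfl | hx
      · obtain ⟨g, _, hg⟩ := hc.1
        exact MMF.mem_dom.2 ⟨g, hg⟩
      · exact ih j hc.2 x hx
  exact key l i₀ h.2.2.2

/-- The agent `i` is the end of an alternating path that starts at `i₀` (possibly `i = i₀`). -/
def Reach (I : BiInstance n m) (S : MMFState n m) (T : Fin n → Option (Fin m))
    (i₀ i : Fin n) : Prop :=
  ∃ l, IsAltPath I S T i₀ l ∧ (i₀ :: l).getLast (List.cons_ne_nil _ _) = i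

theorem Reach.start {i₀ i : Fin n} (h : Reach I S T i₀ i) : i₀ ∈ unfrozen S ∧ T i₀ = none :=
  ⟨h.choose_spec.1.1, h.choose_spec.1.2.1⟩

theorem Reach.refl {i : Fin n} (hi : i ∈ unfrozen S) (hT : T i = none) : Reach I S T i i :=
  ⟨[], ⟨hi, hT, by simp, by simp⟩, rfl⟩

theorem OnPathFrom.reach {i₀ i : Fin n} (h : OnPathFrom I S T i₀ i) : Reach I S T i₀ i := by
  obtain ⟨l, ⟨h1, h2, h3, h4⟩, hi⟩ := h
  obtain ⟨l₁, l₂, rfl⟩ := List.append_of_mem hi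
  have e : i₀ :: (l₁ ++ i :: l₂) = (i₀ :: (l₁ ++ [i])) ++ l₂ := by simp
  rw [e] at h3 h4
  exact ⟨l₁ ++ [i], ⟨h1, h2, h3.of_append_left, h4.left_of_append⟩, by simp⟩

theorem OnPathFrom.start {i₀ i : Fin n} (h : OnPathFrom I S T i₀ i) :
    i₀ ∈ unfrozen S ∧ T i₀ = none :=
  h.reach.start

theorem OnPathFrom.matched {i₀ i : Fin n} (h : OnPathFrom I S T i₀ i) : ∃ g, T i = some g := by
  obtain ⟨l, hl, hi⟩ := h
  exact mem_dom.1 (hl.mem_dom i hi)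

/-- If the good of `j` is next to a reached agent, then `j` is on an alternating path: one that passes
through her already, or the extended path. -/
theorem Reach.extend {i₀ i j : Fin n} {g : Fin m} (h : Reach I S T i₀ i) (he : Edge I S i g)
    (hj : T j = some g) : OnPathFrom I S T i₀ j := by
  obtain ⟨l, ⟨h1, h2, h3, h4⟩, hl⟩ := h
  by_cases hjl : j ∈ l
  · exact ⟨l, ⟨h1, h2, h3, h4⟩, hjl⟩
  have hj0 : j ≠ i₀ := by
    rintro rfl
    rw [h2] at hj
    cases hj
  refine ⟨l ++ [j], ⟨h1, h2, ?_, ?_⟩, by simp⟩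
  · rw [← List.cons_append, List.nodup_append]
    refine ⟨h3, by simp, ?_⟩
    intro a ha b hb e
    rw [List.mem_singleton] at hb
    subst hb
    subst e
    rcases List.mem_cons.1 ha with ha | ha
    · exact hj0 ha
    · exact hjl ha
  · rw [← List.cons_append, List.isChain_append]
    refine ⟨h4, by simp, ?_⟩
    intro x hx y hy
    rw [List.getLast?_eq_getLast_of_ne_nil (List.cons_ne_nil _ _), Option.mem_some_iff, hl] at hx
    simp only [List.head?_cons, Option.mem_some_iff] at hy
    subst hx hy
    exact ⟨g, he, hj⟩

theorem Reach.onPathFrom {i₀ i : Fin n} (h : Reach I S T i₀ i) (hi : i ≠ i₀) :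
    OnPathFrom I S T i₀ i := by
  obtain ⟨l, hl, rfl⟩ := h
  refine ⟨l, hl, ?_⟩
  rcases List.mem_cons.1 (List.getLast_mem (List.cons_ne_nil i₀ l)) with h | h
  · exact (hi h).elim
  · exact h

/-- A property that holds at `i₀` and is passed on along alternating steps holds at every agent
reached from `i₀`. -/
theorem Reach.induction {i₀ i : Fin n} {F : Fin n → Prop} (h : Reach I S T i₀ i) (h₀ : F i₀)
    (hs : ∀ x g y, F x → Edge I S x g → T y = some g → F y) : F i := by
  obtain ⟨l, hl, rfl⟩ := h
  have key : ∀ (l : List (Fin n)) (i : Fin n),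
      (i :: l).IsChain (fun i j => ∃ g, Edge I S i g ∧ T j = some g) → F i →
        F ((i :: l).getLast (List.cons_ne_nil _ _)) := by
    intro l
    induction l with
    | nil => intro i _ h; exact h
    | cons j l ih =>
      intro i hc hi
      rw [List.isChain_cons_cons] at hc
      obtain ⟨g, he, hg⟩ := hc.1
      rw [List.getLast_cons (List.cons_ne_nil j l)]
      exact ih j hc.2 (hs i g j hi he hg)
  exact key l i₀ hl.2.2.2 h₀

theorem isMatching_shift (hT : IsMatching I S T) {i₀ : Fin n} {l : List (Fin n)}
    (hl : IsAltPath I S T i₀ l) : IsMatching I S (shift T (i₀ :: l)) :=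
  ⟨shift_edge hT.1 l i₀ hl.2.2.2, (shift_injective hT.2 l i₀ hl.2.2.1).1⟩

theorem matchSize_shift {i₀ : Fin n} {l : List (Fin n)} (hl : IsAltPath I S T i₀ l) :
    matchSize (shift T (i₀ :: l)) = matchSize T := by
  change (dom _).card = (dom T).card
  have h0 : i₀ ∉ dom T := by simp [dom, hl.2.1]
  rw [dom_shift l i₀ hl.2.2.1 hl.mem_dom, Finset.card_erase_of_mem, Finset.card_insert_of_notMem h0,
    Nat.add_sub_cancel]
  rcases List.mem_cons.1 (List.getLast_mem (List.cons_ne_nil i₀ l)) with h | h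
  · rw [h]; exact Finset.mem_insert_self _ _
  · exact Finset.mem_insert_of_mem (hl.mem_dom _ h)

theorem IsMaxMatching.of_adjustStep (hT : IsMaxMatching I S T) (h : AdjustStep I S T T') :
    IsMaxMatching I S T' := by
  obtain ⟨i₀, l, hl, _, rfl⟩ := h
  refine ⟨isMatching_shift hT.1 hl, fun T'' hT'' => ?_⟩
  rw [matchSize_shift hl]
  exact hT.2 T'' hT''

theorem IsMaxMatching.of_steps {k : ℕ} (hT : IsMaxMatching I S T)
    (h : Steps (AdjustStep I S) k T T') : IsMaxMatching I S T' := by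
  induction h with
  | zero => exact hT
  | succ _ h ih => exact (ih hT).of_adjustStep h

/-- There is no augmenting path: all goods next to a reached agent are matched.  Otherwise shifting
along the path to `i` frees `i`, who can then take the unmatched good. -/
theorem IsMaxMatching.good_matched (hT : IsMaxMatching I S T) {i₀ i : Fin n} {g : Fin m}
    (h : Reach I S T i₀ i) (he : Edge I S i g) : ∃ j, T j = some g := by
  by_contra hg
  push Not at hg
  obtain ⟨l, hl, hi⟩ := h
  have hS := isMatching_shift hT.1 hl
  have rng := (shift_injective hT.1.2 l i₀ hl.2.2.1).2
  have hd := dom_shift l i₀ hl.2.2.1 hl.mem_dom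
  rw [hi] at hd
  have hfree : ∀ x, shift T (i₀ :: l) x ≠ some g := by
    intro x hx
    obtain ⟨y, _, hy⟩ := rng x g hx
    exact hg y hy
  have hm : IsMatching I S (Function.update (shift T (i₀ :: l)) i (some g)) := by
    refine ⟨fun x g' hx => ?_, fun x y g' hx hy => ?_⟩
    · by_cases hxi : x = i
      · subst hxi
        simp only [Function.update_self, Option.some.injEq] at hx
        rwa [← hx]
      · rw [Function.update_of_ne hxi] at hx
        exact hS.1 x g' hx
    · by_cases hxi : x = i <;> by_cases hyi : y = i
      · rw [hxi, hyi]
      · subst hxi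
        rw [Function.update_of_ne hyi] at hy
        simp only [Function.update_self, Option.some.injEq] at hx
        exact (hfree y (hx ▸ hy)).elim
      · subst hyi
        rw [Function.update_of_ne hxi] at hx
        simp only [Function.update_self, Option.some.injEq] at hy
        exact (hfree x (hy ▸ hx)).elim
      · rw [Function.update_of_ne hxi] at hx
        rw [Function.update_of_ne hyi] at hy
        exact hS.2 x y g' hx hy
  have hle := hT.2 _ hm
  have hcard : matchSize (Function.update (shift T (i₀ :: l)) i (some g)) = matchSize T + 1 := by
    rw [← matchSize_shift hl]
    change (dom _).card = (dom (shift T (i₀ :: l))).card + 1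
    have hi' : i ∉ dom (shift T (i₀ :: l)) := by rw [hd]; simp
    rw [← Finset.card_insert_of_notMem hi']
    congr 1
    ext x
    by_cases hxi : x = i <;> simp [mem_dom_iff_isSome, hxi]
  omega

/-- The potential of a matching: the ranks of the ratios of the matched agents, summed up. -/
noncomputable def potential (I : BiInstance n m) (T : Fin n → Option (Fin m)) : ℕ :=
  ∑ i ∈ dom T, (Finset.univ.filter fun j => I.ratio j < I.ratio i).card

theorem potential_le (I : BiInstance n m) (T : Fin n → Option (Fin m)) :
    potential I T ≤ n ^ 2 := by
  have h : potential I T ≤ (dom T).card • n := by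
    refine Finset.sum_le_card_nsmul _ _ _ fun i _ => ?_
    simpa using Finset.card_le_univ (Finset.univ.filter fun j => I.ratio j < I.ratio i)
  have h2 : (dom T).card ≤ n := by simpa using Finset.card_le_univ (dom T)
  rw [sq]
  exact h.trans (Nat.mul_le_mul_right n h2)

/-- A modification replaces one matched agent by an agent of larger ratio. -/
theorem AdjustStep.potential_lt (h : AdjustStep I S T T') : potential I T < potential I T' := by
  obtain ⟨i₀, l, hl, hr, rfl⟩ := h
  have h0 : i₀ ∉ dom T := by simp [dom, hl.2.1]
  have hne : (i₀ :: l).getLast (List.cons_ne_nil _ _) ≠ i₀ := fun e => by simp [e] at hr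
  have hlast : (i₀ :: l).getLast (List.cons_ne_nil _ _) ∈ dom T := by
    rcases List.mem_cons.1 (List.getLast_mem (List.cons_ne_nil i₀ l)) with h | h
    · exact (hne h).elim
    · exact hl.mem_dom _ h
  unfold potential
  rw [dom_shift l i₀ hl.2.2.1 hl.mem_dom]
  set z := (i₀ :: l).getLast (List.cons_ne_nil _ _)
  have e1 := Finset.add_sum_erase (insert i₀ (dom T))
    (fun i => (Finset.univ.filter fun j => I.ratio j < I.ratio i).card)
    (Finset.mem_insert_of_mem hlast)
  rw [Finset.sum_insert h0] at e1
  have hlt : (Finset.univ.filter fun j => I.ratio j < I.ratio z).card <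
      (Finset.univ.filter fun j => I.ratio j < I.ratio i₀).card := by
    refine Finset.card_lt_card ⟨fun j hj => ?_, fun hsub => ?_⟩
    · simp only [Finset.mem_filter, Finset.mem_univ, true_and] at hj ⊢
      exact hj.trans hr
    · have hz : z ∈ Finset.univ.filter fun j => I.ratio j < I.ratio i₀ := by simpa using hr
      simpa using hsub hz
  omega

theorem steps_adjust_le {k : ℕ} (h : Steps (AdjustStep I S) k T T') : k ≤ n ^ 2 := by
  have key : k ≤ potential I T' := by
    induction h with
    | zero => exact Nat.zero_le _
    | succ _ h ih => exact lt_of_le_of_lt ih h.potential_lt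
  exact key.trans (potential_le I T')

/-- After the modify step, every agent reached from `i₀` has at least the ratio of `i₀`. -/
theorem ratio_le_of_reach (h : ∀ T'', ¬ AdjustStep I S T T'') {i₀ i : Fin n}
    (hr : Reach I S T i₀ i) : I.ratio i₀ ≤ I.ratio i := by
  obtain ⟨l, hl, rfl⟩ := hr
  exact not_lt.1 fun hlt => h _ ⟨i₀, l, hl, hlt, rfl⟩

end MMF

/-! ### The invariant of the algorithm -/

namespace BiInstance

variable {n m : ℕ} (I : BiInstance n m)

theorem b_le_u (i : Fin n) (g : Fin m) : I.b i ≤ I.u i g := by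
  rcases I.bivalued i g with h | h <;> rw [h]
  exact (I.b_lt_a i).le

theorem u_le_a (i : Fin n) (g : Fin m) : I.u i g ≤ I.a i := by
  rcases I.bivalued i g with h | h <;> rw [h]
  exact (I.b_lt_a i).le

theorem u_eq_b {i : Fin n} {g : Fin m} (h : ¬ I.Large i g) : I.u i g = I.b i :=
  (I.bivalued i g).resolve_left h

theorem utility_mono (i : Fin n) {B C : Finset (Fin m)} (h : B ⊆ C) :
    I.utility i B ≤ I.utility i C :=
  Finset.sum_le_sum_of_subset_of_nonneg h fun g _ _ => (I.b_pos i).le.trans (I.b_le_u i g)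

theorem utility_le (i : Fin n) (B : Finset (Fin m)) : I.utility i B ≤ B.card * I.a i := by
  have := Finset.sum_le_card_nsmul B (I.u i) (I.a i) fun g _ => I.u_le_a i g
  simpa [utility] using this

/-- Removing a good costs at least the value of a small good. -/
theorem utility_sdiff (i : Fin n) {B : Finset (Fin m)} {g : Fin m} (hg : g ∈ B) :
    I.utility i (B \ {g}) + I.b i ≤ I.utility i B := by
  have h := Finset.sum_sdiff (f := I.u i) (Finset.singleton_subset_iff.2 hg)
  rw [Finset.sum_singleton] at h
  have := I.b_le_u i g
  unfold utility
  linarith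

theorem a_pos (i : Fin n) : 0 < I.a i := (I.b_pos i).trans (I.b_lt_a i)

/-- A bundle of at most `k + 1` goods is worth at most `k` large goods after removing one good. -/
theorem utility_sdiff_le (i : Fin n) {B : Finset (Fin m)} {g : Fin m} {k : ℕ} (hg : g ∈ B)
    (hB : B.card ≤ k + 1) : I.utility i (B \ {g}) ≤ k * I.a i := by
  refine (I.utility_le i _).trans (mul_le_mul_of_nonneg_right ?_ (I.a_pos i).le)
  rw [Finset.card_sdiff_of_subset (Finset.singleton_subset_iff.2 hg), Finset.card_singleton]
  exact_mod_cast (by omega : B.card - 1 ≤ k)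

theorem one_lt_ratio (i : Fin n) : 1 < I.ratio i := (one_lt_div (I.b_pos i)).2 (I.b_lt_a i)

theorem ratio_mul_b (i : Fin n) : I.ratio i * I.b i = I.a i := div_mul_cancel₀ _ (I.b_pos i).ne'

theorem floor_ratio_sub_one (i : Fin n) : ⌊I.ratio i - 1⌋₊ + 1 = ⌊I.ratio i⌋₊ := by
  rw [Nat.floor_sub_one]
  have : 1 ≤ ⌊I.ratio i⌋₊ := (Nat.one_le_floor_iff _).2 (I.one_lt_ratio i).le
  omega

end BiInstance

namespace MMF

variable {n m : ℕ} {I : BiInstance n m} {S : MMFState n m} {T A : Fin n → Option (Fin m)}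

/-- What holds between the bundles of `i` and `j`, from the perspective of an agent `i` for whom no
large good is left: `i` is ahead by the rounds that she still has to miss; or `i` is not behind, and `j`
stays frozen at least as long; or `j` took a large good in the round in which `i`, who is never frozen,
first went without one, and the rounds in which `j` stays frozen make up for it, up to one small
good. -/
def Settled (I : BiInstance n m) (S : MMFState n m) (i j : Fin n) : Prop :=
  I.utility i (S.bundle j) + S.frozen i * I.b i ≤ I.utility i (S.bundle i) ∨
  (I.utility i (S.bundle j) ≤ I.utility i (S.bundle i) ∧ S.frozen i ≤ S.frozen j) ∨
  (S.frozen i = 0 ∧ S.lastFrozen i = ⊤ ∧ S.lastFrozen j ≠ ⊤ ∧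
    I.utility i (S.bundle j) ≤ I.utility i (S.bundle i) + (S.frozen j + 1) * I.b i ∧
    ∀ g ∈ S.bundle j, I.utility i (S.bundle j \ {g}) ≤ I.utility i (S.bundle i))

/-- The invariant of the algorithm after `k` full rounds.  By `status`, every agent either got a
large good in each round, or there is no large good left for her. -/
structure Inv (I : BiInstance n m) (k : ℕ) (S : MMFState n m) : Prop where
  disj : ∀ i j, i ≠ j → Disjoint (S.bundle i) (S.bundle j)
  cover : ∀ g, g ∉ S.goods → ∃ i, g ∈ S.bundle i
  fresh : ∀ i, ∀ g ∈ S.bundle i, g ∉ S.goods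
  count : k + S.goods.card ≤ m
  card_le : ∀ i, (S.bundle i).card ≤ k
  missed : ∀ i, k + S.frozen i + 1 ≤ (S.bundle i).card + ⌊I.ratio i⌋₊
  never : ∀ i, S.lastFrozen i = ⊤ → S.frozen i = 0 ∧ (S.bundle i).card = k
  someone : ∃ i, S.lastFrozen i = ⊤
  round_eq : S.round = k
  last_le : ∀ i, S.lastFrozen i ≠ ⊤ → S.lastFrozen i ≤ (k : ℕ)
  status : ∀ i, (S.lastFrozen i = ⊤ ∧ I.utility i (S.bundle i) = k * I.a i) ∨
    ((∀ g ∈ S.goods, ¬ I.Large i g) ∧ ∀ j, Settled I S i j)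

theorem inv_start (hn : 0 < n) (I : BiInstance n m) : Inv I 0 (start n m) where
  disj := by simp [start]
  cover := by simp [start]
  fresh := by simp [start]
  count := by simp [start]
  card_le := by simp [start]
  missed := fun i => by
    have := I.floor_ratio_sub_one i
    simp only [start, Finset.card_empty]
    omega
  never := by simp [start]
  someone := ⟨⟨0, hn⟩, rfl⟩
  round_eq := rfl
  last_le := by simp [start]
  status := fun i => Or.inl ⟨rfl, by simp [start, BiInstance.utility]⟩

theorem mem_unfrozen {i : Fin n} : i ∈ unfrozen S ↔ S.frozen i = 0 := by simp [unfrozen]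

theorem Inv.unfrozen_nonempty {k : ℕ} (h : Inv I k S) : (unfrozen S).Nonempty := by
  obtain ⟨i, hi⟩ := h.someone
  exact ⟨i, mem_unfrozen.2 (h.never i hi).1⟩

/-- The bundles are envy-free up to any good between any two rounds. -/
theorem Inv.efx {k : ℕ} (h : Inv I k S) : I.EFX S.bundle := by
  intro i j g hg
  have hsub : I.utility i (S.bundle j \ {g}) ≤ I.utility i (S.bundle j) :=
    I.utility_mono i Finset.sdiff_subset
  rcases h.status i with ⟨_, hu⟩ | ⟨_, hs⟩
  · rw [hu]
    exact I.utility_sdiff_le i hg ((h.card_le j).trans (Nat.le_succ k))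
  · rcases hs j with h1 | ⟨h1, _⟩ | ⟨_, _, _, _, h1⟩
    · have : 0 ≤ (S.frozen i : ℝ) * I.b i := mul_nonneg (Nat.cast_nonneg _) (I.b_pos i).le
      linarith
    · linarith
    · exact h1 g hg

theorem Inv.isAllocation {k : ℕ} (h : Inv I k S) (hg : S.goods = ∅) : IsAllocation S.bundle :=
  ⟨h.disj, fun g => h.cover g (by simp [hg])⟩

theorem Inv.frozen_le {k : ℕ} (h : Inv I k S) (i : Fin n) :
    (S.frozen i : ℤ) ≤ ⌊I.ratio i⌋ - 1 := by
  have h1 := h.missed i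
  have h2 := h.card_le i
  have h3 : (⌊I.ratio i⌋₊ : ℤ) = ⌊I.ratio i⌋ :=
    Int.natCast_floor_eq_floor (zero_lt_one.trans (I.one_lt_ratio i)).le
  omega

theorem Inv.missed_le {k : ℕ} (h : Inv I k S) (i : Fin n) :
    (k : ℤ) - ((S.bundle i).card : ℤ) ≤ ⌊I.ratio i⌋ - 1 := by
  have h1 := h.missed i
  have h3 : (⌊I.ratio i⌋₊ : ℤ) = ⌊I.ratio i⌋ :=
    Int.natCast_floor_eq_floor (zero_lt_one.trans (I.one_lt_ratio i)).le
  omega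

theorem utility_union (hA : IsHandout S A) (hf : ∀ i, ∀ g ∈ S.bundle i, g ∉ S.goods) (i j : Fin n) :
    I.utility i (S.bundle j ∪ (A j).toFinset) =
      I.utility i (S.bundle j) + I.utility i (A j).toFinset := by
  refine Finset.sum_union (Finset.disjoint_left.2 fun g hg hg' => hf j g hg ?_)
  rw [Option.mem_toFinset, Option.mem_def] at hg'
  exact (hA.1 j g hg').2

theorem utility_none (i : Fin n) {o : Option (Fin m)} (h : o = none) :
    I.utility i o.toFinset = 0 := by
  simp [h, BiInstance.utility]

theorem utility_some (i : Fin n) {o : Option (Fin m)} {g : Fin m} (h : o = some g) :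
    I.utility i o.toFinset = I.u i g := by
  simp [h, BiInstance.utility]

theorem utility_small_le (hA : IsHandout S A) {i : Fin n} (hs : ∀ g ∈ S.goods, ¬ I.Large i g)
    (j : Fin n) : I.utility i (A j).toFinset ≤ I.b i := by
  rcases h : A j with _ | g
  · rw [utility_none i rfl]; exact (I.b_pos i).le
  · rw [utility_some i rfl, I.u_eq_b (hs g (hA.1 j g h).2)]

theorem le_utility_some {i : Fin n} (h : A i ≠ none) : I.b i ≤ I.utility i (A i).toFinset := by
  obtain ⟨g, hg⟩ := Option.ne_none_iff_exists'.1 h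
  rw [utility_some i hg]
  exact I.b_le_u i g

theorem card_union (hA : IsHandout S A) (hf : ∀ i, ∀ g ∈ S.bundle i, g ∉ S.goods) (i : Fin n) :
    (S.bundle i ∪ (A i).toFinset).card = (S.bundle i).card + (A i).toFinset.card := by
  refine Finset.card_union_of_disjoint (Finset.disjoint_left.2 fun g hg hg' => hf i g hg ?_)
  rw [Option.mem_toFinset, Option.mem_def] at hg'
  exact (hA.1 i g hg').2

theorem card_toFinset_le (o : Option (Fin m)) : o.toFinset.card ≤ 1 := by
  cases o <;> simp

theorem disjoint_union (hA : IsHandout S A) (hf : ∀ i, ∀ g ∈ S.bundle i, g ∉ S.goods)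
    (hd : ∀ i j, i ≠ j → Disjoint (S.bundle i) (S.bundle j)) (i j : Fin n) (hij : i ≠ j) :
    Disjoint (S.bundle i ∪ (A i).toFinset) (S.bundle j ∪ (A j).toFinset) := by
  rw [Finset.disjoint_left]
  intro g hg hg'
  simp only [Finset.mem_union, Option.mem_toFinset, Option.mem_def] at hg hg'
  rcases hg with hg | hg <;> rcases hg' with hg' | hg'
  · exact Finset.disjoint_left.1 (hd i j hij) hg hg'
  · exact hf i g hg (hA.1 j g hg').2
  · exact hf j g hg' (hA.1 i g hg).2
  · exact hij (hA.2 i j g hg hg')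

/-- An agent who was never frozen gets a remaining good before the agents who were. -/
theorem efx_after_lastRound {k : ℕ} (h : Inv I k S) (hA : IsHandout S A)
    (hp : ∀ i ∈ unfrozen S, ∀ j ∈ unfrozen S, A i ≠ none → A j = none →
      S.lastFrozen j ≤ S.lastFrozen i) :
    I.EFX fun i => S.bundle i ∪ (A i).toFinset := by
  intro i j g hg
  have hnn : 0 ≤ I.utility i (A i).toFinset :=
    Finset.sum_nonneg fun g _ => (I.b_pos i).le.trans (I.b_le_u i g)
  have hui := utility_union (I := I) hA h.fresh i i
  have huj := utility_union (I := I) hA h.fresh i j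
  rcases h.status i with ⟨_, hu⟩ | ⟨hl, hs⟩
  · have hc : (S.bundle j ∪ (A j).toFinset).card ≤ k + 1 := by
      rw [card_union hA h.fresh]
      exact Nat.add_le_add (h.card_le j) (card_toFinset_le _)
    have := I.utility_sdiff_le i hg hc
    rw [hui, hu]
    linarith
  · have hsd := I.utility_sdiff i hg
    have hj := utility_small_le hA hl j
    have hfi : 0 ≤ (S.frozen i : ℝ) * I.b i := mul_nonneg (Nat.cast_nonneg _) (I.b_pos i).le
    rw [huj] at hsd
    rw [hui]
    rcases hs j with h1 | ⟨h1, _⟩ | ⟨hi0, hi, hjt, h1, h2⟩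
    · linarith
    · linarith
    · rcases hAj : A j with _ | g'
      · simp only [hAj, Option.toFinset_none, Finset.union_empty] at hg ⊢
        have := h2 g hg
        linarith
      · have hju := (hA.1 j g' hAj).1
        have hj0 := mem_unfrozen.1 hju
        have hAi : A i ≠ none := by
          intro hAi
          have := hp j hju i (mem_unfrozen.2 hi0) (by simp [hAj]) hAi
          rw [hi, top_le_iff] at this
          exact hjt this
        have := le_utility_some (I := I) hAi
        rw [hj0] at h1
        rw [hAj] at hsd hj
        push_cast at h1
        linarith

section FullRound

variable {k : ℕ}

theorem freezeRounds_eq_zero {i : Fin n} (h : ∀ i₀, ¬ OnPathFrom I S T i₀ i) :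
    freezeRounds I S T i = 0 := by
  refine Nat.le_zero.1 (Finset.sup_le fun i₀ _ => ?_)
  rw [if_neg (h i₀)]

theorem le_freezeRounds {i₀ i : Fin n} (h : OnPathFrom I S T i₀ i) :
    ⌊I.ratio i₀ - 1⌋₊ ≤ freezeRounds I S T i := by
  classical
  refine le_trans ?_ (Finset.le_sup (Finset.mem_univ i₀))
  rw [if_pos h]

theorem freezeRounds_le_of_imp {i : Fin n} {x : ℕ}
    (h : ∀ i₀, OnPathFrom I S T i₀ i → ⌊I.ratio i₀ - 1⌋₊ ≤ x) : freezeRounds I S T i ≤ x := by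
  refine Finset.sup_le fun i₀ _ => ?_
  split_ifs with h'
  · exact h i₀ h'
  · exact Nat.zero_le _

/-- An agent for whom a large good is left was never frozen and got a large good in every round. -/
theorem Inv.active_of_edge (h : Inv I k S) {i : Fin n} {g : Fin m} (he : Edge I S i g) :
    S.lastFrozen i = ⊤ ∧ I.utility i (S.bundle i) = k * I.a i := by
  rcases h.status i with h | ⟨h, _⟩
  · exact h
  · exact (h g he.2.1 he.2.2).elim

/-- The invariant is preserved by full rounds. -/
theorem Inv.full (h : Inv I k S) (hT : IsMaxMatching I S T)
    (hadj : ∀ T'', ¬ AdjustStep I S T T'') (hA : IsHandout S A)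
    (hAu : ∀ i ∈ unfrozen S, A i ≠ none) (hTA : ∀ i g, T i = some g → A i = some g) :
    Inv I (k + 1) (afterRound I S T A) := by
  have hfl : ∀ i₀ i, OnPathFrom I S T i₀ i → ⌊I.ratio i₀ - 1⌋₊ ≤ ⌊I.ratio i - 1⌋₊ :=
    fun i₀ i hp => Nat.floor_mono (sub_le_sub_right (ratio_le_of_reach hadj hp.reach) 1)
  have hfr : ∀ i, freezeRounds I S T i ≤ ⌊I.ratio i - 1⌋₊ := fun i =>
    freezeRounds_le_of_imp fun i₀ hp => hfl i₀ i hp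
  have honp : ∀ {i₀ i}, OnPathFrom I S T i₀ i → ∃ g, T i = some g ∧ Edge I S i g := by
    intro i₀ i hp
    obtain ⟨g, hg⟩ := hp.matched
    exact ⟨g, hg, hT.1.1 i g hg⟩
  have hAnone : ∀ i, S.frozen i ≠ 0 → A i = none := by
    intro i hi
    by_contra hne
    obtain ⟨g, hg⟩ := Option.ne_none_iff_exists'.1 hne
    exact hi (mem_unfrozen.1 (hA.1 i g hg).1)
  have hcardA : ∀ i, S.frozen i = 0 → (A i).toFinset.card = 1 := by
    intro i hi
    obtain ⟨g, hg⟩ := Option.ne_none_iff_exists'.1 (hAu i (mem_unfrozen.2 hi))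
    simp [hg]
  have hgoods : ∀ g, g ∈ (afterRound I S T A).goods ↔ g ∈ S.goods ∧ ∀ i, A i ≠ some g := by
    intro g; simp [afterRound]
  have hfz0 : ∀ i, S.frozen i = 0 → (afterRound I S T A).frozen i = freezeRounds I S T i := by
    intro i hi; simp [afterRound, hi]
  have hfz1 : ∀ i, S.frozen i ≠ 0 → (afterRound I S T A).frozen i = S.frozen i - 1 := by
    intro i hi; simp [afterRound, hi]
  have hlf0 : ∀ i, (∀ i₀, ¬ OnPathFrom I S T i₀ i) →
      (afterRound I S T A).lastFrozen i = S.lastFrozen i := by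
    intro i hi; simp [afterRound, hi]
  have hlf1 : ∀ i i₀, OnPathFrom I S T i₀ i →
      (afterRound I S T A).lastFrozen i = ((k + 1 : ℕ) : WithTop ℕ) := by
    intro i i₀ hi
    have : ∃ i₀, OnPathFrom I S T i₀ i := ⟨i₀, hi⟩
    simp [afterRound, this, h.round_eq]
  have hub : ∀ i j, I.utility i ((afterRound I S T A).bundle j) =
      I.utility i (S.bundle j) + I.utility i (A j).toFinset := fun i j =>
    utility_union hA h.fresh i j
  have hcard : ∀ i, ((afterRound I S T A).bundle i).card =
      (S.bundle i).card + (A i).toFinset.card := fun i => card_union hA h.fresh i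
  have hcard_le : ∀ i, ((afterRound I S T A).bundle i).card ≤ k + 1 := by
    intro i
    rw [hcard]
    exact Nat.add_le_add (h.card_le i) (card_toFinset_le _)
  refine ⟨?_, ?_, ?_, ?_, hcard_le, ?_, ?_, ?_, by simp [afterRound, h.round_eq], ?_, ?_⟩
  · exact disjoint_union hA h.fresh h.disj
  · intro g hg
    rw [hgoods] at hg
    by_cases hgs : g ∈ S.goods
    · have : ∃ i, A i = some g := by
        by_contra hne
        exact hg ⟨hgs, fun i hi => hne ⟨i, hi⟩⟩
      obtain ⟨i, hi⟩ := this
      exact ⟨i, by simp [afterRound, hi]⟩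
    · obtain ⟨i, hi⟩ := h.cover g hgs
      exact ⟨i, Finset.mem_union_left _ hi⟩
  · intro i g hgi hgg
    rw [hgoods] at hgg
    have : g ∈ S.bundle i ∪ (A i).toFinset := hgi
    rw [Finset.mem_union, Option.mem_toFinset, Option.mem_def] at this
    rcases this with h' | h'
    · exact h.fresh i g h' hgg.1
    · exact hgg.2 i h'
  · obtain ⟨i, hi⟩ := h.unfrozen_nonempty
    obtain ⟨g, hg⟩ := Option.ne_none_iff_exists'.1 (hAu i hi)
    have hlt : (afterRound I S T A).goods.card < S.goods.card := by
      refine Finset.card_lt_card ⟨fun g' hg' => ((hgoods g').1 hg').1, fun hsub => ?_⟩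
      exact ((hgoods g).1 (hsub (hA.1 i g hg).2)).2 i hg
    have := h.count
    omega
  · intro i
    have h1 := h.missed i
    rw [hcard]
    by_cases hi : S.frozen i = 0
    · rw [hfz0 i hi, hcardA i hi]
      have h2 := I.floor_ratio_sub_one i
      by_cases hp : ∃ i₀, OnPathFrom I S T i₀ i
      · obtain ⟨i₀, hp⟩ := hp
        obtain ⟨g, _, he⟩ := honp hp
        have h3 := (h.never i (h.active_of_edge he).1).2
        have h4 := hfr i
        omega
      · rw [freezeRounds_eq_zero (not_exists.1 hp)]
        omega
    · rw [hfz1 i hi, hAnone i hi]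
      simp only [Option.toFinset_none, Finset.card_empty]
      omega
  · intro i hi
    have hp : ∀ i₀, ¬ OnPathFrom I S T i₀ i := by
      intro i₀ hp
      rw [hlf1 i i₀ hp] at hi
      exact WithTop.coe_ne_top hi
    rw [hlf0 i hp] at hi
    have h1 := h.never i hi
    rw [hfz0 i h1.1, freezeRounds_eq_zero hp, hcard, hcardA i h1.1, h1.2]
    exact ⟨rfl, rfl⟩
  · -- the start of a nontrivial alternating path is never frozen
    by_cases hp : ∃ i₀ i, OnPathFrom I S T i₀ i
    · obtain ⟨i₀, i, hp⟩ := hp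
      refine ⟨i₀, ?_⟩
      have hnp : ∀ i₁, ¬ OnPathFrom I S T i₁ i₀ := by
        intro i₁ hp'
        obtain ⟨g, hg⟩ := hp'.matched
        rw [hp.start.2] at hg
        cases hg
      rw [hlf0 i₀ hnp]
      obtain ⟨l, hl, hi⟩ := hp
      cases l with
      | nil => simp at hi
      | cons j l =>
        have hc := hl.2.2.2
        rw [List.isChain_cons_cons] at hc
        obtain ⟨g, he, _⟩ := hc.1
        exact (h.active_of_edge he).1
    · push Not at hp
      obtain ⟨i, hi⟩ := h.someone
      exact ⟨i, by rw [hlf0 i fun i₀ => hp i₀ i]; exact hi⟩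
  · intro i hi
    by_cases hp : ∃ i₀, OnPathFrom I S T i₀ i
    · obtain ⟨i₀, hp⟩ := hp
      rw [hlf1 i i₀ hp]
    · rw [hlf0 i (not_exists.1 hp)] at hi ⊢
      exact (h.last_le i hi).trans (by exact_mod_cast Nat.le_succ k)
  · intro i
    have hbp := I.b_pos i
    have hab := I.b_lt_a i
    rcases h.status i with ⟨hlast, hu⟩ | ⟨hl, hs⟩
    · have hi0 := (h.never i hlast).1
      have hiu := mem_unfrozen.2 hi0
      by_cases hr : ∃ i₀, Reach I S T i₀ i
      · -- from this round on no large good is left for `i`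
        right
        have hmat : ∀ g ∈ S.goods, I.Large i g → ∃ j, T j = some g := by
          intro g hg hlg
          obtain ⟨i₀, hr⟩ := hr
          exact hT.good_matched hr ⟨hiu, hg, hlg⟩
        refine ⟨?_, ?_⟩
        · intro g hg hlg
          rw [hgoods] at hg
          obtain ⟨j, hj⟩ := hmat g hg.1 hlg
          exact hg.2 j (hTA j g hj)
        intro j
        have huj : I.utility i (S.bundle j) ≤ k * I.a i :=
          (I.utility_le i _).trans
            (mul_le_mul_of_nonneg_right (by exact_mod_cast h.card_le j) (I.a_pos i).le)
        have hAj : (∃ g, A j = some g ∧ T j = some g ∧ I.Large i g ∧ Edge I S i g) ∨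
            I.utility i (A j).toFinset ≤ I.b i := by
          rcases hAj : A j with _ | g
          · right; rw [utility_none i rfl]; exact hbp.le
          · by_cases hlg : I.Large i g
            · have hgj := hA.1 j g hAj
              obtain ⟨j', hj'⟩ := hmat g hgj.2 hlg
              have : j' = j := hA.2 _ _ g (hTA j' g hj') hAj
              subst this
              exact Or.inl ⟨g, rfl, hj', hlg, hiu, hgj.2, hlg⟩
            · right; rw [utility_some i rfl, I.u_eq_b hlg]
        -- the two cases are an unmatched agent and an agent on a nontrivial alternating path
        rcases hTi : T i with _ | g₀
        · have hnp : ∀ i₀, ¬ OnPathFrom I S T i₀ i := by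
            intro i₀ hp
            obtain ⟨g, hg⟩ := hp.matched
            rw [hTi] at hg
            cases hg
          have hfi : (afterRound I S T A).frozen i = 0 := by
            rw [hfz0 i hi0, freezeRounds_eq_zero hnp]
          have hgi := le_utility_some (I := I) (hAu i hiu)
          unfold Settled
          rw [hub, hub, hu, hfi]
          rcases hAj with ⟨g, hAg, hTg, hlg, he⟩ | hAj
          · have hp := (Reach.refl hiu hTi).extend he hTg
            have hj0 := mem_unfrozen.1 (hA.1 j g hAg).1
            refine Or.inr (Or.inr ⟨rfl, by rw [hlf0 i hnp]; exact hlast, ?_, ?_, ?_⟩)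
            · rw [hlf1 j i hp]; exact WithTop.coe_ne_top
            · rw [hfz0 j hj0]
              have h1 : ((⌊I.ratio i - 1⌋₊ : ℕ) : ℝ) ≤ freezeRounds I S T j := by
                exact_mod_cast le_freezeRounds hp
              have h2 := Nat.lt_floor_add_one (I.ratio i - 1)
              -- `r_i < ⌊r_i - 1⌋ + 2`, and `j` is frozen for at least `⌊r_i - 1⌋` rounds
              have h3 : I.ratio i * I.b i ≤ ((freezeRounds I S T j : ℝ) + 2) * I.b i :=
                mul_le_mul_of_nonneg_right (by linarith) hbp.le
              rw [I.ratio_mul_b] at h3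
              rw [utility_some i hAg, show I.u i g = I.a i from hlg]
              linarith
            · intro g' hg'
              have := I.utility_sdiff_le i hg' (hcard_le j)
              linarith
          · left
            push_cast
            linarith
        · have hp : ∃ i₀, OnPathFrom I S T i₀ i := by
            obtain ⟨i₀, hr⟩ := hr
            refine ⟨i₀, hr.onPathFrom ?_⟩
            rintro rfl
            rw [hr.start.2] at hTi
            cases hTi
          have hAi : I.utility i (A i).toFinset = I.a i := by
            rw [utility_some i (hTA i g₀ hTi)]
            exact (hT.1.1 i g₀ hTi).2.2
          unfold Settled
          rw [hub, hub, hu, hAi, hfz0 i hi0]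
          rcases hAj with ⟨g, hAg, hTg, hlg, he⟩ | hAj
          · right; left
            refine ⟨?_, ?_⟩
            · rw [utility_some i hAg, show I.u i g = I.a i from hlg]
              linarith
            · rw [hfz0 j (mem_unfrozen.1 (hA.1 j g hAg).1)]
              exact freezeRounds_le_of_imp fun i₀ hp' =>
                le_freezeRounds (hp'.reach.extend he hTg)
          · left
            have h1 : (freezeRounds I S T i : ℝ) ≤ I.ratio i - 1 := by
              have h0 : 0 ≤ I.ratio i - 1 := by linarith [I.one_lt_ratio i]
              exact le_trans (by exact_mod_cast hfr i) (Nat.floor_le h0)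
            -- the lead `a_i - b_i` pays for at most `r_i - 1` missed rounds
            have h2 := mul_le_mul_of_nonneg_right h1 hbp.le
            rw [sub_mul, I.ratio_mul_b] at h2
            linarith
      · -- an agent who is not reached gets another large good
        left
        have hnp : ∀ i₀, ¬ OnPathFrom I S T i₀ i := fun i₀ hp => hr ⟨i₀, hp.reach⟩
        refine ⟨by rw [hlf0 i hnp]; exact hlast, ?_⟩
        rcases hTi : T i with _ | g
        · exact (hr ⟨i, Reach.refl hiu hTi⟩).elim
        · rw [hub, hu, utility_some i (hTA i g hTi), show I.u i g = I.a i from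
            (hT.1.1 i g hTi).2.2]
          push_cast
          ring
    · -- no large good was left for `i` before this round, so she is not on an alternating path
      right
      refine ⟨fun g hg => hl g ((hgoods g).1 hg).1, fun j => ?_⟩
      have hnp : ∀ i₀, ¬ OnPathFrom I S T i₀ i := by
        intro i₀ hp
        obtain ⟨g, _, he⟩ := honp hp
        exact hl g he.2.1 he.2.2
      have hAj := utility_small_le hA hl j
      have hAj0 : S.frozen j ≠ 0 → I.utility i (A j).toFinset = 0 := fun hj =>
        utility_none i (hAnone j hj)
      unfold Settled
      rw [hub, hub, hlf0 i hnp]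
      by_cases hi0 : S.frozen i = 0
      · have hgi := le_utility_some (I := I) (hAu i (mem_unfrozen.2 hi0))
        rw [hfz0 i hi0, freezeRounds_eq_zero hnp]
        rcases hs j with h1 | ⟨h1, _⟩ | ⟨_, hi, hjt, h1, h2⟩
        · left
          rw [hi0] at h1
          push_cast at h1 ⊢
          linarith
        · left
          push_cast
          linarith
        · right; right
          refine ⟨rfl, hi, ?_, ?_, ?_⟩
          · by_cases hp : ∃ i₀, OnPathFrom I S T i₀ j
            · obtain ⟨i₀, hp⟩ := hp
              rw [hlf1 j i₀ hp]; exact WithTop.coe_ne_top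
            · rwa [hlf0 j (not_exists.1 hp)]
          · by_cases hj0 : S.frozen j = 0
            · have : 0 ≤ ((afterRound I S T A).frozen j : ℝ) * I.b i :=
                mul_nonneg (Nat.cast_nonneg _) hbp.le
              rw [hj0] at h1
              push_cast at h1
              linarith
            · rw [hfz1 j hj0, hAj0 hj0, Nat.cast_sub (Nat.one_le_iff_ne_zero.2 hj0)]
              push_cast
              linarith
          · intro g hg'
            by_cases hj0 : S.frozen j = 0
            · have := I.utility_sdiff i hg'
              rw [hub] at this
              rw [hj0] at h1
              push_cast at h1
              linarith
            · have e : (afterRound I S T A).bundle j = S.bundle j := by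
                simp [afterRound, hAnone j hj0]
              rw [e] at hg' ⊢
              have := h2 g hg'
              linarith
      · rw [hfz1 i hi0, utility_none i (hAnone i hi0)]
        rcases hs j with h1 | ⟨h1, h2⟩ | ⟨h0, _⟩
        · left
          rw [Nat.cast_sub (Nat.one_le_iff_ne_zero.2 hi0)]
          push_cast
          linarith
        · right; left
          have hj0 : S.frozen j ≠ 0 := by omega
          rw [hfz1 j hj0, hAj0 hj0]
          exact ⟨by linarith, by omega⟩
        · exact (hi0 h0).elim

end FullRound

/-- The properties of the state after a last round, in which fewer goods than unfrozen agents were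
left, when `k` rounds have been made. -/
structure Final (I : BiInstance n m) (k : ℕ) (S : MMFState n m) : Prop where
  goods_eq : S.goods = ∅
  le : k ≤ m
  frozen_le : ∀ i, (S.frozen i : ℤ) ≤ ⌊I.ratio i⌋ - 1
  isAllocation : IsAllocation S.bundle
  efx : I.EFX S.bundle

theorem Inv.last {k : ℕ} {S' : MMFState n m} (h : Inv I k S) (hS : LastRound S S') :
    Final I (k + 1) S' := by
  obtain ⟨hg, _, A, hA, hall, hp, rfl⟩ := hS
  refine ⟨rfl, ?_, h.frozen_le, ⟨disjoint_union hA h.fresh h.disj, fun g => ?_⟩,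
    efx_after_lastRound h hA hp⟩
  · have := h.count
    have := Finset.card_pos.2 hg
    omega
  · by_cases hgs : g ∈ S.goods
    · obtain ⟨i, hi⟩ := hall g hgs
      exact ⟨i, by simp [hi]⟩
    · obtain ⟨i, hi⟩ := h.cover g hgs
      exact ⟨i, Finset.mem_union_left _ hi⟩

theorem ReachedIn.inv_or_final (hn : 0 < n) {k : ℕ} (h : ReachedIn I k S) :
    Inv I k S ∨ Final I k S := by
  unfold ReachedIn at h
  generalize hs : start n m = S₀ at h
  induction h with
  | zero => subst hs; exact Or.inl (inv_start hn I)
  | succ _ hR ih =>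
    rcases ih hs with ih | ih
    · rcases hR with ⟨_, _, T₀, T, A, hT₀, ⟨⟨l, hl⟩, hadj⟩, hA, hAu, hTA, rfl⟩ | hR
      · exact Or.inl (ih.full (hT₀.of_steps hl) hadj hA hAu hTA)
      · exact Or.inr (ih.last hR)
    · rcases hR with hR | hR <;>
      · have := hR.1
        simp [ih.goods_eq] at this

end MMF

/-! ### A language of bounded loops -/

namespace Mini

/-- The arrays of the machine that a command may write.  In `out`, `taken` and `frozen` the agent `i` or
the good `g` has cell `i` or `g`.  In `last`, `done`, `label` and `value` the agent `i` has cell `i + 1`,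
and the entries of `owner`, `best`, `cur` and `temp` are agents stored as `i + 1`, so that `0` stands for
nobody.  The arrays `count`, `best`, `cur`, `temp`, `agents`, `goods` and `round` are variables, of which
only cell `0` is used. -/
inductive Arr
  | out | taken | frozen | last | owner | done | label | value
  | count | best | cur | temp | agents | goods | round
  deriving DecidableEq

/-- The number of an array; the output array is array `4` of the machine. -/
def Arr.code : Arr → ℕ
  | .out => 4 | .taken => 5 | .frozen => 6 | .last => 7 | .owner => 8 | .done => 9
  | .label => 10 | .value => 11 | .count => 12 | .best => 13 | .cur => 14 | .temp => 15
  | .agents => 16 | .goods => 17 | .round => 18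

theorem Arr.code_injective {a b : Arr} (h : a.code = b.code) : a = b := by
  cases a <;> cases b <;> first | rfl | exact absurd h (by decide)

theorem Arr.code_bounds (a : Arr) : 4 ≤ a.code ∧ a.code < 20 := by
  cases a <;> decide

/-- The contents of the arrays. -/
abbrev Store := Arr → ℕ → ℕ

/-- Writing `v` into cell `x` of the array `a`. -/
def Store.write (s : Store) (a : Arr) (x v : ℕ) : Store :=
  Function.update s a (Function.update (s a) x v)

theorem Store.write_apply (s : Store) (a b : Arr) (x y v : ℕ) :
    s.write a x v b y = if b = a ∧ y = x then v else s b y := by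
  unfold Store.write
  by_cases h : b = a
  · subst h
    by_cases hy : y = x
    · subst hy; simp
    · simp [hy]
  · simp [h]

@[simp] theorem Store.write_ne (s : Store) {a b : Arr} (x v : ℕ) (h : b ≠ a) :
    s.write a x v b = s b := by
  simp [Store.write, h]

theorem Store.write_same (s : Store) (a : Arr) (x y v : ℕ) :
    s.write a x v a y = if y = x then v else s a y := by
  simp [Store.write_apply]

@[simp] theorem Store.write_self (s : Store) (a : Arr) (x v : ℕ) : s.write a x v a x = v := by
  simp [Store.write_apply]

/-- The read-only input: the numbers of agents and goods, which agent finds which good large, the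
order of the ratios, and their floors. -/
structure Inp where
  n : ℕ
  m : ℕ
  edge : ℕ → ℕ → Prop
  ratioLT : ℕ → ℕ → Prop
  floor : ℕ → ℕ

/-- The two ranges that a loop can run over. -/
inductive Index
  | agent
  | good

/-- The length of a range. -/
def Inp.size (c : Inp) : Index → ℕ
  | .agent => c.n
  | .good => c.m

/-- Numerical expressions; `var k` is the counter of the `k`-th enclosing loop, from outside. -/
inductive Ex
  | const (x : ℕ)
  | var (k : ℕ)
  | size (k : Index)
  | read (a : Arr) (e : Ex)
  | add (e f : Ex)
  | sub (e f : Ex)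
  | floor (e : Ex)

/-- The value of an expression. -/
def Ex.ev (c : Inp) (env : ℕ → ℕ) (s : Store) : Ex → ℕ
  | .const x => x
  | .var k => env k
  | .size k => c.size k
  | .read a e => s a (e.ev c env s)
  | .add e f => e.ev c env s + f.ev c env s
  | .sub e f => e.ev c env s - f.ev c env s
  | .floor e => c.floor (e.ev c env s)

/-- Conditions. -/
inductive Bx
  | lt (e f : Ex)
  | ratioLT (e f : Ex)
  | edge (e f : Ex)
  | and (a b : Bx)
  | not (a : Bx)

/-- The truth of a condition. -/
def Bx.ev (c : Inp) (env : ℕ → ℕ) (s : Store) : Bx → Prop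
  | .lt e f => e.ev c env s < f.ev c env s
  | .ratioLT e f => c.ratioLT (e.ev c env s) (f.ev c env s)
  | .edge e f => c.edge (e.ev c env s) (f.ev c env s)
  | .and a b => a.ev c env s ∧ b.ev c env s
  | .not a => ¬ a.ev c env s

/-- Commands: all loops run over the agents or over the goods, so every command halts after
polynomially many steps.  The command `set a e f` writes the value of `f` into the cell `e` of `a`. -/
inductive Cmd
  | skip
  | set (a : Arr) (e f : Ex)
  | seq (p q : Cmd)
  | ite (b : Bx) (p q : Cmd)
  | loop (k : Index) (p : Cmd)

/-- `f 0`, `f 1`, …, `f (N - 1)` applied one after the other. -/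
def iter {σ : Type*} (f : ℕ → σ → σ) : ℕ → σ → σ
  | 0, s => s
  | N + 1, s => f N (iter f N s)

theorem iter_induction {σ : Type*} {f : ℕ → σ → σ} {N : ℕ} {s : σ} (P : ℕ → σ → Prop) (h0 : P 0 s)
    (hs : ∀ x t, x < N → P x t → P (x + 1) (f x t)) : P N (iter f N s) := by
  have key : ∀ M, M ≤ N → P M (iter f M s) := by
    intro M
    induction M with
    | zero => intro _; exact h0
    | succ M ih => intro hM; exact hs M _ hM (ih (Nat.le_of_succ_le hM))
  exact key N le_rfl

open Classical in
/-- The effect of a command inside `d` loops with counters `env`. -/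
noncomputable def Cmd.run (c : Inp) : Cmd → ℕ → (ℕ → ℕ) → Store → Store
  | .skip, _, _, s => s
  | .set a e f, _, env, s => s.write a (e.ev c env s) (f.ev c env s)
  | .seq p q, d, env, s => q.run c d env (p.run c d env s)
  | .ite b p q, d, env, s => if b.ev c env s then p.run c d env s else q.run c d env s
  | .loop k p, d, env, s =>
    iter (fun x => p.run c (d + 1) (Function.update env d x)) (c.size k) s

/-! ### Compilation to the random access machine -/

/-- The array whose cell `0` is the counter of the `k`-th enclosing loop; these arrays are beyond those
of the commands. -/
def ctr (k : ℕ) : ℕ := 20 + k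

theorem Arr.code_ne_ctr (a : Arr) (k : ℕ) : a.code ≠ ctr k := by
  have := a.code_bounds
  unfold ctr
  omega

/-- The expression for the length of a range, which is part of the input. -/
def sizeExpr : Index → RAM.Expr
  | .agent => .read 0 (.const 0)
  | .good => .read 0 (.const 1)

def Ex.compile : Ex → RAM.Expr
  | .const x => .const x
  | .var k => .read (ctr k) (.const 0)
  | .size k => sizeExpr k
  | .read a e => .read a.code e.compile
  | .add e f => .add e.compile f.compile
  | .sub e f => .sub e.compile f.compile
  | .floor e => .div (.read 1 e.compile) (.read 2 e.compile)

/-- Conditions compile to expressions with value `0` or `1`.  The row index of the table of large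
goods is cut off at `n`, by truncated subtraction, to bound the cost of the multiplication. -/
def Bx.compile : Bx → RAM.Expr
  | .lt e f => .lt e.compile f.compile
  | .ratioLT e f => .lt (.mul (.read 1 e.compile) (.read 2 f.compile))
      (.mul (.read 1 f.compile) (.read 2 e.compile))
  | .edge e f => .lt (.const 0) (.read 3 (.add
      (.mul (.sub (sizeExpr .agent) (.sub (sizeExpr .agent) e.compile)) (sizeExpr .good))
      f.compile))
  | .and a b => .lt (.const 1) (.add a.compile b.compile)
  | .not a => .lt a.compile (.const 1)

/-- Compilation of a command that stands inside `d` loops. -/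
def Cmd.compile : Cmd → ℕ → RAM.Program
  | .skip, _ => .skip
  | .set a e f, _ => .assign a.code e.compile f.compile
  | .seq p q, d => .seq (p.compile d) (q.compile d)
  | .ite b p q, d => .cond b.compile (p.compile d) (q.compile d)
  | .loop k p, d => .seq (.assign (ctr d) (.const 0) (.const 0))
      (.loop (.lt (.read (ctr d) (.const 0)) (sizeExpr k)) (.seq (p.compile (d + 1))
        (.assign (ctr d) (.const 0) (.add (.read (ctr d) (.const 0)) (.const 1)))))

/-- Only counters of enclosing loops occur in the expression, which stands inside `d` loops. -/
def Ex.wf (d : ℕ) : Ex → Bool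
  | .const _ => true
  | .var k => decide (k < d)
  | .size _ => true
  | .read _ e => e.wf d
  | .add e f => e.wf d && f.wf d
  | .sub e f => e.wf d && f.wf d
  | .floor e => e.wf d

/-- Only counters of enclosing loops occur in the condition, which stands inside `d` loops. -/
def Bx.wf (d : ℕ) : Bx → Bool
  | .lt e f => e.wf d && f.wf d
  | .ratioLT e f => e.wf d && f.wf d
  | .edge e f => e.wf d && f.wf d
  | .and a b => a.wf d && b.wf d
  | .not a => a.wf d

/-- Only counters of enclosing loops occur in the command, which stands inside `d` loops. -/
def Cmd.wf : Cmd → ℕ → Bool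
  | .skip, _ => true
  | .set _ e f, d => e.wf d && f.wf d
  | .seq p q, d => p.wf d && q.wf d
  | .ite b p q, d => b.wf d && p.wf d && q.wf d
  | .loop _ p, d => p.wf (d + 1)

/-- The memory holds the input `c`, and its products have at most `ℓ` bits. -/
structure Fits (c : Inp) (ℓ : ℕ) (μ : RAM.Memory) : Prop where
  n_eq : μ 0 0 = c.n
  m_eq : μ 0 1 = c.m
  floor_eq : ∀ i, μ 1 i / μ 2 i = c.floor i
  ratio_iff : ∀ i j, μ 1 i * μ 2 j < μ 1 j * μ 2 i ↔ c.ratioLT i j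
  edge_iff : ∀ i g, 0 < μ 3 (min i c.n * c.m + g) ↔ c.edge i g
  n_le : c.n ≤ ℓ
  m_le : c.m ≤ ℓ
  nm_le : c.n * c.m ≤ ℓ
  mul_le : ∀ i j, (μ 1 i * μ 2 j).size ≤ ℓ

/-- The memory represents the input, the store and the counters of the `d` enclosing loops. -/
structure Agree (c : Inp) (ℓ d : ℕ) (env : ℕ → ℕ) (s : Store) (μ : RAM.Memory) : Prop where
  fits : Fits c ℓ μ
  store : ∀ a x, μ a.code x = s a x
  counter : ∀ k < d, μ (ctr k) 0 = env k

variable {c : Inp} {ℓ d : ℕ} {env : ℕ → ℕ} {s : Store} {μ : RAM.Memory}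

theorem Fits.of_eq {μ' : RAM.Memory} (h : Fits c ℓ μ) (he : ∀ k < 4, μ' k = μ k) :
    Fits c ℓ μ' where
  n_eq := by rw [he 0 (by norm_num)]; exact h.n_eq
  m_eq := by rw [he 0 (by norm_num)]; exact h.m_eq
  floor_eq := by rw [he 1 (by norm_num), he 2 (by norm_num)]; exact h.floor_eq
  ratio_iff := by rw [he 1 (by norm_num), he 2 (by norm_num)]; exact h.ratio_iff
  edge_iff := by rw [he 3 (by norm_num)]; exact h.edge_iff
  n_le := h.n_le
  m_le := h.m_le
  nm_le := h.nm_le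
  mul_le := by rw [he 1 (by norm_num), he 2 (by norm_num)]; exact h.mul_le

theorem Agree.eval_size (h : Agree c ℓ d env s μ) (k : Index) :
    (sizeExpr k).eval μ = c.size k := by
  cases k
  · exact h.fits.n_eq
  · exact h.fits.m_eq

theorem cost_size (μ : RAM.Memory) (k : Index) : (sizeExpr k).cost μ = 2 := by
  cases k <;> rfl

theorem Agree.eval_ex (h : Agree c ℓ d env s μ) (e : Ex) (hw : e.wf d = true) :
    e.compile.eval μ = e.ev c env s := by
  induction e with
  | const x => rfl
  | var k => exact h.counter k (by simpa [Ex.wf] using hw)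
  | size k => exact h.eval_size k
  | read a e ih => simp only [Ex.compile, RAM.Expr.eval, Ex.ev, ih hw, h.store]
  | add e f ihe ihf =>
    simp only [Ex.wf, Bool.and_eq_true] at hw
    simp only [Ex.compile, RAM.Expr.eval, Ex.ev, ihe hw.1, ihf hw.2]
  | sub e f ihe ihf =>
    simp only [Ex.wf, Bool.and_eq_true] at hw
    simp only [Ex.compile, RAM.Expr.eval, Ex.ev, ihe hw.1, ihf hw.2]
  | floor e ih => simp only [Ex.compile, RAM.Expr.eval, Ex.ev, ih hw, h.fits.floor_eq]

open Classical in
theorem Agree.eval_bx (h : Agree c ℓ d env s μ) (b : Bx) (hw : b.wf d = true) :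
    b.compile.eval μ = if b.ev c env s then 1 else 0 := by
  induction b with
  | lt e f =>
    simp only [Bx.wf, Bool.and_eq_true] at hw
    simp only [Bx.compile, RAM.Expr.eval, Bx.ev, h.eval_ex e hw.1, h.eval_ex f hw.2]
    congr
  | ratioLT e f =>
    simp only [Bx.wf, Bool.and_eq_true] at hw
    simp only [Bx.compile, RAM.Expr.eval, Bx.ev, h.eval_ex e hw.1, h.eval_ex f hw.2,
      h.fits.ratio_iff]
    congr
  | edge e f =>
    simp only [Bx.wf, Bool.and_eq_true] at hw
    have hmin : c.n - (c.n - e.ev c env s) = min (e.ev c env s) c.n := by omega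
    simp only [Bx.compile, RAM.Expr.eval, Bx.ev, h.eval_ex e hw.1, h.eval_ex f hw.2, h.eval_size,
      Inp.size, hmin, h.fits.edge_iff]
    congr
  | and a b iha ihb =>
    simp only [Bx.wf, Bool.and_eq_true] at hw
    simp only [Bx.compile, RAM.Expr.eval, Bx.ev, iha hw.1, ihb hw.2]
    by_cases ha : a.ev c env s <;> by_cases hb : b.ev c env s <;> simp [ha, hb]
  | not a iha =>
    simp only [Bx.compile, RAM.Expr.eval, Bx.ev, iha hw]
    by_cases ha : a.ev c env s <;> simp [ha]

/-- Expressions contain no multiplication, so a bound for their cost does not depend on the memory. -/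
theorem exists_cost_ex (e : Ex) : ∃ A : ℕ, ∀ μ, e.compile.cost μ ≤ A := by
  induction e with
  | const x => exact ⟨1, fun μ => le_rfl⟩
  | var k => exact ⟨2, fun μ => le_rfl⟩
  | size k => exact ⟨2, fun μ => (cost_size μ k).le⟩
  | read a e ih =>
    obtain ⟨A, hA⟩ := ih
    exact ⟨A + 1, fun μ => by simpa [Ex.compile, RAM.Expr.cost] using hA μ⟩
  | add e f ihe ihf =>
    obtain ⟨A, hA⟩ := ihe
    obtain ⟨B, hB⟩ := ihf
    refine ⟨A + B + 1, fun μ => ?_⟩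
    have := hA μ
    have := hB μ
    simp only [Ex.compile, RAM.Expr.cost]
    omega
  | sub e f ihe ihf =>
    obtain ⟨A, hA⟩ := ihe
    obtain ⟨B, hB⟩ := ihf
    refine ⟨A + B + 1, fun μ => ?_⟩
    have := hA μ
    have := hB μ
    simp only [Ex.compile, RAM.Expr.cost]
    omega
  | floor e ih =>
    obtain ⟨A, hA⟩ := ih
    refine ⟨2 * A + 3, fun μ => ?_⟩
    have := hA μ
    simp only [Ex.compile, RAM.Expr.cost]
    omega

theorem size_le_of_le {x y : ℕ} (h : x ≤ y) : x.size ≤ y :=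
  Nat.size_le.2 (h.trans_lt Nat.lt_two_pow_self)

/-- Evaluating a condition takes a number of steps that is linear in the input length. -/
theorem exists_cost_bx (b : Bx) : ∃ A : ℕ, ∀ c ℓ μ, Fits c ℓ μ → b.compile.cost μ ≤ A + A * ℓ := by
  induction b with
  | lt e f =>
    obtain ⟨A, hA⟩ := exists_cost_ex e
    obtain ⟨B, hB⟩ := exists_cost_ex f
    refine ⟨A + B + 1, fun c ℓ μ _ => ?_⟩
    have := hA μ
    have := hB μ
    simp only [Bx.compile, RAM.Expr.cost]
    exact (by omega : _ ≤ A + B + 1).trans (Nat.le_add_right _ _)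
  | ratioLT e f =>
    obtain ⟨A, hA⟩ := exists_cost_ex e
    obtain ⟨B, hB⟩ := exists_cost_ex f
    refine ⟨2 * A + 2 * B + 7, fun c ℓ μ h => ?_⟩
    have h1 := hA μ
    have h2 := hB μ
    have h3 := h.mul_le (e.compile.eval μ) (f.compile.eval μ)
    have h4 := h.mul_le (f.compile.eval μ) (e.compile.eval μ)
    have h5 : 2 * ℓ ≤ (2 * A + 2 * B + 7) * ℓ := Nat.mul_le_mul_right ℓ (by omega)
    simp only [Bx.compile, RAM.Expr.cost, RAM.Expr.eval]
    omega
  | edge e f =>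
    obtain ⟨A, hA⟩ := exists_cost_ex e
    obtain ⟨B, hB⟩ := exists_cost_ex f
    refine ⟨A + B + 15, fun c ℓ μ h => ?_⟩
    have h1 := hA μ
    have h2 := hB μ
    have h3 : ((sizeExpr .agent).eval μ - ((sizeExpr .agent).eval μ - e.compile.eval μ)) *
        (sizeExpr .good).eval μ ≤ ℓ := by
      refine le_trans ?_ h.nm_le
      change (μ 0 0 - _) * μ 0 1 ≤ _
      rw [h.n_eq, h.m_eq]
      exact Nat.mul_le_mul_right _ (Nat.sub_le _ _)
    have h4 := size_le_of_le h3
    have h5 : ℓ ≤ (A + B + 15) * ℓ := Nat.le_mul_of_pos_left ℓ (by omega)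
    simp only [Bx.compile, RAM.Expr.cost, RAM.Expr.eval, cost_size]
    omega
  | and a b iha ihb =>
    obtain ⟨A, hA⟩ := iha
    obtain ⟨B, hB⟩ := ihb
    refine ⟨A + B + 3, fun c ℓ μ h => ?_⟩
    have h1 := hA c ℓ μ h
    have h2 := hB c ℓ μ h
    simp only [Bx.compile, RAM.Expr.cost]
    nlinarith
  | not a iha =>
    obtain ⟨A, hA⟩ := iha
    refine ⟨A + 3, fun c ℓ μ h => ?_⟩
    have h1 := hA c ℓ μ h
    simp only [Bx.compile, RAM.Expr.cost]
    nlinarith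

theorem write_of_ne {k k' : ℕ} (h : k' ≠ k) (x v : ℕ) : μ.write k x v k' = μ k' :=
  Function.update_of_ne h _ _

theorem Agree.write_store (h : Agree c ℓ d env s μ) (a : Arr) (x v : ℕ) :
    Agree c ℓ d env (s.write a x v) (μ.write a.code x v) where
  fits := h.fits.of_eq fun k hk => write_of_ne (by have := a.code_bounds; omega) _ _
  store := fun b y => by
    by_cases hb : b = a
    · subst hb
      rw [Store.write_same, ← h.store]
      simp [RAM.Memory.write, Function.update_apply]
    · rw [write_of_ne (fun e => hb (Arr.code_injective e)), s.write_ne _ _ hb, h.store]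
  counter := fun k hk => by rw [write_of_ne (a.code_ne_ctr k).symm]; exact h.counter k hk

/-- Setting the counter of a new loop. -/
theorem Agree.write_counter (h : Agree c ℓ d env s μ) (x : ℕ) :
    Agree c ℓ (d + 1) (Function.update env d x) s (μ.write (ctr d) 0 x) where
  fits := h.fits.of_eq fun k hk => write_of_ne (by unfold ctr; omega) _ _
  store := fun b y => by rw [write_of_ne (b.code_ne_ctr d), h.store]
  counter := fun k hk => by
    by_cases hkd : k = d
    · subst hkd; simp [RAM.Memory.write]
    · rw [write_of_ne (by unfold ctr; omega), Function.update_of_ne hkd]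
      exact h.counter k (by omega)

/-- Leaving a loop makes its counter irrelevant. -/
theorem Agree.leave {x : ℕ} (h : Agree c ℓ (d + 1) (Function.update env d x) s μ) :
    Agree c ℓ d env s μ where
  fits := h.fits
  store := h.store
  counter := fun k hk => by
    rw [h.counter k (by omega), Function.update_of_ne (by omega)]

/-- A compiled command has the intended effect, within a number of steps that is polynomial in the
input length. -/
theorem exists_exec (p : Cmd) : ∀ d, p.wf d = true → ∃ P : Polynomial ℕ, ∀ c ℓ env s μ,
    Agree c ℓ d env s μ → ∃ t μ', RAM.Exec (p.compile d) μ t μ' ∧ t ≤ P.eval ℓ ∧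
      Agree c ℓ d env (p.run c d env s) μ' := by
  induction p with
  | skip =>
    intro d _
    exact ⟨1, fun c ℓ env s μ h => ⟨1, μ, .skip μ, by simp, h⟩⟩
  | set a e f =>
    intro d hw
    simp only [Cmd.wf, Bool.and_eq_true] at hw
    obtain ⟨A, hA⟩ := exists_cost_ex e
    obtain ⟨B, hB⟩ := exists_cost_ex f
    refine ⟨Polynomial.C (A + B + 1), fun c ℓ env s μ h => ⟨_, _, .assign _ _ _ μ, ?_, ?_⟩⟩
    · have := hA μ
      have := hB μ
      rw [Polynomial.eval_C]
      omega
    · rw [h.eval_ex e hw.1, h.eval_ex f hw.2]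
      exact h.write_store a _ _
  | seq p q ihp ihq =>
    intro d hw
    simp only [Cmd.wf, Bool.and_eq_true] at hw
    obtain ⟨P, hP⟩ := ihp d hw.1
    obtain ⟨Q, hQ⟩ := ihq d hw.2
    refine ⟨P + Q, fun c ℓ env s μ h => ?_⟩
    obtain ⟨t, μ', h1, h2, h3⟩ := hP c ℓ env s μ h
    obtain ⟨t', μ'', h1', h2', h3'⟩ := hQ c ℓ env _ μ' h3
    exact ⟨t + t', μ'', .seq h1 h1', by rw [Polynomial.eval_add]; omega, h3'⟩
  | ite b p q ihp ihq =>
    intro d hw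
    simp only [Cmd.wf, Bool.and_eq_true] at hw
    obtain ⟨A, hA⟩ := exists_cost_bx b
    obtain ⟨P, hP⟩ := ihp d hw.1.2
    obtain ⟨Q, hQ⟩ := ihq d hw.2
    refine ⟨Polynomial.C (A + 1) + Polynomial.C A * Polynomial.X + P + Q,
      fun c ℓ env s μ h => ?_⟩
    have hb := h.eval_bx b hw.1.1
    have hc := hA c ℓ μ h.fits
    simp only [Polynomial.eval_add, Polynomial.eval_mul, Polynomial.eval_C, Polynomial.eval_X]
    by_cases hbe : b.ev c env s
    · obtain ⟨t, μ', h1, h2, h3⟩ := hP c ℓ env s μ h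
      refine ⟨_, μ', .cond_true (by rw [hb, if_pos hbe]; exact one_ne_zero) h1, by omega, ?_⟩
      simpa only [Cmd.run, if_pos hbe] using h3
    · obtain ⟨t, μ', h1, h2, h3⟩ := hQ c ℓ env s μ h
      refine ⟨_, μ', .cond_false (by rw [hb, if_neg hbe]) h1, by omega, ?_⟩
      simpa only [Cmd.run, if_neg hbe] using h3
  | loop k p ih =>
    intro d hw
    obtain ⟨P, hP⟩ := ih (d + 1) hw
    refine ⟨Polynomial.X * (P + 12) + 9, fun c ℓ env s μ h => ?_⟩
    set f : ℕ → Store → Store := fun x => p.run c (d + 1) (Function.update env d x) with hf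
    -- what the loop does when `r` iterations remain
    have key : ∀ r x, x + r = c.size k → ∀ μ,
        Agree c ℓ (d + 1) (Function.update env d x) (iter f x s) μ →
        ∃ t μ', RAM.Exec (.loop (.lt (.read (ctr d) (.const 0)) (sizeExpr k))
          (.seq (p.compile (d + 1))
            (.assign (ctr d) (.const 0) (.add (.read (ctr d) (.const 0)) (.const 1))))) μ t μ' ∧
          t ≤ r * (P.eval ℓ + 12) + 6 ∧ Agree c ℓ d env (iter f (c.size k) s) μ' := by
      intro r
      induction r with
      | zero =>
        intro x hx μ hμ
        have hc0 := hμ.counter d (Nat.lt_succ_self d)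
        rw [Function.update_self] at hc0
        rw [Nat.add_zero] at hx
        subst hx
        refine ⟨_, μ, .loop_false ?_, ?_, hμ.leave⟩
        · simp [RAM.Expr.eval, hc0, hμ.eval_size]
        · simp [RAM.Expr.cost, cost_size]
      | succ r ihr =>
        intro x hx μ hμ
        have hc0 := hμ.counter d (Nat.lt_succ_self d)
        rw [Function.update_self] at hc0
        obtain ⟨t, μ', h1, h2, h3⟩ := hP c ℓ _ _ μ hμ
        have hc1 := h3.counter d (Nat.lt_succ_self d)
        rw [Function.update_self] at hc1
        have h4 := h3.leave.write_counter (x + 1)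
        obtain ⟨t', μ'', h1', h2', h3'⟩ := ihr (x + 1) (by omega) _ h4
        have hassign := RAM.Exec.assign (ctr d) (.const 0)
          (.add (.read (ctr d) (.const 0)) (.const 1)) μ'
        simp only [RAM.Expr.eval, hc1] at hassign
        refine ⟨_, μ'', .loop_true ?_ (.seq h1 hassign) h1', ?_, h3'⟩
        · simp only [RAM.Expr.eval, hc0, hμ.eval_size]
          rw [if_pos (by omega)]
          exact one_ne_zero
        · simp only [RAM.Expr.cost, cost_size]
          have : (r + 1) * (P.eval ℓ + 12) = r * (P.eval ℓ + 12) + (P.eval ℓ + 12) := by ring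
          omega
    obtain ⟨t, μ', h1, h2, h3⟩ := key (c.size k) 0 (by simp) _ (h.write_counter 0)
    refine ⟨_, μ', .seq (.assign (ctr d) (.const 0) (.const 0) μ) h1, ?_, h3⟩
    have hk : c.size k ≤ ℓ := by
      cases k
      · exact h.fits.n_le
      · exact h.fits.m_le
    have := Nat.mul_le_mul_right (P.eval ℓ + 12) hk
    simp only [Polynomial.eval_add, Polynomial.eval_mul, Polynomial.eval_X, RAM.Expr.cost]
    simp only [Polynomial.eval_ofNat]
    omega

/-! ### The program -/

/-- A sequence of commands. -/
def Cmd.block : List Cmd → Cmd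
  | [] => .skip
  | p :: l => .seq p (Cmd.block l)

/-- The content of cell `0` of an array that serves as a variable. -/
def Ex.get (a : Arr) : Ex := .read a (.const 0)

def Ex.succ (e : Ex) : Ex := .add e (.const 1)

def Ex.pred (e : Ex) : Ex := .sub e (.const 1)

/-- The condition `e = 0`. -/
def Bx.isZero (e : Ex) : Bx := .lt e (.const 1)

/-- The condition `0 < e`. -/
def Bx.pos (e : Ex) : Bx := .lt (.const 0) e

/-- The conjunction of a list of conditions; the empty one is the true condition `0 = 0`. -/
def Bx.all : List Bx → Bx
  | [] => .isZero (.const 0)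
  | [b] => b
  | b :: l => .and b (Bx.all l)

/-- Run `p` if all conditions of `l` hold. -/
def Cmd.when (l : List Bx) (p : List Cmd) : Cmd := .ite (Bx.all l) (.block p) .skip

/-- Find a best unfrozen agent who is not marked in `done`; the condition `better` says that the agent
`var 2` is better than the agent in `best`. -/
def pick (better : Bx) : Cmd := .block [
  .set .best (.const 0) (.const 0),
  .loop .agent (.when [.isZero (.read .frozen (.var 2)),
      .isZero (.read .done (.succ (.var 2))), .not (.and (.pos (.get .best)) (.not better))]
    [.set .best (.const 0) (.succ (.var 2))])]

/-- The condition that the good `g` is unallocated and large for `i`. -/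
def Bx.freeEdge (i g : Ex) : Bx := .and (.isZero (.read .taken g)) (.edge i g)

/-- The agent `var 3` gets the next label, if she has none and the good `var 4` is unallocated, large
for her, and owned by someone with a label. -/
def labelStep : Cmd := .when [.isZero (.read .label (.succ (.var 3))), .freeEdge (.var 3) (.var 4),
    .pos (.read .label (.read .owner (.var 4)))]
  [.set .count (.const 0) (.succ (.get .count)),
    .set .label (.succ (.var 3)) (.get .count)]

/-- Label the agents from whom an unmatched good can be reached, in an order in which one of the
goods next to each labelled agent is unmatched or belongs to an agent labelled earlier.  The label
of `0`, the owner of the unmatched goods, is `1`. -/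
def setLabels : Cmd := .block [
  .loop .agent (.set .label (.succ (.var 2)) (.const 0)),
  .set .label (.const 0) (.const 1),
  .set .count (.const 0) (.const 1),
  .loop .agent (.loop .agent (.loop .good labelStep))]

/-- The current agent takes the good `var 3`, if it is unallocated and large for her and its owner has
a smaller label; the owner becomes the current agent. -/
def walkStep : Cmd := .when [.pos (.get .cur), .freeEdge (.pred (.get .cur)) (.var 3),
    .pos (.read .label (.read .owner (.var 3))),
    .lt (.read .label (.read .owner (.var 3))) (.read .label (.get .cur))]
  [.set .temp (.const 0) (.read .owner (.var 3)),
    .set .owner (.var 3) (.get .cur),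
    .set .cur (.const 0) (.get .temp)]

/-- Augment the matching, starting from the agent in `best`.  Every step decreases the label of the
current agent; the walk ends with the owner `0` of the unmatched goods. -/
def walk : Cmd := .block [
  .set .cur (.const 0) (.get .best),
  .loop .agent (.loop .good walkStep)]

/-- Match the unfrozen agents greedily, by decreasing ratio. -/
def matchAll : Cmd := .loop .agent (.block [
  pick (.ratioLT (.pred (.get .best)) (.var 2)),
  .set .done (.get .best) (.const 1),
  setLabels,
  walk])

/-- Mark the matched agents. -/
def markMatched : Cmd := .block [
  .loop .agent (.set .done (.succ (.var 1)) (.const 0)),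
  .loop .good (.set .done (.read .owner (.var 1)) (.const 1))]

/-- The value of the agent `var 2` is passed on to the owner of the good `var 3`, if this good is
unallocated and large for her and the value of its owner is smaller. -/
def valueStep : Cmd := .when [.freeEdge (.var 2) (.var 3), .pos (.read .owner (.var 3)),
    .lt (.read .value (.read .owner (.var 3))) (.read .value (.succ (.var 2)))]
  [.set .value (.read .owner (.var 3)) (.read .value (.succ (.var 2)))]

/-- For every agent the largest floor of a ratio of an unmatched agent from whom she is reached by an
alternating path, or `0` if there is none.  As alternating paths have at most `n` agents, `n` sweeps
suffice. -/
def setValues : Cmd := .block [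
  .loop .agent (.ite (.and (.isZero (.read .frozen (.var 1)))
      (.isZero (.read .done (.succ (.var 1)))))
    (.set .value (.succ (.var 1)) (.floor (.var 1)))
    (.set .value (.succ (.var 1)) (.const 0))),
  .loop .agent (.loop .agent (.loop .good valueStep))]

/-- Hand out further goods to the unmatched agents, who are marked by `2`. -/
def handOut : Cmd := .loop .agent (.loop .good (.when [.isZero (.read .frozen (.var 1)),
    .isZero (.read .done (.succ (.var 1))), .isZero (.read .taken (.var 2)),
    .isZero (.read .owner (.var 2))]
  [.set .owner (.var 2) (.succ (.var 1)),
    .set .done (.succ (.var 1)) (.const 2)]))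

/-- Freeze the agents on alternating paths.  The mark `2` of the agents who were not matched keeps them
from being frozen, although they have a positive value. -/
def freeze : Cmd := .loop .agent (.ite (.isZero (.read .frozen (.var 1)))
  (.when [.lt (.read .done (.succ (.var 1))) (.const 2), .pos (.read .value (.succ (.var 1)))]
    [.set .frozen (.var 1) (.pred (.read .value (.succ (.var 1)))),
      .set .last (.succ (.var 1)) (.succ (.get .round))])
  (.set .frozen (.var 1) (.pred (.read .frozen (.var 1)))))

/-- A full round, up to the actual allocation of the goods. -/
def fullRound : Cmd := .block [matchAll, markMatched, setValues, handOut, freeze]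

/-- The last round: every remaining good goes to an agent who has the latest entry in `last` among the
unfrozen agents without a good. -/
def lastRound : Cmd := .loop .good (.when [.isZero (.read .taken (.var 1))] [
  pick (.lt (.read .last (.get .best)) (.read .last (.succ (.var 2)))),
  .set .owner (.var 1) (.get .best),
  .set .done (.get .best) (.const 1)])

/-- Count the unfrozen agents. -/
def countAgents : Cmd := .block [
  .set .agents (.const 0) (.const 0),
  .loop .agent (.when [.isZero (.read .frozen (.var 1))]
    [.set .agents (.const 0) (.succ (.get .agents))])]

/-- Count the unallocated goods. -/
def countGoods : Cmd := .block [
  .set .goods (.const 0) (.const 0),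
  .loop .good (.when [.isZero (.read .taken (.var 1))]
    [.set .goods (.const 0) (.succ (.get .goods))])]

/-- Forget the owners and the marks of the previous round. -/
def reset : Cmd := .block [
  .loop .good (.set .owner (.var 1) (.const 0)),
  .loop .agent (.set .done (.succ (.var 1)) (.const 0))]

/-- Allocate every good that has an owner, and count the round. -/
def commit : Cmd := .block [
  .loop .good (.when [.pos (.read .owner (.var 1))]
    [.set .out (.var 1) (.pred (.read .owner (.var 1))),
      .set .taken (.var 1) (.const 1)]),
  .set .round (.const 0) (.succ (.get .round))]

/-- A round, when unallocated goods are left and have been counted. -/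
def roundBody : Cmd := .block [countAgents, reset,
  .ite (.lt (.get .goods) (.get .agents)) lastRound fullRound, commit]

/-- A round, or nothing when no unallocated goods are left. -/
def oneRound : Cmd := .block [countGoods, .when [.pos (.get .goods)] [roundBody]]

/-- The whole algorithm, in at most `m` rounds.  An agent who was never frozen has the entry `m + 1` in
`last`, later than any round. -/
def main : Cmd := .block [
  .loop .agent (.set .last (.succ (.var 0)) (.succ (.size .good))),
  .loop .good oneRound]

theorem main_wf : main.wf 0 = true := by decide

/-! ### General facts about commands -/

/-- The arrays that a command may change. -/
def Cmd.writes : Cmd → List Arr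
  | .skip => []
  | .set a _ _ => [a]
  | .seq p q => p.writes ++ q.writes
  | .ite _ p q => p.writes ++ q.writes
  | .loop _ p => p.writes

/-- A command leaves the arrays that it does not write as they are. -/
theorem Cmd.run_of_notMem (c : Inp) {a : Arr} : ∀ (p : Cmd), a ∉ p.writes →
    ∀ d env s, p.run c d env s a = s a
  | .skip, _, _, _, _ => rfl
  | .set b e f, h, _, env, s => s.write_ne _ _ (by simpa [Cmd.writes] using h)
  | .seq p q, h, d, env, s => by
    simp only [Cmd.writes, List.mem_append, not_or] at h
    rw [Cmd.run, q.run_of_notMem c h.2, p.run_of_notMem c h.1]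
  | .ite b p q, h, d, env, s => by
    simp only [Cmd.writes, List.mem_append, not_or] at h
    rw [Cmd.run]
    split_ifs
    · exact p.run_of_notMem c h.1 d env s
    · exact q.run_of_notMem c h.2 d env s
  | .loop k p, h, d, env, s => by
    rw [Cmd.run]
    refine iter_induction (fun _ (t : Store) => t a = s a) rfl fun x t _ ht => ?_
    rw [p.run_of_notMem c h, ht]

@[simp] theorem Cmd.run_block_nil : (Cmd.block []).run c d env s = s := rfl

@[simp] theorem Cmd.run_block_cons (p : Cmd) (l : List Cmd) :
    (Cmd.block (p :: l)).run c d env s = (Cmd.block l).run c d env (p.run c d env s) := rfl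

@[simp] theorem Cmd.run_set (a : Arr) (e f : Ex) :
    (Cmd.set a e f).run c d env s = s.write a (e.ev c env s) (f.ev c env s) := rfl

theorem Cmd.run_loop (k : Index) (p : Cmd) : (Cmd.loop k p).run c d env s =
    iter (fun x => p.run c (d + 1) (Function.update env d x)) (c.size k) s := rfl

open Classical in
theorem Cmd.run_ite (b : Bx) (p q : Cmd) : (Cmd.ite b p q).run c d env s =
    if b.ev c env s then p.run c d env s else q.run c d env s := rfl

open Classical in
theorem Cmd.run_when (l : List Bx) (p : List Cmd) : (Cmd.when l p).run c d env s =
    if (Bx.all l).ev c env s then (Cmd.block p).run c d env s else s := rfl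

@[simp] theorem Bx.ev_all_singleton (b : Bx) : (Bx.all [b]).ev c env s ↔ b.ev c env s := Iff.rfl

@[simp] theorem Bx.ev_all_cons (b b' : Bx) (l : List Bx) :
    (Bx.all (b :: b' :: l)).ev c env s ↔ b.ev c env s ∧ (Bx.all (b' :: l)).ev c env s := Iff.rfl

@[simp] theorem Bx.ev_lt (e f : Ex) : (Bx.lt e f).ev c env s ↔ e.ev c env s < f.ev c env s :=
  Iff.rfl

@[simp] theorem Bx.ev_ratioLT (e f : Ex) :
    (Bx.ratioLT e f).ev c env s ↔ c.ratioLT (e.ev c env s) (f.ev c env s) := Iff.rfl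

@[simp] theorem Bx.ev_and (a b : Bx) : (Bx.and a b).ev c env s ↔ a.ev c env s ∧ b.ev c env s :=
  Iff.rfl

@[simp] theorem Bx.ev_not (a : Bx) : (Bx.not a).ev c env s ↔ ¬ a.ev c env s := Iff.rfl

@[simp] theorem Bx.ev_isZero (e : Ex) : (Bx.isZero e).ev c env s ↔ e.ev c env s = 0 :=
  Nat.lt_one_iff

@[simp] theorem Bx.ev_pos (e : Ex) : (Bx.pos e).ev c env s ↔ 0 < e.ev c env s := Iff.rfl

/-- The good `g` is unallocated and large for `i`. -/
def FreeEdge (c : Inp) (s : Store) (i g : ℕ) : Prop := s .taken g = 0 ∧ c.edge i g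

@[simp] theorem Bx.ev_freeEdge (i g : Ex) :
    (Bx.freeEdge i g).ev c env s ↔ FreeEdge c s (i.ev c env s) (g.ev c env s) := by
  unfold Bx.freeEdge FreeEdge
  rw [Bx.ev_and, Bx.ev_isZero]
  rfl

@[simp] theorem Ex.ev_const (x : ℕ) : (Ex.const x).ev c env s = x := rfl

@[simp] theorem Ex.ev_var (k : ℕ) : (Ex.var k).ev c env s = env k := rfl

@[simp] theorem Ex.ev_get (a : Arr) : (Ex.get a).ev c env s = s a 0 := rfl

@[simp] theorem Ex.ev_read (a : Arr) (e : Ex) : (Ex.read a e).ev c env s = s a (e.ev c env s) := rfl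

@[simp] theorem Ex.ev_succ (e : Ex) : (Ex.succ e).ev c env s = e.ev c env s + 1 := rfl

@[simp] theorem Ex.ev_pred (e : Ex) : (Ex.pred e).ev c env s = e.ev c env s - 1 := rfl

@[simp] theorem Ex.ev_floor (e : Ex) : (Ex.floor e).ev c env s = c.floor (e.ev c env s) := rfl

@[simp] theorem Ex.ev_size (k : Index) : (Ex.size k).ev c env s = c.size k := rfl

/-- If each step of a sweep either does nothing or increases a measure, then after as many sweeps as
the measure can increase, no further step applies. -/
theorem iter_saturate {σ : Type*} (f : ℕ → ℕ → σ → σ) (G : ℕ → ℕ → σ → Prop) (J : σ → Prop)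
    (meas : σ → ℕ) {N A B : ℕ} {s : σ} (h0 : J s)
    (hG : ∀ i < A, ∀ g < B, ∀ t, J t → G i g t → J (f i g t) ∧ meas t < meas (f i g t))
    (hn : ∀ i < A, ∀ g < B, ∀ t, J t → ¬ G i g t → f i g t = t)
    (hb : ∀ t, J t → meas t ≤ meas s + N) :
    J (iter (fun _ => iter (fun i => iter (f i) B) A) N s) ∧
      ∀ i < A, ∀ g < B, ¬ G i g (iter (fun _ => iter (fun i => iter (f i) B) A) N s) := by
  have sweep : ∀ t, J t → J (iter (fun i => iter (f i) B) A t) ∧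
      ((iter (fun i => iter (f i) B) A t = t ∧ ∀ i < A, ∀ g < B, ¬ G i g t) ∨
        meas t < meas (iter (fun i => iter (f i) B) A t)) := by
    intro t ht
    refine iter_induction
      (fun x u => J u ∧ ((u = t ∧ ∀ i < x, ∀ g < B, ¬ G i g t) ∨ meas t < meas u)) ?_ ?_
    · exact ⟨ht, Or.inl ⟨rfl, fun i hi => absurd hi (Nat.not_lt_zero i)⟩⟩
    · intro x u hx ⟨hu, h⟩
      refine And.imp_right (Or.imp_left fun h' => ⟨h'.1, ?_⟩) (iter_induction
        (fun y v => J v ∧ ((v = t ∧ (∀ i < x, ∀ g < B, ¬ G i g t) ∧ ∀ g < y, ¬ G x g t) ∨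
          meas t < meas v)) ?_ ?_)
      · intro i hi
        rcases Nat.lt_succ_iff_lt_or_eq.1 hi with hi | rfl
        · exact h'.2.1 i hi
        · exact h'.2.2
      · exact ⟨hu, h.imp_left fun h' => ⟨h'.1, h'.2, fun g hg => absurd hg (Nat.not_lt_zero g)⟩⟩
      · intro y v hy ⟨hv, hvt⟩
        by_cases hGv : G x y v
        · have h1 := hG x hx y hy v hv hGv
          refine ⟨h1.1, Or.inr ?_⟩
          rcases hvt with ⟨rfl, _⟩ | hvt
          · exact h1.2
          · exact hvt.trans h1.2
        · rw [hn x hx y hy v hv hGv]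
          refine ⟨hv, hvt.imp_left fun h' => ⟨h'.1, h'.2.1, fun g hg => ?_⟩⟩
          rcases Nat.lt_succ_iff_lt_or_eq.1 hg with hg | rfl
          · exact h'.2.2 g hg
          · exact h'.1 ▸ hGv
  have key := iter_induction (f := fun _ => iter (fun i => iter (f i) B) A) (N := N) (s := s)
    (fun x t => J t ∧ ((∀ i < A, ∀ g < B, ¬ G i g t) ∨ meas s + x ≤ meas t)) ⟨h0, Or.inr le_rfl⟩
    (by
      intro x t _ ⟨ht, h⟩
      obtain ⟨h1, h2⟩ := sweep t ht
      refine ⟨h1, ?_⟩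
      rcases h2 with ⟨h2, h3⟩ | h2
      · exact Or.inl (by rw [h2]; exact h3)
      · rcases h with h | h
        · left
          have : iter (fun i => iter (f i) B) A t = t := by
            refine iter_induction (fun _ u => u = t) rfl fun i u hi hu => ?_
            refine iter_induction (fun _ v => v = t) hu fun g v hg hv => ?_
            rw [hv]
            exact hn i hi g hg t ht (h i hi g hg)
          rw [this]
          exact h
        · exact Or.inr (by omega))
  refine ⟨key.1, fun i hi g hg hGt => ?_⟩
  rcases key.2 with h | h
  · exact h i hi g hg hGt
  · have h1 := hG i hi g hg _ key.1 hGt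
    have h2 := hb _ h1.1
    omega

/-- An unfrozen agent who is not marked yet. -/
def Cand (s : Store) (i : ℕ) : Prop := s .frozen i = 0 ∧ s .done (i + 1) = 0

open Classical in
/-- `pick` finds a candidate such that no other one is better, if there is any candidate. -/
theorem run_pick (better : Bx) (R : ℕ → ℕ → Prop)
    (hR : ∀ x < c.n, ∀ b < c.n, ∀ t : Store, (∀ a, a ≠ .best → t a = s a) → t .best 0 = b + 1 →
      (better.ev c (Function.update env 2 x) t ↔ R b x))
    (irrefl : ∀ x < c.n, ¬ R x x)
    (trans : ∀ x < c.n, ∀ y < c.n, ∀ z < c.n, R x y → R y z → R x z) :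
    ((pick better).run c 2 env s .best 0 = 0 ∧ ∀ i < c.n, ¬ Cand s i) ∨
      ∃ b < c.n, (pick better).run c 2 env s .best 0 = b + 1 ∧ Cand s b ∧
        ∀ i < c.n, Cand s i → ¬ R b i := by
  have key : ∀ t : Store, t = (pick better).run c 2 env s → (∀ a, a ≠ .best → t a = s a) ∧
      ((t .best 0 = 0 ∧ ∀ i < c.n, ¬ Cand s i) ∨
      ∃ b < c.n, t .best 0 = b + 1 ∧ Cand s b ∧ ∀ i < c.n, Cand s i → ¬ R b i) := by
    rintro t rfl
    unfold pick
    simp only [Cmd.run_block_cons, Cmd.run_block_nil, Cmd.run_set, Cmd.run_loop]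
    refine iter_induction (fun x (t : Store) => (∀ a, a ≠ .best → t a = s a) ∧
      ((t .best 0 = 0 ∧ ∀ i < x, ¬ Cand s i) ∨
      ∃ b < c.n, t .best 0 = b + 1 ∧ Cand s b ∧ ∀ i < x, Cand s i → ¬ R b i)) ?_ ?_
    · exact ⟨fun a ha => s.write_ne _ _ ha, Or.inl ⟨by simp, fun i hi => absurd hi (Nat.not_lt_zero i)⟩⟩
    · intro x t hx ⟨ht, h⟩
      have hx : x < c.n := hx
      simp only [Cmd.run_when, Bx.ev_all_cons, Bx.ev_all_singleton, Bx.ev_isZero, Ex.ev_read,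
        Ex.ev_var, Function.update_self, Ex.ev_succ, Bx.ev_not, Bx.ev_and, Bx.ev_pos, Ex.ev_get,
        ht .frozen (by decide), ht .done (by decide), not_and, not_not]
      split_ifs with hc
      · simp only [Cmd.run_block_cons, Cmd.run_block_nil, Cmd.run_set, Ex.ev_const, Ex.ev_succ,
          Ex.ev_var, Function.update_self]
        refine ⟨fun a ha => by rw [t.write_ne _ _ ha, ht a ha],
          Or.inr ⟨x, hx, by simp, ⟨hc.1, hc.2.1⟩, fun i hi hci => ?_⟩⟩
        rcases Nat.lt_succ_iff_lt_or_eq.1 hi with hi | rfl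
        · rcases h with h | ⟨b, hb, hbt, _, hmax⟩
          · exact (h.2 i hi hci).elim
          · have hbx : R b x := (hR x hx b hb t ht hbt).1 (hc.2.2 (by omega))
            exact fun hxi => hmax i hi hci (trans b hb x hx i (hi.trans hx) hbx hxi)
        · exact irrefl i hx
      · refine ⟨ht, ?_⟩
        have hxc : Cand s x → 0 < t .best 0 ∧ ¬ better.ev c (Function.update env 2 x) t := by
          intro hx
          by_contra hcon
          exact hc ⟨hx.1, hx.2, fun hp => by_contra fun hb => hcon ⟨hp, hb⟩⟩
        rcases h with h | ⟨b, hb, hbt, hcb, hmax⟩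
        · refine Or.inl ⟨h.1, fun i hi hci => ?_⟩
          rcases Nat.lt_succ_iff_lt_or_eq.1 hi with hi | rfl
          · exact h.2 i hi hci
          · have := (hxc hci).1
            omega
        · refine Or.inr ⟨b, hb, hbt, hcb, fun i hi hci => ?_⟩
          rcases Nat.lt_succ_iff_lt_or_eq.1 hi with hi | rfl
          · exact hmax i hi hci
          · exact fun hbi => (hxc hci).2 ((hR i hx b hb t ht hbt).2 hbi)
  exact (key _ rfl).2

/-! ### Labels and augmentation -/

/-- A set of agents (stored as `i + 1`) such that every good next to one of them is matched, with one
of them. -/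
structure Sealed (c : Inp) (s : Store) (F : ℕ → Prop) : Prop where
  pos : ∀ x, F x → 0 < x ∧ x ≤ c.n
  closed : ∀ i < c.n, F (i + 1) → ∀ g < c.m, FreeEdge c s i g → F (s .owner g)

/-- The labels certify how the agents with a nonzero label reach an unmatched good, and that the
other agents do not reach any.  As the owner `0` of the unmatched goods has label `1`, the field `step`
also covers the agents next to an unmatched good. -/
structure Labels (c : Inp) (s : Store) : Prop where
  zero : s .label 0 = 1
  le : ∀ i < c.n, s .label (i + 1) ≤ c.n + 1
  step : ∀ i < c.n, s .label (i + 1) ≠ 0 → ∃ g < c.m, FreeEdge c s i g ∧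
    0 < s .label (s .owner g) ∧ s .label (s .owner g) < s .label (i + 1)
  closed : ∀ i < c.n, ∀ g < c.m, s .label (i + 1) = 0 → FreeEdge c s i g →
    s .label (s .owner g) = 0
  sealed : ∀ F, Sealed c s F → ∀ x, F x → s .label x = 0

/-- The invariant of the loop that computes the labels of `s` in `t`. -/
structure LabelInv (c : Inp) (s t : Store) : Prop where
  taken : t .taken = s .taken
  owner : t .owner = s .owner
  zero : t .label 0 = 1
  le : ∀ i < c.n, t .label (i + 1) ≤ t .count 0
  step : ∀ i < c.n, t .label (i + 1) ≠ 0 → ∃ g < c.m, FreeEdge c s i g ∧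
    0 < t .label (s .owner g) ∧ t .label (s .owner g) < t .label (i + 1)
  sealed : ∀ F, Sealed c s F → ∀ x, F x → t .label x = 0
  count : t .count 0 = 1 + ((Finset.range c.n).filter fun i => t .label (i + 1) ≠ 0).card

open Classical in
theorem run_labelStep (env : ℕ → ℕ) (s : Store) (i g : ℕ) :
    labelStep.run c d (Function.update (Function.update env 3 i) 4 g) s =
    if s .label (i + 1) = 0 ∧ FreeEdge c s i g ∧ 0 < s .label (s .owner g) then
      (s.write .count 0 (s .count 0 + 1)).write .label (i + 1) (s .count 0 + 1)
    else s := by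
  rw [labelStep, Cmd.run_when]
  simp

/-- After at most `n` sweeps no agent can get a further label. -/
theorem run_setLabels (hs : ∀ g < c.m, s .owner g ≤ c.n) :
    Labels c (setLabels.run c 2 env s) := by
  set u := setLabels.run c 2 env s with hu
  have hcnt : ∀ t : Store, LabelInv c s t → t .count 0 ≤ 1 + c.n := by
    intro t ht
    rw [ht.count]
    have := Finset.card_filter_le (Finset.range c.n) fun i => t .label (i + 1) ≠ 0
    rw [Finset.card_range] at this
    omega
  have key : LabelInv c s u ∧ ∀ i < c.n, ∀ g < c.m,
      ¬ (u .label (i + 1) = 0 ∧ FreeEdge c u i g ∧ 0 < u .label (u .owner g)) := by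
    simp only [setLabels, Cmd.run_block_cons, Cmd.run_block_nil, Cmd.run_set] at hu
    set s₁ := (Cmd.loop .agent (.set .label (.succ (.var 2)) (.const 0))).run c 2 env s with hs₁
    have h₁ : (∀ a, a ≠ .label → s₁ a = s a) ∧ ∀ i < c.n, s₁ .label (i + 1) = 0 := by
      rw [hs₁, Cmd.run_loop]
      refine iter_induction (fun x (t : Store) => (∀ a, a ≠ .label → t a = s a) ∧
        ∀ i < x, t .label (i + 1) = 0) ⟨fun _ _ => rfl, fun i hi => absurd hi (Nat.not_lt_zero i)⟩ ?_
      intro x t hx ⟨h, h'⟩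
      refine ⟨fun a ha => ?_, fun i hi => ?_⟩
      · rw [Cmd.run_set, Store.write_ne _ _ _ ha, h a ha]
      · rw [Cmd.run_set, Store.write_same]
        simp only [Ex.ev_succ, Ex.ev_var, Function.update_self, Ex.ev_const, Nat.add_right_cancel_iff]
        split_ifs with hix
        · rfl
        · exact h' i (by omega)
    set s₂ := (s₁.write .label ((Ex.const 0).ev c env s₁) ((Ex.const 1).ev c env s₁)).write
      .count ((Ex.const 0).ev c env _) ((Ex.const 1).ev c env _) with hs₂
    have e1 : s₂ .taken = s .taken := by
      rw [hs₂, Store.write_ne _ _ _ (by decide), Store.write_ne _ _ _ (by decide)]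
      exact h₁.1 _ (by decide)
    have e2 : s₂ .owner = s .owner := by
      rw [hs₂, Store.write_ne _ _ _ (by decide), Store.write_ne _ _ _ (by decide)]
      exact h₁.1 _ (by decide)
    have e3 : ∀ x, s₂ .label x = if x = 0 then 1 else s₁ .label x := by
      intro x
      rw [hs₂, Store.write_ne _ _ _ (by decide), Store.write_same]
      simp only [Ex.ev_const]
      congr
    have e4 : s₂ .count 0 = 1 := by
      rw [hs₂]
      simp
    have e5 : ∀ i < c.n, s₂ .label (i + 1) = 0 := fun i hi => by
      rw [e3, if_neg (Nat.succ_ne_zero i), h₁.2 i hi]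
    have h0 : LabelInv c s s₂ := by
      refine ⟨e1, e2, by rw [e3, if_pos rfl], fun i hi => by rw [e5 i hi]; exact Nat.zero_le _,
        fun i hi h => (h (e5 i hi)).elim, ?_, ?_⟩
      · intro F hF x hx
        have := hF.pos x hx
        obtain ⟨i, rfl⟩ := Nat.exists_eq_add_of_lt this.1
        rw [zero_add]
        exact e5 i (by omega)
      · rw [e4, Finset.filter_false_of_mem, Finset.card_empty]
        intro i hi
        rw [not_not]
        exact e5 i (Finset.mem_range.1 hi)
    have key := iter_saturate (N := c.n) (A := c.n) (B := c.m) (s := s₂)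
      (fun i g t => labelStep.run c 5 (Function.update (Function.update (Function.update env 2 0)
        3 i) 4 g) t)
      (fun i g (t : Store) => t .label (i + 1) = 0 ∧ FreeEdge c t i g ∧ 0 < t .label (t .owner g))
      (LabelInv c s) (fun t => t .count 0) h0 ?_ ?_ ?_
    · have hiter : iter (fun _ => iter (fun i => iter (fun g t => labelStep.run c 5
          (Function.update (Function.update (Function.update env 2 0) 3 i) 4 g) t) c.m) c.n)
          c.n s₂ = u := by
        rw [hu, Cmd.run_loop]
        congr 1
      rwa [hiter] at key
    · intro i hi g hg t ht hG
      rw [run_labelStep, if_pos hG]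
      set v := (t.write .count 0 (t .count 0 + 1)).write .label (i + 1) (t .count 0 + 1) with hv
      have hvl : ∀ x, v .label x = if x = i + 1 then t .count 0 + 1 else t .label x := by
        intro x
        rw [hv, Store.write_same, Store.write_ne _ _ _ (by decide)]
      have hvc : v .count 0 = t .count 0 + 1 := by
        rw [hv, Store.write_ne _ _ _ (by decide), Store.write_self]
      obtain ⟨hG1, hG2, hG3⟩ := hG
      have hc1 : 1 ≤ t .count 0 := by rw [ht.count]; omega
      have hFE : FreeEdge c s i g := by
        unfold FreeEdge at hG2 ⊢
        rwa [ht.taken] at hG2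
      rw [ht.owner] at hG3
      have hog : t .label (s .owner g) ≤ t .count 0 := by
        rcases Nat.eq_zero_or_pos (s .owner g) with h | h
        · rw [h, ht.zero]; exact hc1
        · have := hs g hg
          have := ht.le (s .owner g - 1) (by omega)
          rwa [Nat.sub_add_cancel h] at this
      have hne : ∀ x, 0 < t .label x → v .label x = t .label x := by
        intro x hx
        rw [hvl, if_neg]
        rintro rfl
        omega
      refine ⟨⟨?_, ?_, ?_, ?_, ?_, ?_, ?_⟩, by rw [hvc]; exact Nat.lt_succ_self _⟩
      · rw [hv, Store.write_ne _ _ _ (by decide), Store.write_ne _ _ _ (by decide), ht.taken]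
      · rw [hv, Store.write_ne _ _ _ (by decide), Store.write_ne _ _ _ (by decide), ht.owner]
      · rw [hvl, if_neg (Nat.succ_ne_zero i).symm, ht.zero]
      · intro j hj
        rw [hvl, hvc]
        split_ifs
        · exact le_rfl
        · exact (ht.le j hj).trans (Nat.le_succ _)
      · intro j hj hj0
        by_cases hji : j = i
        · subst hji
          refine ⟨g, hg, hFE, ?_⟩
          rw [hne _ hG3, hvl, if_pos rfl]
          exact ⟨hG3, Nat.lt_succ_of_le hog⟩
        · have hjl : v .label (j + 1) = t .label (j + 1) := by
            rw [hvl, if_neg (by omega)]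
          rw [hjl] at hj0 ⊢
          obtain ⟨g', hg', h1, h2, h3⟩ := ht.step j hj hj0
          refine ⟨g', hg', h1, ?_⟩
          rw [hne _ h2]
          exact ⟨h2, h3⟩
      · intro F hF x hx
        rw [hvl, if_neg, ht.sealed F hF x hx]
        rintro rfl
        have := ht.sealed F hF _ (hF.closed i hi hx g hg hFE)
        omega
      · rw [hvc, ht.count]
        have : (Finset.range c.n).filter (fun j => v .label (j + 1) ≠ 0) =
            insert i ((Finset.range c.n).filter fun j => t .label (j + 1) ≠ 0) := by
          ext j
          simp only [Finset.mem_filter, Finset.mem_insert, Finset.mem_range, hvl,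
            Nat.add_right_cancel_iff]
          by_cases hji : j = i
          · subst hji; simp [hi]
          · simp [hji]
        rw [this, Finset.card_insert_of_notMem (by simp [hG1])]
        omega
    · intro i hi g hg t ht hG
      rw [run_labelStep, if_neg hG]
    · intro t ht
      have := hcnt t ht
      change t .count 0 ≤ s₂ .count 0 + c.n
      omega
  obtain ⟨h, hf⟩ := key
  have hE : ∀ i g, FreeEdge c u i g ↔ FreeEdge c s i g := by
    intro i g
    unfold FreeEdge
    rw [h.taken]
  refine ⟨h.zero, fun i hi => ?_, fun i hi hi0 => ?_, fun i hi g hg hi0 hE => ?_, ?_⟩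
  · have := h.le i hi
    have := hcnt _ h
    omega
  · simp only [hE, h.owner]
    exact h.step i hi hi0
  · by_contra hne
    exact hf i hi g hg ⟨hi0, hE, Nat.pos_of_ne_zero hne⟩
  · intro F hF
    refine h.sealed F ⟨hF.pos, fun i hi hx g hg hE' => ?_⟩
    rw [← h.owner]
    exact hF.closed i hi hx g hg ((hE i g).2 hE')

/-- The array `owner` describes a matching. -/
structure Matched (c : Inp) (s : Store) : Prop where
  edge : ∀ g < c.m, ∀ i, s .owner g = i + 1 → i < c.n ∧ FreeEdge c s i g
  inj : ∀ g < c.m, ∀ g' < c.m, s .owner g = s .owner g' → s .owner g ≠ 0 → g = g'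

/-- The invariant of the augmentation: `t .cur 0` is the only agent who has lost her good. -/
structure WalkInv (c : Inp) (s t : Store) (b : ℕ) : Prop where
  label : t .label = s .label
  matched : Matched c t
  taken : t .taken = s .taken
  cur_le : t .cur 0 ≤ c.n
  unmatched : t .cur 0 ≠ 0 → ∀ g < c.m, t .owner g ≠ t .cur 0
  pos : 0 < s .label (t .cur 0)
  le : s .label (t .cur 0) ≤ s .label (b + 1)
  covered : ∀ i, (i = b ∨ ∃ g < c.m, s .owner g = i + 1) →
    t .cur 0 = i + 1 ∨ ∃ g < c.m, t .owner g = i + 1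
  owned : ∀ g < c.m, ∀ i, t .owner g = i + 1 → i = b ∨ ∃ g < c.m, s .owner g = i + 1
  cur_owned : ∀ i, t .cur 0 = i + 1 → i = b ∨ ∃ g < c.m, s .owner g = i + 1
  untouched : ∀ g < c.m, s .label (s .owner g) = 0 → t .owner g = s .owner g
  step : ∀ i < c.n, s .label (i + 1) ≠ 0 → s .label (i + 1) ≤ s .label (t .cur 0) →
    ∃ g < c.m, FreeEdge c s i g ∧
      0 < s .label (t .owner g) ∧ s .label (t .owner g) < s .label (i + 1)

open Classical in
theorem run_walkStep (env : ℕ → ℕ) (s : Store) (g : ℕ) :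
    walkStep.run c d (Function.update env 3 g) s =
    if 0 < s .cur 0 ∧ FreeEdge c s (s .cur 0 - 1) g ∧ 0 < s .label (s .owner g) ∧
        s .label (s .owner g) < s .label (s .cur 0) then
      ((s.write .temp 0 (s .owner g)).write .owner g (s .cur 0)).write .cur 0 (s .owner g)
    else s := by
  rw [walkStep, Cmd.run_when]
  simp

/-- An agent without a label reaches no unmatched good, and nothing changes. -/
theorem run_walk_of_label_eq_zero (h : s .label (s .best 0) = 0) :
    (walk.run c 2 env s) .owner = s .owner := by
  simp only [walk, Cmd.run_block_cons, Cmd.run_block_nil, Cmd.run_set, Cmd.run_loop]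
  refine (iter_induction (fun _ (t : Store) => t .owner = s .owner ∧ t .label (t .cur 0) = 0)
    ⟨by simp, by simpa using h⟩ ?_).1
  intro x t _ ht
  refine iter_induction (fun _ (t : Store) => t .owner = s .owner ∧ t .label (t .cur 0) = 0) ht ?_
  intro g t _ ht
  rw [run_walkStep, if_neg]
  · exact ht
  · rw [ht.2]
    exact fun h => Nat.not_lt_zero _ h.2.2.2

/-- If the agent `b` has a label, the augmentation adds her to the matched agents, and keeps the
goods of the agents without a label. -/
theorem run_walk {b : ℕ} (hL : Labels c s) (hM : Matched c s) (hb : b < c.n)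
    (hbest : s .best 0 = b + 1) (hbl : s .label (b + 1) ≠ 0)
    (hbu : ∀ g < c.m, s .owner g ≠ b + 1) :
    ∃ t, walk.run c 2 env s = t ∧ Matched c t ∧
      (∀ i, (i = b ∨ ∃ g < c.m, s .owner g = i + 1) → ∃ g < c.m, t .owner g = i + 1) ∧
      (∀ g < c.m, ∀ i, t .owner g = i + 1 → i = b ∨ ∃ g < c.m, s .owner g = i + 1) ∧
      ∀ g < c.m, s .label (s .owner g) = 0 → t .owner g = s .owner g := by
  classical
  refine ⟨_, rfl, ?_⟩
  set u := walk.run c 2 env s with hu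
  simp only [walk, Cmd.run_block_cons, Cmd.run_block_nil, Cmd.run_set, Ex.ev_const, Ex.ev_get] at hu
  set s₁ := s.write .cur 0 (s .best 0) with hs₁
  have hcur : s₁ .cur 0 = b + 1 := by rw [hs₁, Store.write_self, hbest]
  have hrest : ∀ a, a ≠ .cur → s₁ a = s a := fun a ha => s.write_ne _ _ ha
  have ho := hrest .owner (by decide)
  have hE : ∀ t : Store, t .taken = s .taken → ∀ i g, FreeEdge c t i g ↔ FreeEdge c s i g := by
    intro t ht i g
    unfold FreeEdge
    rw [ht]
  have h0 : WalkInv c s s₁ b := by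
    refine ⟨hrest _ (by decide), ⟨?_, ?_⟩, hrest _ (by decide), ?_, ?_, ?_, ?_, ?_, ?_, ?_, ?_, ?_⟩
    · intro g hg i hi
      rw [ho] at hi
      rw [hE s₁ (hrest _ (by decide))]
      exact hM.edge g hg i hi
    · rw [ho]
      exact hM.inj
    · rw [hcur]; omega
    · intro _ g hg
      rw [hcur, ho]
      exact hbu g hg
    · rw [hcur]; omega
    · rw [hcur]
    · intro i hi
      rw [hcur, ho]
      rcases hi with rfl | hi
      · exact Or.inl rfl
      · exact Or.inr hi
    · intro g hg i hi
      rw [ho] at hi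
      exact Or.inr ⟨g, hg, hi⟩
    · intro i hi
      rw [hcur] at hi
      exact Or.inl (by omega)
    · intro g _ _
      rw [ho]
    · intro i hi hi0 _
      rw [ho]
      exact hL.step i hi hi0
  have key := iter_saturate (N := c.n) (A := 1) (B := c.m) (s := s₁)
    (fun _ g t => walkStep.run c 4 (Function.update (Function.update env 2 0) 3 g) t)
    (fun _ g (t : Store) => 0 < t .cur 0 ∧ FreeEdge c t (t .cur 0 - 1) g ∧
      0 < t .label (t .owner g) ∧ t .label (t .owner g) < t .label (t .cur 0))
    (fun t => WalkInv c s t b) (fun t => s .label (b + 1) - s .label (t .cur 0)) h0 ?_ ?_ ?_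
  · have hiter : iter (fun _ => iter (fun _ => iter (fun g t => walkStep.run c 4
        (Function.update (Function.update env 2 0) 3 g) t) c.m) 1) c.n s₁ = u := by
      rw [hu, Cmd.run_loop]
      congr 1
    rw [hiter] at key
    obtain ⟨hJ, hG⟩ := key
    -- as long as there is a current agent, her label provides a further step
    have hu0 : u .cur 0 = 0 := by
      by_contra hne
      obtain ⟨i, hi⟩ := Nat.exists_eq_succ_of_ne_zero hne
      have hin : i < c.n := by have := hJ.cur_le; omega
      obtain ⟨g, hg, h1, h2, h3⟩ := hJ.step i hin (by have := hJ.pos; rw [hi] at this; exact this.ne')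
        (by rw [hi])
      refine hG 0 Nat.one_pos g hg ⟨Nat.pos_of_ne_zero hne, ?_, ?_, ?_⟩
      · rw [hE u hJ.taken, hi]; exact h1
      · rw [hJ.label]; exact h2
      · rw [hJ.label, hi]; exact h3
    refine ⟨hJ.matched, fun i hi => (hJ.covered i hi).resolve_left (by omega), hJ.owned,
      hJ.untouched⟩
  · intro _ _ g hg t ht hGt
    rw [run_walkStep, if_pos hGt]
    obtain ⟨hc0, hGE, hG1, hG2⟩ := hGt
    obtain ⟨i, hi⟩ := Nat.exists_eq_succ_of_ne_zero hc0.ne'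
    rw [hE t ht.taken, hi, Nat.succ_sub_one] at hGE
    have hin : i < c.n := by have := ht.cur_le; omega
    rw [ht.label] at hG1 hG2
    set v := ((t.write .temp 0 (t .owner g)).write .owner g (t .cur 0)).write .cur 0 (t .owner g)
      with hv
    have hvo : ∀ x, v .owner x = if x = g then i + 1 else t .owner x := by
      intro x
      rw [hv, Store.write_ne _ _ _ (by decide), Store.write_same, Store.write_ne _ _ _ (by decide),
        hi]
    have hvc : v .cur 0 = t .owner g := by rw [hv, Store.write_self]
    have hva : ∀ a, a ≠ .cur → a ≠ .owner → a ≠ .temp → v a = t a := by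
      intro a h1 h2 h3
      rw [hv, Store.write_ne _ _ _ h1, Store.write_ne _ _ _ h2, Store.write_ne _ _ _ h3]
    have hvt : v .taken = s .taken := by
      rw [hva _ (by decide) (by decide) (by decide), ht.taken]
    have hcu := ht.unmatched hc0.ne'
    rw [hi] at hcu
    refine ⟨⟨?_, ⟨?_, ?_⟩, hvt, ?_, ?_, ?_, ?_, ?_, ?_, ?_, ?_, ?_⟩, ?_⟩
    · rw [hva _ (by decide) (by decide) (by decide), ht.label]
    · intro g' hg' j hj
      rw [hvo] at hj
      rw [hE v hvt]
      split_ifs at hj with h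
      · subst h
        obtain rfl : i = j := by omega
        exact ⟨hin, hGE⟩
      · rw [← hE t ht.taken]
        exact ht.matched.edge g' hg' j hj
    · intro x hx y hy
      rw [hvo, hvo]
      split_ifs with h1 h2 h2
      · intro _ _; rw [h1, h2]
      · intro h; exact (hcu y hy h.symm).elim
      · intro h; exact (hcu x hx h).elim
      · exact ht.matched.inj x hx y hy
    · rw [hvc]
      rcases hog : t .owner g with _ | j
      · exact Nat.zero_le _
      · exact (ht.matched.edge g hg j hog).1
    · rw [hvc]
      intro hne x hx
      rw [hvo]
      split_ifs with h
      · exact fun h' => hcu g hg h'.symm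
      · exact fun h' => h (ht.matched.inj x hx g hg h' (h' ▸ hne))
    · rw [hvc]; exact hG1
    · rw [hvc]; exact hG2.le.trans ht.le
    · intro j hj
      rw [hvc]
      rcases ht.covered j hj with h | ⟨x, hx, h⟩
      · right
        exact ⟨g, hg, by rw [hvo, if_pos rfl]; omega⟩
      · by_cases hxg : x = g
        · left; rw [← hxg]; exact h
        · right; exact ⟨x, hx, by rw [hvo, if_neg hxg]; exact h⟩
    · intro x hx j hj
      rw [hvo] at hj
      split_ifs at hj with h
      · exact ht.cur_owned j (by omega)
      · exact ht.owned x hx j hj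
    · intro j hj
      rw [hvc] at hj
      exact ht.owned g hg j hj
    · intro x hx hx0
      rw [hvo]
      split_ifs with h
      · subst h
        rw [ht.untouched x hx hx0] at hG1
        omega
      · exact ht.untouched x hx hx0
    · intro j hj hj0 hjl
      rw [hvc] at hjl
      obtain ⟨x, hx, h1, h2, h3⟩ := ht.step j hj hj0 (hjl.trans hG2.le)
      have hxg : x ≠ g := by
        rintro rfl
        omega
      refine ⟨x, hx, h1, ?_⟩
      rw [hvo, if_neg hxg]
      exact ⟨h2, h3⟩
    · rw [hvc]
      have := ht.le
      omega
  · intro _ _ g _ t _ hGt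
    rw [run_walkStep, if_neg hGt]
  · intro t ht
    have h1 := ht.pos
    have h2 := hL.le b hb
    change s .label (b + 1) - s .label (t .cur 0) ≤ _ + c.n
    omega

open MMF

variable {n m : ℕ} {I : BiInstance n m} {S : MMFState n m}

/-! ### The greedy matching -/

/-- The input `c` describes the instance `I`. -/
structure Models (I : BiInstance n m) (c : Inp) : Prop where
  n_eq : c.n = n
  m_eq : c.m = m
  edge_iff : ∀ (i : Fin n) (g : Fin m), c.edge i g ↔ I.Large i g
  ratio_iff : ∀ i j : Fin n, c.ratioLT i j ↔ I.ratio i < I.ratio j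
  floor_eq : ∀ i : Fin n, c.floor i = ⌊I.ratio i⌋₊

theorem Models.irrefl (h : Models I c) : ∀ x < c.n, ¬ c.ratioLT x x := by
  intro x hx
  rw [h.n_eq] at hx
  rw [h.ratio_iff ⟨x, hx⟩ ⟨x, hx⟩]
  exact lt_irrefl _

theorem Models.trans (h : Models I c) : ∀ x < c.n, ∀ y < c.n, ∀ z < c.n,
    c.ratioLT x y → c.ratioLT y z → c.ratioLT x z := by
  intro x hx y hy z hz
  rw [h.n_eq] at hx hy hz
  rw [h.ratio_iff ⟨x, hx⟩ ⟨y, hy⟩, h.ratio_iff ⟨y, hy⟩ ⟨z, hz⟩, h.ratio_iff ⟨x, hx⟩ ⟨z, hz⟩]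
  exact lt_trans

/-- The invariant of the greedy matching.  An agent who could not be matched lies in a sealed set of
agents with at least her ratio; later augmentations do not touch such a set. -/
structure MatchInv (c : Inp) (s : Store) : Prop where
  matched : Matched c s
  owned : ∀ g < c.m, ∀ i, s .owner g = i + 1 → s .frozen i = 0 ∧ s .done (i + 1) ≠ 0
  order : ∀ i < c.n, ∀ j < c.n, s .frozen i = 0 → s .done (i + 1) ≠ 0 → Cand s j →
    ¬ c.ratioLT i j
  sealed : ∀ i < c.n, s .frozen i = 0 → s .done (i + 1) ≠ 0 → (∀ g < c.m, s .owner g ≠ i + 1) →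
    ∃ F, Sealed c s F ∧ F (i + 1) ∧ ∀ x < c.n, F (x + 1) → s .frozen x = 0 ∧ ¬ c.ratioLT x i

theorem freeEdge_congr {t : Store} (h : t .taken = s .taken) (i g : ℕ) :
    FreeEdge c t i g ↔ FreeEdge c s i g := by
  unfold FreeEdge
  rw [h]

theorem Matched.congr {t : Store} (h : Matched c s) (h1 : t .taken = s .taken)
    (h2 : t .owner = s .owner) : Matched c t where
  edge := fun g hg i hi => by
    rw [h2] at hi
    rw [freeEdge_congr h1]
    exact h.edge g hg i hi
  inj := by rw [h2]; exact h.inj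

theorem Sealed.congr {t : Store} {F : ℕ → Prop} (h : Sealed c s F) (h1 : t .taken = s .taken)
    (h2 : ∀ g < c.m, F (s .owner g) → t .owner g = s .owner g) : Sealed c t F where
  pos := h.pos
  closed := fun i hi hF g hg hE => by
    have := h.closed i hi hF g hg ((freeEdge_congr h1 i g).1 hE)
    rw [h2 g hg this]
    exact this

/-- One round of the greedy matching processes an unfrozen agent of largest ratio. -/
theorem MatchInv.step (hirr : ∀ x < c.n, ¬ c.ratioLT x x) (htr : ∀ x < c.n, ∀ y < c.n, ∀ z < c.n,
      c.ratioLT x y → c.ratioLT y z → c.ratioLT x z) (h : MatchInv c s) :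
    ∃ t, (Cmd.block [pick (.ratioLT (.pred (.get .best)) (.var 2)),
        .set .done (.get .best) (.const 1), setLabels, walk]).run c 2 env s = t ∧ MatchInv c t ∧
      ((∀ i < c.n, ¬ Cand t i) ∨
        ∃ b < c.n, Cand s b ∧ ∀ i < c.n, Cand t i → Cand s i ∧ i ≠ b) := by
  refine ⟨_, rfl, ?_⟩
  simp only [Cmd.run_block_cons, Cmd.run_block_nil, Cmd.run_set, Ex.ev_get, Ex.ev_const]
  have hpick := run_pick (c := c) (env := env) (s := s) (.ratioLT (.pred (.get .best)) (.var 2))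
    c.ratioLT (by
      intro x _ b _ t _ htb
      simp [htb]) hirr htr
  set s₁ := (pick (.ratioLT (.pred (.get .best)) (.var 2))).run c 2 env s with hs₁
  set s₂ := s₁.write .done (s₁ .best 0) 1 with hs₂
  set s₃ := setLabels.run c 2 env s₂ with hs₃
  set s₄ := walk.run c 2 env s₃ with hs₄
  have f₁ : ∀ a, a ≠ .best → s₁ a = s a := fun a ha =>
    Cmd.run_of_notMem c _ (by simpa [pick, Cmd.block, Cmd.when, Cmd.writes] using ha) _ _ _
  have f₂ : ∀ a, a ≠ .done → s₂ a = s₁ a := fun a ha => Store.write_ne _ _ _ ha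
  have f₃ : ∀ a, a ∉ setLabels.writes → s₃ a = s₂ a := fun a ha => Cmd.run_of_notMem c _ ha _ _ _
  have f₄ : ∀ a, a ∉ walk.writes → s₄ a = s₃ a := fun a ha => Cmd.run_of_notMem c _ ha _ _ _
  have e2o : s₂ .owner = s .owner := (f₂ _ (by decide)).trans (f₁ _ (by decide))
  have e2t : s₂ .taken = s .taken := (f₂ _ (by decide)).trans (f₁ _ (by decide))
  have e3o : s₃ .owner = s .owner := (f₃ _ (by decide)).trans e2o
  have e3t : s₃ .taken = s .taken := (f₃ _ (by decide)).trans e2t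
  have e4t : s₄ .taken = s .taken := (f₄ _ (by decide)).trans e3t
  have e4f : s₄ .frozen = s .frozen := by
    rw [f₄ _ (by decide), f₃ _ (by decide), f₂ _ (by decide), f₁ _ (by decide)]
  have e4d : ∀ x, s₄ .done x = if x = s₁ .best 0 then 1 else s .done x := by
    intro x
    rw [f₄ _ (by decide), f₃ _ (by decide), hs₂, Store.write_same, f₁ .done (by decide)]
  have e3b : s₃ .best 0 = s₁ .best 0 := by
    rw [f₃ _ (by decide), f₂ _ (by decide)]
  have hL : Labels c s₃ := by
    refine run_setLabels fun g hg => ?_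
    rw [e2o]
    rcases hog : s .owner g with _ | i
    · exact Nat.zero_le _
    · exact (h.matched.edge g hg i hog).1
  rcases hpick with ⟨hb0, hno⟩ | ⟨b, hb, hbest, hcb, hmax⟩
  · -- all agents are processed already
    have hwo : s₄ .owner = s₃ .owner := by
      rw [hs₄]
      simp only [walk, Cmd.run_block_cons, Cmd.run_block_nil, Cmd.run_set, Cmd.run_loop]
      refine (iter_induction (fun _ (t : Store) => t .owner = s₃ .owner ∧ t .cur 0 = 0)
        ⟨by simp, by simp [e3b, hb0]⟩ ?_).1
      intro x t _ ht
      refine iter_induction (fun _ (t : Store) => t .owner = s₃ .owner ∧ t .cur 0 = 0) ht ?_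
      intro g t _ ht
      rw [run_walkStep, if_neg]
      · exact ht
      · rw [ht.2]
        exact fun h => Nat.not_lt_zero _ h.1
    have e4o : s₄ .owner = s .owner := hwo.trans e3o
    have hd : ∀ i, s₄ .done (i + 1) = s .done (i + 1) := fun i => by
      rw [e4d, hb0, if_neg (Nat.succ_ne_zero i)]
    have hcand : ∀ i, Cand s₄ i ↔ Cand s i := fun i => by unfold Cand; rw [hd, e4f]
    refine ⟨⟨h.matched.congr e4t e4o, ?_, ?_, ?_⟩, Or.inl fun i hi => ?_⟩
    · intro g hg i hi
      rw [e4f, hd]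
      rw [e4o] at hi
      exact h.owned g hg i hi
    · intro i hi j hj
      rw [e4f, hd, hcand]
      exact h.order i hi j hj
    · intro i hi
      rw [e4f, hd, e4o]
      intro h1 h2 h3
      obtain ⟨F, hF, hF'⟩ := h.sealed i hi h1 h2 h3
      exact ⟨F, hF.congr e4t fun g _ _ => by rw [e4o], hF'⟩
    · rw [hcand]
      exact hno i hi
  · have hd : ∀ i, s₄ .done (i + 1) ≠ 0 ↔ i = b ∨ s .done (i + 1) ≠ 0 := fun i => by
      rw [e4d, hbest]
      by_cases hib : i = b
      · simp [hib]
      · simp [hib]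
    have hcand : ∀ i, Cand s₄ i ↔ Cand s i ∧ i ≠ b := fun i => by
      unfold Cand
      rw [e4f]
      have := hd i
      tauto
    have hM₃ : Matched c s₃ := h.matched.congr e3t e3o
    have hbu : ∀ g < c.m, s .owner g ≠ b + 1 := by
      intro g hg hgb
      exact (h.owned g hg b hgb).2 hcb.2
    have horder : ∀ i < c.n, ∀ j < c.n, s₄ .frozen i = 0 → s₄ .done (i + 1) ≠ 0 → Cand s₄ j →
        ¬ c.ratioLT i j := by
      intro i hi j hj h1 h2 h3
      rw [e4f] at h1
      rw [hd] at h2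
      rw [hcand] at h3
      rcases h2 with rfl | h2
      · exact hmax j hj h3.1
      · exact h.order i hi j hj h1 h2 h3.1
    have hlast : (∀ i < c.n, ¬ Cand s₄ i) ∨
        ∃ b < c.n, Cand s b ∧ ∀ i < c.n, Cand s₄ i → Cand s i ∧ i ≠ b :=
      Or.inr ⟨b, hb, hcb, fun i _ hi => (hcand i).1 hi⟩
    by_cases hbl : s₃ .label (b + 1) = 0
    · -- the agent `b` stays unmatched, and the agents without a label form a sealed set
      have e4o : s₄ .owner = s .owner :=
        (run_walk_of_label_eq_zero (by rw [e3b, hbest]; exact hbl)).trans e3o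
      refine ⟨⟨h.matched.congr e4t e4o, ?_, horder, ?_⟩, hlast⟩
      · intro g hg i hi
        rw [e4o] at hi
        have := h.owned g hg i hi
        rw [e4f, hd]
        exact ⟨this.1, Or.inr this.2⟩
      · intro i hi h1 h2 h3
        rw [hd] at h2
        by_cases hib : i = b
        · subst hib
          -- all processed agents have at least the ratio of `i`, so the unlabelled ones form her set
          refine ⟨fun x => ∃ y < c.n, x = y + 1 ∧ s .frozen y = 0 ∧ s₃ .label (y + 1) = 0 ∧
            (y = i ∨ s .done (y + 1) ≠ 0), ⟨?_, ?_⟩, ⟨i, hi, rfl, hcb.1, hbl, Or.inl rfl⟩, ?_⟩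
          · rintro x ⟨y, hy, rfl, _⟩
            exact ⟨Nat.succ_pos y, hy⟩
          · rintro x hx ⟨y, hy, hxy, h4, h5, h6⟩ g hg hE
            obtain rfl : x = y := by omega
            rw [freeEdge_congr e4t, ← freeEdge_congr e3t] at hE
            have h7 := hL.closed x hx g hg h5 hE
            rw [e3o] at h7
            rw [e4o]
            rcases hog : s .owner g with _ | j
            · rw [hog, hL.zero] at h7
              exact (one_ne_zero h7).elim
            · have h8 := h.owned g hg j hog
              rw [hog] at h7
              exact ⟨j, (h.matched.edge g hg j hog).1, rfl, h8.1, h7, Or.inr h8.2⟩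
          · rintro x hx ⟨y, hy, hxy, h4, h5, h6⟩
            obtain rfl : x = y := by omega
            rw [e4f]
            refine ⟨h4, ?_⟩
            rcases h6 with rfl | h6
            · exact hirr x hx
            · exact h.order x hx i hi h4 h6 hcb
        · rw [e4f] at h1 ⊢
          rw [e4o] at h3
          obtain ⟨F, hF, hF'⟩ := h.sealed i hi h1 (h2.resolve_left hib) h3
          exact ⟨F, hF.congr e4t fun g _ _ => by rw [e4o], hF'⟩
    · obtain ⟨t, ht, hMt, hcov, hown, hunt⟩ := run_walk (env := env) hL hM₃ hb
        (by rw [e3b, hbest]) hbl (by rw [e3o]; exact hbu)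
      rw [← hs₄] at ht
      subst ht
      rw [e3o] at hcov hown hunt
      refine ⟨⟨hMt, ?_, horder, ?_⟩, hlast⟩
      · intro g hg i hi
        rw [e4f, hd]
        rcases hown g hg i hi with rfl | ⟨g', hg', hi'⟩
        · exact ⟨hcb.1, Or.inl rfl⟩
        · exact ⟨(h.owned g' hg' i hi').1, Or.inr (h.owned g' hg' i hi').2⟩
      · intro i hi h1 h2 h3
        rw [hd] at h2
        rw [e4f] at h1 ⊢
        have hib : i ≠ b := by
          rintro rfl
          obtain ⟨g, hg, hgi⟩ := hcov i (Or.inl rfl)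
          exact h3 g hg hgi
        obtain ⟨F, hF, hF'⟩ := h.sealed i hi h1 (h2.resolve_left hib) (by
          intro g hg hgi
          obtain ⟨g', hg', hgi'⟩ := hcov i (Or.inr ⟨g, hg, hgi⟩)
          exact h3 g' hg' hgi')
        -- a sealed set reaches no unmatched good, so its agents have no label and keep their goods
        refine ⟨F, hF.congr e4t fun g hg hFg => hunt g hg ?_, hF'⟩
        exact hL.sealed F (hF.congr e3t fun g _ _ => by rw [e3o]) _ hFg

/-- The greedy matching processes all unfrozen agents. -/
theorem run_matchAll (hirr : ∀ x < c.n, ¬ c.ratioLT x x) (htr : ∀ x < c.n, ∀ y < c.n, ∀ z < c.n,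
      c.ratioLT x y → c.ratioLT y z → c.ratioLT x z) (ho : ∀ g < c.m, s .owner g = 0)
    (hd : ∀ i < c.n, s .done (i + 1) = 0) :
    MatchInv c (matchAll.run c 1 env s) ∧ ∀ i < c.n, ¬ Cand (matchAll.run c 1 env s) i := by
  classical
  have h0 : MatchInv c s := by
    refine ⟨⟨?_, ?_⟩, ?_, ?_, ?_⟩
    · intro g hg i hi
      rw [ho g hg] at hi
      exact (Nat.succ_ne_zero i hi.symm).elim
    · intro g hg _ _ _ hne
      exact (hne (ho g hg)).elim
    · intro g hg i hi
      rw [ho g hg] at hi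
      exact (Nat.succ_ne_zero i hi.symm).elim
    · intro i hi j _ _ h
      exact (h (hd i hi)).elim
    · intro i hi _ h
      exact (h (hd i hi)).elim
  rw [matchAll, Cmd.run_loop]
  have key := iter_induction (f := fun x => (Cmd.block
        [pick (.ratioLT (.pred (.get .best)) (.var 2)), .set .done (.get .best) (.const 1),
          setLabels, walk]).run c (1 + 1) (Function.update env 1 x)) (N := c.size .agent) (s := s)
    (fun x t => MatchInv c t ∧ ((Finset.range c.n).filter (Cand t)).card + x ≤ c.n ∨
      MatchInv c t ∧ ∀ i < c.n, ¬ Cand t i) ?_ ?_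
  · rcases key with ⟨h1, h2⟩ | h
    · refine ⟨h1, fun i hi hc => ?_⟩
      have : 0 < ((Finset.range c.n).filter (Cand _)).card :=
        Finset.card_pos.2 ⟨i, Finset.mem_filter.2 ⟨Finset.mem_range.2 hi, hc⟩⟩
      change _ + c.n ≤ c.n at h2
      omega
    · exact h
  · left
    refine ⟨h0, ?_⟩
    have := Finset.card_filter_le (Finset.range c.n) (Cand s)
    rwa [Finset.card_range] at this
  · intro x t _ ht
    have hI : MatchInv c t := by
      rcases ht with ht | ht
      · exact ht.1
      · exact ht.1
    obtain ⟨u, hu, hIu, hcu⟩ := hI.step (env := Function.update env 1 x) hirr htr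
    rw [hu]
    rcases hcu with hcu | ⟨b, hb, hcb, hcu⟩
    · exact Or.inr ⟨hIu, hcu⟩
    · rcases ht with ht | ht
      · left
        refine ⟨hIu, ?_⟩
        have : ((Finset.range c.n).filter (Cand u)).card <
            ((Finset.range c.n).filter (Cand t)).card := by
          refine Finset.card_lt_card ⟨fun i hi => ?_, fun hsub => ?_⟩
          · rw [Finset.mem_filter, Finset.mem_range] at hi ⊢
            exact ⟨hi.1, (hcu i hi.1 hi.2).1⟩
          · have hbt : b ∈ (Finset.range c.n).filter (Cand t) :=
              Finset.mem_filter.2 ⟨Finset.mem_range.2 hb, hcb⟩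
            exact (hcu b hb (Finset.mem_filter.1 (hsub hbt)).2).2 rfl
        have := ht.2
        omega
      · exact (ht.2 b hb hcb).elim

/-- The assignment described by the array `owner`. -/
noncomputable def assigned (w : ℕ → ℕ) (i : Fin n) : Option (Fin m) :=
  open Classical in if h : ∃ g : Fin m, w g = i + 1 then some h.choose else none

theorem assigned_eq_some {w : ℕ → ℕ} (hw : ∀ g < m, ∀ g' < m, w g = w g' → w g ≠ 0 → g = g')
    (i : Fin n) (g : Fin m) : assigned w i = some g ↔ w g = i + 1 := by
  unfold assigned
  split_ifs with h
  · rw [Option.some.injEq]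
    refine ⟨fun e => e ▸ h.choose_spec, fun e => Fin.ext ?_⟩
    refine hw _ h.choose.2 _ g.2 (h.choose_spec.trans e.symm) ?_
    rw [h.choose_spec]
    exact Nat.succ_ne_zero _
  · simp only [false_iff]
    exact fun e => h ⟨g, e⟩

theorem assigned_eq_none {w : ℕ → ℕ} (i : Fin n) :
    (assigned w i : Option (Fin m)) = none ↔ ∀ g : Fin m, w g ≠ i + 1 := by
  unfold assigned
  split_ifs with h
  · simp only [false_iff]
    exact fun h' => h' _ h.choose_spec
  · simpa using h

/-- The store shows which goods are left and who is frozen. -/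
structure Shows (S : MMFState n m) (s : Store) : Prop where
  taken : ∀ g : Fin m, s .taken g = 0 ↔ g ∈ S.goods
  frozen : ∀ i : Fin n, s .frozen i = S.frozen i

theorem Shows.congr {t : Store} (h : Shows S s) (h1 : t .taken = s .taken)
    (h2 : t .frozen = s .frozen) : Shows S t where
  taken := by rw [h1]; exact h.taken
  frozen := by rw [h2]; exact h.frozen

theorem Shows.freeEdge (h : Shows S s) (hc : Models I c) {i : Fin n} {g : Fin m}
    (hi : s .frozen i = 0) : FreeEdge c s i g ↔ Edge I S i g := by
  unfold FreeEdge Edge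
  rw [h.taken, hc.edge_iff, mem_unfrozen, ← h.frozen]
  simp [hi]

theorem Shows.edge_freeEdge (h : Shows S s) (hc : Models I c) {i : Fin n} {g : Fin m}
    (he : Edge I S i g) : FreeEdge c s i g := by
  refine (h.freeEdge hc ?_).2 he
  rw [h.frozen]
  exact mem_unfrozen.1 he.1

theorem Matched.assigned_eq_some (hM : Matched c s) (hm : c.m = m) (i : Fin n) (g : Fin m) :
    assigned (s .owner) i = some g ↔ s .owner g = i + 1 :=
  Mini.assigned_eq_some (fun g hg g' hg' => hM.inj g (hm ▸ hg) g' (hm ▸ hg')) i g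

theorem MatchInv.isMatching (hc : Models I c) (hS : Shows S s) (h : MatchInv c s) :
    IsMatching I S (assigned (s .owner)) := by
  have hsome := h.matched.assigned_eq_some (n := n) hc.m_eq
  refine ⟨fun i g hi => ?_, fun i j g hi hj => ?_⟩
  · rw [hsome] at hi
    have hg : (g : ℕ) < c.m := hc.m_eq ▸ g.2
    exact (hS.freeEdge hc (h.owned g hg i hi).1).1 (h.matched.edge g hg i hi).2
  · rw [hsome] at hi hj
    exact Fin.ext (by omega)

/-- The sealed sets of the agents who could not be matched, as sets of agents. -/
theorem MatchInv.exists_sealed (hc : Models I c) (hS : Shows S s) (h : MatchInv c s)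
    (hall : ∀ i < c.n, ¬ Cand s i) {i : Fin n} (hi : i ∈ unfrozen S)
    (hn : (assigned (s .owner) i : Option (Fin m)) = none) :
    ∃ F : Fin n → Prop, F i ∧ (∀ x, F x → x ∈ unfrozen S ∧ I.ratio i ≤ I.ratio x) ∧
      ∀ x g, F x → Edge I S x g → ∃ y, F y ∧ assigned (s .owner) y = some g := by
  have hin : (i : ℕ) < c.n := hc.n_eq ▸ i.2
  have hfi : s .frozen i = 0 := (hS.frozen i).trans (mem_unfrozen.1 hi)
  obtain ⟨F, hF, hFi, hF'⟩ := h.sealed i hin hfi (fun hd => hall i hin ⟨hfi, hd⟩) (by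
    intro g hg
    exact (assigned_eq_none i).1 hn ⟨g, hc.m_eq ▸ hg⟩)
  refine ⟨fun x => F (x + 1), hFi, fun x hx => ?_, fun x g hx hE => ?_⟩
  · have := hF' x (hc.n_eq ▸ x.2) hx
    rw [hc.ratio_iff, not_lt] at this
    exact ⟨mem_unfrozen.2 ((hS.frozen x).symm.trans this.1), this.2⟩
  · have hg : (g : ℕ) < c.m := hc.m_eq ▸ g.2
    have hFo := hF.closed x (hc.n_eq ▸ x.2) hx g hg (hS.edge_freeEdge hc hE)
    have hpos := hF.pos _ hFo
    obtain ⟨y, hy⟩ := Nat.exists_eq_succ_of_ne_zero hpos.1.ne'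
    have hyn : y < n := by have := hc.n_eq; omega
    refine ⟨⟨y, hyn⟩, ?_, ?_⟩
    · rw [hy] at hFo
      exact hFo
    · rw [h.matched.assigned_eq_some hc.m_eq]
      exact hy

/-- The greedy matching has maximum size: the sealed sets give an injection from the agents matched
by any other matching. -/
theorem MatchInv.isMaxMatching (hc : Models I c) (hS : Shows S s) (h : MatchInv c s)
    (hall : ∀ i < c.n, ¬ Cand s i) : IsMaxMatching I S (assigned (s .owner)) := by
  classical
  have hM := h.isMatching hc hS
  refine ⟨hM, fun T' hT' => ?_⟩
  set T : Fin n → Option (Fin m) := assigned (s .owner) with hT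
  -- the union of the sealed sets
  let F : Fin n → Prop := fun x => ∃ i, ∃ G : Fin n → Prop, i ∈ unfrozen S ∧ T i = none ∧ G x ∧
    ∀ x g, G x → Edge I S x g → ∃ y, G y ∧ T y = some g
  have hFun : ∀ i ∈ unfrozen S, T i = none → F i := by
    intro i hi hn
    obtain ⟨G, h1, _, h3⟩ := h.exists_sealed hc hS hall hi hn
    exact ⟨i, G, hi, hn, h1, h3⟩
  have hFcl : ∀ x g, F x → Edge I S x g → ∃ y, F y ∧ T y = some g := by
    rintro x g ⟨i, G, hi, hn, hx, hG⟩ hE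
    obtain ⟨y, hy, hyg⟩ := hG x g hx hE
    exact ⟨y, ⟨i, G, hi, hn, hy, hG⟩, hyg⟩
  -- agents in the union are mapped to the owner of their good, and all others to themselves
  have hφ : ∀ x ∈ dom T', ∃ y ∈ dom T, (F x ∧ F y ∧ T y = T' x) ∨ (¬ F x ∧ y = x) := by
    intro x hx
    obtain ⟨g, hg⟩ := mem_dom.1 hx
    have hE := hT'.1 x g hg
    by_cases hFx : F x
    · obtain ⟨y, hy, hyg⟩ := hFcl x g hFx hE
      exact ⟨y, mem_dom.2 ⟨g, hyg⟩, Or.inl ⟨hFx, hy, hyg.trans hg.symm⟩⟩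
    · refine ⟨x, ?_, Or.inr ⟨hFx, rfl⟩⟩
      rw [mem_dom, ← Option.ne_none_iff_exists']
      exact fun hn => hFx (hFun x hE.1 hn)
  choose! φ hφd hφs using hφ
  refine Finset.card_le_card_of_injOn φ hφd ?_
  intro x hx y hy hxy
  rcases hφs x hx with ⟨h1, h2, h3⟩ | ⟨h1, h2⟩ <;> rcases hφs y hy with ⟨h1', h2', h3'⟩ | ⟨h1', h2'⟩
  · obtain ⟨g, hg⟩ := mem_dom.1 hx
    refine hT'.2 x y g hg ?_
    rw [← h3', ← hxy, h3, hg]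
  · rw [hxy, h2'] at h2
    exact (h1' h2).elim
  · rw [← hxy, h2] at h2'
    exact (h1 h2').elim
  · rw [← h2, ← h2', hxy]

/-- The greedy matching needs no modification: an alternating path from `i₀` stays in the sealed set of
`i₀`, whose agents have at least her ratio. -/
theorem MatchInv.not_adjustStep (hc : Models I c) (hS : Shows S s) (h : MatchInv c s)
    (hall : ∀ i < c.n, ¬ Cand s i) (T'' : Fin n → Option (Fin m)) :
    ¬ AdjustStep I S (assigned (s .owner)) T'' := by
  rintro ⟨i₀, l, hl, hr, _⟩
  obtain ⟨F, h1, h2, h3⟩ := h.exists_sealed hc hS hall hl.1 hl.2.1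
  have hF := Reach.induction (F := F) ⟨l, hl, rfl⟩ h1 (by
    intro x g y hx hE hy
    obtain ⟨z, hz, hzg⟩ := h3 x g hx hE
    rwa [(h.isMatching hc hS).2 y z g hy hzg])
  exact absurd hr (not_lt.2 (h2 _ hF).2)

/-! ### Freezing -/

theorem run_fill_agents (a : Arr) (v : ℕ) : ∀ i < c.n,
    (Cmd.loop .agent (.set a (.succ (.var d)) (.const v))).run c d env s a (i + 1) = v := by
  rw [Cmd.run_loop]
  refine iter_induction (fun x (t : Store) => ∀ i < x, t a (i + 1) = v)
    (fun i hi => absurd hi (Nat.not_lt_zero i)) fun x t _ h i hi => ?_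
  rw [Cmd.run_set, Store.write_same]
  simp only [Ex.ev_succ, Ex.ev_var, Function.update_self, Ex.ev_const, Nat.add_right_cancel_iff]
  split_ifs
  · rfl
  · exact h i (by omega)

theorem run_fill_goods (a : Arr) (v : ℕ) : ∀ g < c.m,
    (Cmd.loop .good (.set a (.var d) (.const v))).run c d env s a g = v := by
  rw [Cmd.run_loop]
  refine iter_induction (fun x (t : Store) => ∀ g < x, t a g = v)
    (fun i hi => absurd hi (Nat.not_lt_zero i)) fun x t _ h i hi => ?_
  rw [Cmd.run_set, Store.write_same]
  simp only [Ex.ev_var, Function.update_self, Ex.ev_const]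
  split_ifs
  · rfl
  · exact h i (by omega)

/-- The matched agents are exactly the marked ones. -/
theorem run_markMatched : ∀ i < c.n,
    (markMatched.run c 1 env s .done (i + 1) = 1 ∧ ∃ g < c.m, s .owner g = i + 1) ∨
    (markMatched.run c 1 env s .done (i + 1) = 0 ∧ ∀ g < c.m, s .owner g ≠ i + 1) := by
  intro i hi
  simp only [markMatched, Cmd.run_block_cons, Cmd.run_block_nil]
  set s₁ := (Cmd.loop .agent (.set .done (.succ (.var 1)) (.const 0))).run c 1 env s with hs₁
  have h1 : s₁ .done (i + 1) = 0 := run_fill_agents .done 0 i hi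
  have h2 : s₁ .owner = s .owner := Cmd.run_of_notMem c _ (by decide) _ _ _
  rw [Cmd.run_loop]
  refine (iter_induction (fun x (t : Store) => t .owner = s .owner ∧
    ((t .done (i + 1) = 1 ∧ ∃ g < c.m, s .owner g = i + 1) ∨
      (t .done (i + 1) = 0 ∧ ∀ g < x, s .owner g ≠ i + 1)))
    ⟨h2, Or.inr ⟨h1, fun g hg => absurd hg (Nat.not_lt_zero g)⟩⟩ ?_).2
  intro x t hx ⟨ho, h⟩
  rw [Cmd.run_set, Store.write_same]
  simp only [Ex.ev_read, Ex.ev_var, Function.update_self, Ex.ev_const, ho]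
  refine ⟨by rw [Store.write_ne _ _ _ (by decide), ho], ?_⟩
  by_cases hxi : i + 1 = s .owner x
  · rw [if_pos hxi]
    exact Or.inl ⟨rfl, x, hx, hxi.symm⟩
  · rw [if_neg hxi]
    refine h.imp_right fun h => ⟨h.1, fun g hg => ?_⟩
    rcases Nat.lt_succ_iff_lt_or_eq.1 hg with hg | rfl
    · exact h.2 g hg
    · exact fun e => hxi e.symm

theorem Reach.mem_unfrozen {T : Fin n → Option (Fin m)} (hT : IsMatching I S T) {i₀ i : Fin n}
    (h : Reach I S T i₀ i) : i ∈ unfrozen S :=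
  h.induction h.start.1 fun _ g y _ _ hy => (hT.1 y g hy).1

open Classical in
theorem run_valueStep (env : ℕ → ℕ) (s : Store) (i g : ℕ) :
    valueStep.run c d (Function.update (Function.update env 2 i) 3 g) s =
    if FreeEdge c s i g ∧ 0 < s .owner g ∧ s .value (s .owner g) < s .value (i + 1) then
      s.write .value (s .owner g) (s .value (i + 1))
    else s := by
  rw [valueStep, Cmd.run_when]
  simp

/-- The invariant of the propagation of the ratios along alternating paths. -/
structure ValueInv (I : BiInstance n m) (S : MMFState n m) (s t : Store) : Prop where
  taken : t .taken = s .taken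
  owner : t .owner = s .owner
  sound : ∀ i : Fin n, t .value (i + 1) ≠ 0 → ∃ i₀, Reach I S (assigned (s .owner)) i₀ i ∧
    t .value (i + 1) = ⌊I.ratio i₀⌋₊

theorem ValueInv.step (hc : Models I c) (hS : Shows S s) (hM : Matched c s)
    (hT : IsMatching I S (assigned (s .owner))) {t : Store} (h : ValueInv I S s t) {i g : ℕ}
    (hi : i < c.n) (hg : g < c.m) :
    ValueInv I S s (valueStep.run c d (Function.update (Function.update env 2 i) 3 g) t) ∧
      (∀ x, t .value x ≤
        valueStep.run c d (Function.update (Function.update env 2 i) 3 g) t .value x) ∧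
      (FreeEdge c s i g → 0 < s .owner g → t .value (i + 1) ≤
        valueStep.run c d (Function.update (Function.update env 2 i) 3 g) t .value
          (s .owner g)) := by
  rw [run_valueStep]
  split_ifs with hG
  · obtain ⟨hE, ho, hlt⟩ := hG
    rw [h.owner] at ho hlt ⊢
    rw [freeEdge_congr h.taken] at hE
    refine ⟨⟨?_, ?_, ?_⟩, ?_, ?_⟩
    · rw [Store.write_ne _ _ _ (by decide), h.taken]
    · rw [Store.write_ne _ _ _ (by decide), h.owner]
    · intro j hj
      rw [Store.write_same] at hj ⊢
      by_cases hjo : (j : ℕ) + 1 = s .owner g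
      · rw [if_pos hjo]
        have hi' : i < n := hc.n_eq ▸ hi
        have hg' : g < m := hc.m_eq ▸ hg
        obtain ⟨i₀, hr, hv⟩ := h.sound ⟨i, hi'⟩ (by
          change t .value (i + 1) ≠ 0
          omega)
        refine ⟨i₀, ?_, hv⟩
        have hfi : s .frozen i = 0 :=
          (hS.frozen ⟨i, hi'⟩).trans (mem_unfrozen.1 (Reach.mem_unfrozen hT hr))
        have hE' : Edge I S ⟨i, hi'⟩ ⟨g, hg'⟩ :=
          (hS.freeEdge (i := ⟨i, hi'⟩) (g := ⟨g, hg'⟩) hc hfi).1 hE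
        exact (hr.extend hE' ((hM.assigned_eq_some hc.m_eq j ⟨g, hg'⟩).2 hjo.symm)).reach
      · rw [if_neg hjo] at hj ⊢
        exact h.sound j hj
    · intro x
      rw [Store.write_same]
      split_ifs with hx
      · rw [hx]; exact hlt.le
      · exact le_rfl
    · intro _ _
      rw [Store.write_self]
  · refine ⟨h, fun _ => le_rfl, fun hE ho => ?_⟩
    rw [freeEdge_congr h.taken, h.owner] at hG
    by_contra hlt
    exact hG ⟨hE, ho, not_le.1 hlt⟩

/-- The computed values are the maxima that determine how long the agents are frozen. -/
theorem run_setValues (hc : Models I c) (hS : Shows S s) (hM : Matched c s)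
    (hT : IsMatching I S (assigned (s .owner)))
    (hdone : ∀ i < c.n, (s .done (i + 1) = 1 ∧ ∃ g < c.m, s .owner g = i + 1) ∨
      (s .done (i + 1) = 0 ∧ ∀ g < c.m, s .owner g ≠ i + 1))
    (i : Fin n) {g : Fin m} (hig : assigned (s .owner) i = some g) :
    (setValues.run c 1 env s .value (i + 1) = 0 ∧
      ∀ i₀, ¬ OnPathFrom I S (assigned (s .owner)) i₀ i) ∨
    ((∃ i₀, OnPathFrom I S (assigned (s .owner)) i₀ i) ∧
      setValues.run c 1 env s .value (i + 1) =
        freezeRounds I S (assigned (s .owner)) i + 1) := by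
  set T : Fin n → Option (Fin m) := assigned (s .owner) with hTdef
  have hnone : ∀ j : Fin n, T j = none ↔ s .done (j + 1) = 0 := by
    intro j
    rw [hTdef, assigned_eq_none]
    rcases hdone j (hc.n_eq ▸ j.2) with ⟨h1, g, hg, h2⟩ | ⟨h1, h2⟩
    · simp only [h1, one_ne_zero, iff_false, not_forall, not_not]
      exact ⟨⟨g, hc.m_eq ▸ hg⟩, h2⟩
    · simp only [h1, iff_true]
      exact fun g => h2 g (hc.m_eq ▸ g.2)
  simp only [setValues, Cmd.run_block_cons, Cmd.run_block_nil]
  set p := Cmd.loop .agent (.ite (.and (.isZero (.read .frozen (.var 1)))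
      (.isZero (.read .done (.succ (.var 1)))))
    (.set .value (.succ (.var 1)) (.floor (.var 1)))
    (.set .value (.succ (.var 1)) (.const 0))) with hp
  set s₁ := p.run c 1 env s with hs₁
  have ft : s₁ .taken = s .taken := Cmd.run_of_notMem c _ (by decide) _ _ _
  have fo : s₁ .owner = s .owner := Cmd.run_of_notMem c _ (by decide) _ _ _
  have hv₁ : ∀ j < c.n, s₁ .value (j + 1) =
      if s .frozen j = 0 ∧ s .done (j + 1) = 0 then c.floor j else 0 := by
    rw [hs₁, hp, Cmd.run_loop]
    refine (iter_induction (fun x (t : Store) => (∀ a, a ≠ .value → t a = s a) ∧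
      ∀ j < x, t .value (j + 1) =
        if s .frozen j = 0 ∧ s .done (j + 1) = 0 then c.floor j else 0)
      ⟨fun _ _ => rfl, fun j hj => absurd hj (Nat.not_lt_zero j)⟩ ?_).2
    intro x t _ ⟨h, h'⟩
    rw [Cmd.run_ite]
    simp only [Bx.ev_and, Bx.ev_isZero, Ex.ev_read, Ex.ev_var, Function.update_self, Ex.ev_succ,
      h .frozen (by decide), h .done (by decide), Cmd.run_set, Ex.ev_floor, Ex.ev_const]
    split_ifs with hx
    · refine ⟨fun a ha => by rw [Store.write_ne _ _ _ ha, h a ha], fun j hj => ?_⟩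
      rw [Store.write_same]
      by_cases hjx : j = x
      · subst hjx; simp [hx]
      · rw [if_neg (by omega), h' j (by omega)]
    · refine ⟨fun a ha => by rw [Store.write_ne _ _ _ ha, h a ha], fun j hj => ?_⟩
      rw [Store.write_same]
      by_cases hjx : j = x
      · subst hjx; simp [hx]
      · rw [if_neg (by omega), h' j (by omega)]
  have h0 : ValueInv I S s s₁ := by
    refine ⟨ft, fo, fun j hj => ?_⟩
    rw [hv₁ j (hc.n_eq ▸ j.2)] at hj ⊢
    split_ifs at hj ⊢ with h
    · rw [hS.frozen, ← hnone] at h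
      exact ⟨j, Reach.refl (mem_unfrozen.2 h.1) h.2, hc.floor_eq j⟩
    · exact (hj rfl).elim
  have sweep : ∀ x t, ValueInv I S s t →
      ValueInv I S s ((Cmd.loop .agent (.loop .good valueStep)).run c 2
        (Function.update env 1 x) t) ∧
      (∀ y, t .value y ≤ (Cmd.loop .agent (.loop .good valueStep)).run c 2
        (Function.update env 1 x) t .value y) ∧
      ∀ i < c.n, ∀ g < c.m, FreeEdge c s i g → 0 < s .owner g → t .value (i + 1) ≤
        (Cmd.loop .agent (.loop .good valueStep)).run c 2
          (Function.update env 1 x) t .value (s .owner g) := by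
    intro x t ht
    rw [Cmd.run_loop]
    refine iter_induction (fun z u => ValueInv I S s u ∧ (∀ y, t .value y ≤ u .value y) ∧
      ∀ i < z, ∀ g < c.m, FreeEdge c s i g → 0 < s .owner g →
        t .value (i + 1) ≤ u .value (s .owner g)) ?_ ?_
    · exact ⟨ht, fun _ => le_rfl, fun i hi => absurd hi (Nat.not_lt_zero i)⟩
    · intro z u hz ⟨h1, h2, h3⟩
      rw [Cmd.run_loop]
      have := iter_induction (f := fun g => valueStep.run c (2 + 1 + 1) (Function.update
          (Function.update (Function.update env 1 x) 2 z) 3 g)) (N := c.size .good) (s := u)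
        (fun w v => ValueInv I S s v ∧ (∀ y, t .value y ≤ v .value y) ∧
        (∀ i < z, ∀ g < c.m, FreeEdge c s i g → 0 < s .owner g →
          t .value (i + 1) ≤ v .value (s .owner g)) ∧
        ∀ g < w, FreeEdge c s z g → 0 < s .owner g → t .value (z + 1) ≤ v .value (s .owner g))
        ⟨h1, h2, h3, fun g hg => absurd hg (Nat.not_lt_zero g)⟩ ?_
      · obtain ⟨k1, k2, k3, k4⟩ := this
        refine ⟨k1, k2, fun i hi => ?_⟩
        rcases Nat.lt_succ_iff_lt_or_eq.1 hi with hi | rfl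
        · exact k3 i hi
        · exact k4
      · intro w v hw ⟨k1, k2, k3, k4⟩
        obtain ⟨l1, l2, l3⟩ := k1.step (d := 2 + 1 + 1) (env := Function.update env 1 x)
          hc hS hM hT hz hw
        refine ⟨l1, fun y => (k2 y).trans (l2 y),
          fun i hi g hg hE ho => (k3 i hi g hg hE ho).trans (l2 _), fun g hg hE ho => ?_⟩
        rcases Nat.lt_succ_iff_lt_or_eq.1 hg with hg | rfl
        · exact (k4 g hg hE ho).trans (l2 _)
        · exact (k2 _).trans (l3 hE ho)
  rw [Cmd.run_loop]
  -- after `k` sweeps the ratio of `i₀` has been passed on along all paths with at most `k` steps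
  have key := iter_induction (f := fun x => (Cmd.loop .agent (.loop .good valueStep)).run c (1 + 1)
      (Function.update env 1 x)) (N := c.size .agent) (s := s₁)
    (fun k t => ValueInv I S s t ∧ ∀ i₀ l, IsAltPath I S T i₀ l → l.length ≤ k →
      ⌊I.ratio i₀⌋₊ ≤ t .value ((i₀ :: l).getLast (List.cons_ne_nil _ _) + 1)) ?_ ?_
  · set u := iter (fun x => (Cmd.loop .agent (.loop .good valueStep)).run c (1 + 1)
      (Function.update env 1 x)) (c.size .agent) s₁ with hu
    have hcomp : ∀ i₀, Reach I S T i₀ i → ⌊I.ratio i₀⌋₊ ≤ u .value (i + 1) := by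
      rintro i₀ ⟨l, hl, rfl⟩
      refine key.2 i₀ l hl ?_
      have := hl.2.2.1.length_le_card
      rw [Fintype.card_fin, List.length_cons] at this
      change l.length ≤ c.n
      rw [hc.n_eq]
      omega
    have hon : ∀ i₀, Reach I S T i₀ i → OnPathFrom I S T i₀ i := by
      intro i₀ hr
      refine hr.onPathFrom ?_
      rintro rfl
      rw [hr.start.2] at hig
      cases hig
    by_cases hv : u .value (i + 1) = 0
    · left
      refine ⟨hv, fun i₀ hp => ?_⟩
      have h1 := hcomp i₀ hp.reach
      have h2 := I.floor_ratio_sub_one i₀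
      omega
    · right
      obtain ⟨i₀, hr, hvi⟩ := key.1.sound i hv
      refine ⟨⟨i₀, hon i₀ hr⟩, le_antisymm ?_ ?_⟩
      · rw [hvi, ← I.floor_ratio_sub_one i₀]
        exact Nat.succ_le_succ (le_freezeRounds (hon i₀ hr))
      · have : freezeRounds I S T i ≤ u .value (i + 1) - 1 := by
          refine freezeRounds_le_of_imp fun i₁ hp => ?_
          have h1 := hcomp i₁ hp.reach
          have h2 := I.floor_ratio_sub_one i₁
          omega
        omega
  · refine ⟨h0, fun i₀ l hl hlen => ?_⟩
    obtain rfl := List.eq_nil_of_length_eq_zero (Nat.le_zero.1 hlen)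
    rw [List.getLast_singleton, hv₁ i₀ (hc.n_eq ▸ i₀.2), if_pos, hc.floor_eq]
    exact ⟨(hS.frozen i₀).trans (mem_unfrozen.1 hl.1), (hnone i₀).1 hl.2.1⟩
  · intro k t _ ⟨ht, hpath⟩
    obtain ⟨k1, k2, k3⟩ := sweep k t ht
    refine ⟨k1, fun i₀ l hl hlen => ?_⟩
    rcases List.eq_nil_or_concat' l with rfl | ⟨l', j, rfl⟩
    · exact (hpath i₀ [] hl (Nat.zero_le _)).trans (k2 _)
    · obtain ⟨p1, p2, p3, p4⟩ := hl
      rw [← List.cons_append] at p3 p4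
      rw [List.isChain_append] at p4
      have h1 := hpath i₀ l' ⟨p1, p2, p3.of_append_left, p4.1⟩ (by
        rw [List.length_append, List.length_singleton] at hlen
        omega)
      obtain ⟨g, hE, hj⟩ := p4.2.2 _ (by
        rw [List.getLast?_eq_getLast_of_ne_nil (List.cons_ne_nil i₀ l')]
        rfl) j (by simp)
      rw [hM.assigned_eq_some hc.m_eq] at hj
      have h2 := k3 _ (hc.n_eq ▸ ((i₀ :: l').getLast (List.cons_ne_nil _ _)).2) g
        (hc.m_eq ▸ g.2) (hS.edge_freeEdge hc hE) (by rw [hj]; exact Nat.succ_pos _)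
      rw [hj] at h2
      have e : (i₀ :: (l' ++ [j])).getLast (List.cons_ne_nil _ _) = j := by simp
      rw [e]
      exact h1.trans h2

/-- Every agent unfreezes by one round, or is frozen according to the computed values. -/
theorem run_freeze : ∀ i < c.n,
    (freeze.run c 1 env s .frozen i = if s .frozen i = 0 then
        (if s .done (i + 1) < 2 ∧ 0 < s .value (i + 1) then s .value (i + 1) - 1 else 0)
      else s .frozen i - 1) ∧
    freeze.run c 1 env s .last (i + 1) =
      if s .frozen i = 0 ∧ s .done (i + 1) < 2 ∧ 0 < s .value (i + 1) then s .round 0 + 1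
      else s .last (i + 1) := by
  rw [freeze, Cmd.run_loop]
  refine (iter_induction (fun x (t : Store) => (∀ a, a ≠ .frozen → a ≠ .last → t a = s a) ∧
    (∀ i ≥ x, t .frozen i = s .frozen i ∧ t .last (i + 1) = s .last (i + 1)) ∧
    ∀ i < x, (t .frozen i = if s .frozen i = 0 then
        (if s .done (i + 1) < 2 ∧ 0 < s .value (i + 1) then s .value (i + 1) - 1 else 0)
      else s .frozen i - 1) ∧
      t .last (i + 1) = if s .frozen i = 0 ∧ s .done (i + 1) < 2 ∧ 0 < s .value (i + 1) then
        s .round 0 + 1 else s .last (i + 1)) ?_ ?_).2.2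
  · exact ⟨fun _ _ _ => rfl, fun _ _ => ⟨rfl, rfl⟩, fun i hi => absurd hi (Nat.not_lt_zero i)⟩
  · intro x t _ ⟨h1, h2, h3⟩
    have hx := h2 x le_rfl
    rw [Cmd.run_ite, Cmd.run_when]
    simp only [Bx.ev_isZero, Ex.ev_read, Ex.ev_var, Function.update_self, Bx.ev_all_cons,
      Bx.ev_all_singleton, Bx.ev_lt, Ex.ev_succ, Ex.ev_const, Bx.ev_pos, Cmd.run_block_cons,
      Cmd.run_block_nil, Cmd.run_set, Ex.ev_pred, Ex.ev_get, hx.1,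
      h1 .done (by decide) (by decide), h1 .value (by decide) (by decide)]
    split_ifs with hf hv
    · refine ⟨fun a ha ha' => by rw [Store.write_ne _ _ _ ha', Store.write_ne _ _ _ ha, h1 a ha ha'],
        fun i hi => ?_, fun i hi => ?_⟩
      · rw [Store.write_ne _ _ _ (by decide : Arr.frozen ≠ .last), Store.write_same,
          Store.write_same, Store.write_ne _ _ _ (by decide : Arr.last ≠ .frozen),
          if_neg (by omega), if_neg (by omega)]
        exact h2 i (by omega)
      · rw [Store.write_ne _ _ _ (by decide : Arr.frozen ≠ .last), Store.write_same,
          Store.write_same, Store.write_ne _ _ _ (by decide : Arr.last ≠ .frozen),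
          Store.write_ne _ _ _ (by decide : Arr.round ≠ .frozen),
          h1 .round (by decide) (by decide)]
        by_cases hix : i = x
        · subst hix
          simp [hf, hv]
        · rw [if_neg hix, if_neg (by omega : ¬ i + 1 = x + 1)]
          exact h3 i (by omega)
    · refine ⟨h1, fun i hi => h2 i (by omega), fun i hi => ?_⟩
      by_cases hix : i = x
      · subst hix
        rw [if_pos hf, if_neg hv, if_neg (fun h => hv h.2), hx.1, hx.2]
        exact ⟨hf, rfl⟩
      · exact h3 i (by omega)
    · refine ⟨fun a ha ha' => by rw [Store.write_ne _ _ _ ha, h1 a ha ha'],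
        fun i hi => ?_, fun i hi => ?_⟩
      · rw [Store.write_same, Store.write_ne _ _ _ (by decide : Arr.last ≠ .frozen),
          if_neg (by omega)]
        exact h2 i (by omega)
      · rw [Store.write_same, Store.write_ne _ _ _ (by decide : Arr.last ≠ .frozen)]
        by_cases hix : i = x
        · subst hix
          simp [hf, hx.2]
        · rw [if_neg (by omega)]
          exact h3 i (by omega)

/-! ### Handing out the goods -/

/-- The array `owner` hands out unallocated goods to unfrozen agents, at most one to each, and `done`
marks those who get a good. -/
structure Handed (c : Inp) (s : Store) : Prop where
  owned : ∀ g < c.m, ∀ i, s .owner g = i + 1 → i < c.n ∧ s .frozen i = 0 ∧ s .taken g = 0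
  inj : ∀ g < c.m, ∀ g' < c.m, s .owner g = s .owner g' → s .owner g ≠ 0 → g = g'
  done : ∀ i < c.n, s .frozen i = 0 → (s .done (i + 1) ≠ 0 ↔ ∃ g < c.m, s .owner g = i + 1)

/-- Handing out one more good. -/
theorem Handed.give (h : Handed c s) {t : Store} {i g v : ℕ} (hi : i < c.n) (hg : g < c.m)
    (hv : v ≠ 0) (hc : Cand s i) (ht : s .taken g = 0) (ho : s .owner g = 0)
    (h1 : t .taken = s .taken) (h2 : t .frozen = s .frozen)
    (h3 : ∀ x, t .owner x = if x = g then i + 1 else s .owner x)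
    (h4 : ∀ x, t .done x = if x = i + 1 then v else s .done x) : Handed c t := by
  have hno : ∀ x < c.m, s .owner x ≠ i + 1 := fun x hx hxi =>
    (h.done i hi hc.1).2 ⟨x, hx, hxi⟩ hc.2
  refine ⟨fun x hx j hj => ?_, fun x hx y hy => ?_, fun j hj hj0 => ?_⟩
  · rw [h1, h2]
    rw [h3] at hj
    split_ifs at hj with hxg
    · obtain rfl : i = j := by omega
      exact ⟨hi, hc.1, hxg ▸ ht⟩
    · exact h.owned x hx j hj
  · rw [h3, h3]
    split_ifs with hxg hyg hyg
    · intro _ _; rw [hxg, hyg]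
    · intro e; exact (hno y hy e.symm).elim
    · intro e; exact (hno x hx e).elim
    · exact h.inj x hx y hy
  · rw [h2] at hj0
    rw [h4]
    by_cases hji : j = i
    · subst hji
      simp only [if_true]
      exact ⟨fun _ => ⟨g, hg, by rw [h3, if_pos rfl]⟩, fun _ => hv⟩
    · rw [if_neg (by omega), h.done j hj hj0]
      constructor
      · rintro ⟨x, hx, hxj⟩
        refine ⟨x, hx, ?_⟩
        rw [h3, if_neg, hxj]
        rintro rfl
        omega
      · rintro ⟨x, hx, hxj⟩
        rw [h3] at hxj
        split_ifs at hxj with hxg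
        · omega
        · exact ⟨x, hx, hxj⟩

/-- If all unfrozen agents get a good, there are at least as many goods as unfrozen agents. -/
theorem Handed.card_le (h : Handed c s) (hc : Models I c) (hS : Shows S s)
    (hall : ∀ i < c.n, ¬ Cand s i) : (unfrozen S).card ≤ S.goods.card := by
  have hex : ∀ i ∈ unfrozen S, ∃ g ∈ S.goods, s .owner g = i + 1 := by
    intro i hi
    have hin : (i : ℕ) < c.n := hc.n_eq ▸ i.2
    have hf : s .frozen i = 0 := (hS.frozen i).trans (mem_unfrozen.1 hi)
    obtain ⟨g, hg, ho⟩ := (h.done i hin hf).1 fun h0 => hall i hin ⟨hf, h0⟩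
    exact ⟨⟨g, hc.m_eq ▸ hg⟩, (hS.taken _).1 (h.owned g hg i ho).2.2, ho⟩
  refine Finset.card_le_card_of_forall_subsingleton
    (fun (i : Fin n) (g : Fin m) => s .owner g = (i : ℕ) + 1) hex ?_
  rintro g _ i ⟨_, h1⟩ j ⟨_, h2⟩
  exact Fin.ext (by omega)

/-- If all goods are handed out and some unfrozen agent gets none, there are fewer goods than unfrozen
agents. -/
theorem Handed.card_lt (h : Handed c s) (hc : Models I c) (hS : Shows S s)
    (hall : ∀ g < c.m, s .taken g = 0 → s .owner g ≠ 0) {i : ℕ} (hi : i < c.n)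
    (hci : Cand s i) : S.goods.card < (unfrozen S).card := by
  have hex : ∀ g ∈ S.goods, ∃ j ∈ (unfrozen S).erase ⟨i, hc.n_eq ▸ hi⟩,
      s .owner g = (j : ℕ) + 1 := by
    intro g hg
    have hgm : (g : ℕ) < c.m := hc.m_eq ▸ g.2
    obtain ⟨j, hj⟩ := Nat.exists_eq_succ_of_ne_zero (hall g hgm ((hS.taken g).2 hg))
    obtain ⟨h1, h2, _⟩ := h.owned g hgm j hj
    refine ⟨⟨j, hc.n_eq ▸ h1⟩, Finset.mem_erase.2 ⟨?_, ?_⟩, hj⟩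
    · intro e
      rw [Fin.mk.injEq] at e
      subst e
      exact (h.done j h1 h2).2 ⟨g, hgm, hj⟩ hci.2
    · exact mem_unfrozen.2 ((hS.frozen ⟨j, _⟩).symm.trans h2)
  have hiu : (⟨i, hc.n_eq ▸ hi⟩ : Fin n) ∈ unfrozen S :=
    mem_unfrozen.2 ((hS.frozen ⟨i, _⟩).symm.trans hci.1)
  refine lt_of_le_of_lt (Finset.card_le_card_of_forall_subsingleton
    (fun (g : Fin m) (j : Fin n) => s .owner g = (j : ℕ) + 1) hex ?_) (Finset.card_erase_lt_of_mem hiu)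
  rintro j _ g ⟨_, h1⟩ g' ⟨_, h2⟩
  refine Fin.ext (h.inj g (hc.m_eq ▸ g.2) g' (hc.m_eq ▸ g'.2) (h1.trans h2.symm) ?_)
  rw [h1]
  exact Nat.succ_ne_zero _

theorem Handed.assigned_eq_some (h : Handed c s) (hc : Models I c) (i : Fin n) (g : Fin m) :
    assigned (s .owner) i = some g ↔ s .owner g = i + 1 :=
  Mini.assigned_eq_some (fun g hg g' hg' => h.inj g (hc.m_eq ▸ hg) g' (hc.m_eq ▸ hg')) i g

theorem Handed.isHandout (h : Handed c s) (hc : Models I c) (hS : Shows S s) :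
    IsHandout S (assigned (s .owner)) := by
  refine ⟨fun i g hi => ?_, fun i j g hi hj => ?_⟩
  · rw [h.assigned_eq_some hc] at hi
    obtain ⟨_, h2, h3⟩ := h.owned g (hc.m_eq ▸ g.2) i hi
    exact ⟨mem_unfrozen.2 ((hS.frozen i).symm.trans h2), (hS.taken g).1 h3⟩
  · rw [h.assigned_eq_some hc] at hi hj
    exact Fin.ext (by omega)

theorem Handed.ne_none_iff (h : Handed c s) (hc : Models I c) (hS : Shows S s) {i : Fin n}
    (hi : i ∈ unfrozen S) : (assigned (s .owner) i : Option (Fin m)) ≠ none ↔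
      s .done (i + 1) ≠ 0 := by
  rw [h.done i (hc.n_eq ▸ i.2) ((hS.frozen i).trans (mem_unfrozen.1 hi)), Ne, assigned_eq_none,
    not_forall]
  simp only [not_not]
  exact ⟨fun ⟨g, hg⟩ => ⟨g, hc.m_eq ▸ g.2, hg⟩, fun ⟨g, hg, h⟩ => ⟨⟨g, hc.m_eq ▸ hg⟩, h⟩⟩

/-- The unmatched agents get further goods. -/
theorem run_handOut (hc : Models I c) (hS : Shows S s) (h : Handed c s)
    (hcard : (unfrozen S).card ≤ S.goods.card) :
    ∃ t, handOut.run c 1 env s = t ∧ Handed c t ∧ (∀ i < c.n, ¬ Cand t i) ∧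
      (∀ g < c.m, s .owner g ≠ 0 → t .owner g = s .owner g) ∧
      ∀ i < c.n, (s .done (i + 1) ≠ 0 → t .done (i + 1) = s .done (i + 1)) ∧
        (s .done (i + 1) = 0 → t .done (i + 1) = 0 ∨ t .done (i + 1) = 2) := by
  classical
  refine ⟨_, rfl, ?_⟩
  let J : Store → Prop := fun t => t .taken = s .taken ∧ t .frozen = s .frozen ∧ Handed c t ∧
    (∀ g < c.m, s .owner g ≠ 0 → t .owner g = s .owner g) ∧
    ∀ i < c.n, (s .done (i + 1) ≠ 0 → t .done (i + 1) = s .done (i + 1)) ∧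
      (s .done (i + 1) = 0 → t .done (i + 1) = 0 ∨ t .done (i + 1) = 2)
  let G : ℕ → ℕ → Store → Prop := fun i g t => Cand t i ∧ t .taken g = 0 ∧ t .owner g = 0
  let f : ℕ → ℕ → Store → Store := fun i g => (Cmd.when [.isZero (.read .frozen (.var 1)),
    .isZero (.read .done (.succ (.var 1))), .isZero (.read .taken (.var 2)),
    .isZero (.read .owner (.var 2))]
    [.set .owner (.var 2) (.succ (.var 1)),
      .set .done (.succ (.var 1)) (.const 2)]).run c 3
      (Function.update (Function.update env 1 i) 2 g)
  have hf : ∀ i g t, f i g t =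
      if G i g t then (t.write .owner g (i + 1)).write .done (i + 1) 2 else t := by
    intro i g t
    simp only [f, G, Cand]
    rw [Cmd.run_when]
    simp [and_assoc]
  have hstep : ∀ i < c.n, ∀ g < c.m, ∀ t, J t → J (f i g t) ∧ ¬ G i g (f i g t) ∧
      ∀ j x, ¬ G j x t → ¬ G j x (f i g t) := by
    intro i hi g hg t ⟨h1, h2, h3, h4, h5⟩
    rw [hf]
    split_ifs with hG
    · have ko : ∀ x, ((t.write .owner g (i + 1)).write .done (i + 1) 2) .owner x =
          if x = g then i + 1 else t .owner x := by
        intro x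
        rw [Store.write_ne _ _ _ (by decide), Store.write_same]
      have kd : ∀ x, ((t.write .owner g (i + 1)).write .done (i + 1) 2) .done x =
          if x = i + 1 then 2 else t .done x := by
        intro x
        rw [Store.write_same, Store.write_ne _ _ _ (by decide)]
      have kt : ((t.write .owner g (i + 1)).write .done (i + 1) 2) .taken = t .taken := by
        rw [Store.write_ne _ _ _ (by decide), Store.write_ne _ _ _ (by decide)]
      have kf : ((t.write .owner g (i + 1)).write .done (i + 1) 2) .frozen = t .frozen := by
        rw [Store.write_ne _ _ _ (by decide), Store.write_ne _ _ _ (by decide)]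
      refine ⟨⟨kt.trans h1, kf.trans h2, h3.give hi hg two_ne_zero hG.1 hG.2.1 hG.2.2 kt kf ko kd,
        fun x hx hx0 => ?_, fun j hj => ?_⟩, ?_, ?_⟩
      · rw [ko, if_neg, h4 x hx hx0]
        rintro rfl
        have := hG.2.2
        rw [h4 x hx hx0] at this
        exact hx0 this
      · rw [kd]
        by_cases hji : j = i
        · subst hji
          refine ⟨fun hj0 => ?_, fun _ => Or.inr (if_pos rfl)⟩
          have := hG.1.2
          rw [(h5 j hj).1 hj0] at this
          exact (hj0 this).elim
        · rw [if_neg (by omega)]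
          exact h5 j hj
      · rintro ⟨⟨_, h⟩, _⟩
        rw [kd, if_pos rfl] at h
        exact two_ne_zero h
      · rintro j x hn ⟨⟨g1, g2⟩, g3, g4⟩
        rw [kf] at g1
        rw [kd] at g2
        rw [kt] at g3
        rw [ko] at g4
        split_ifs at g2 g4
        exact hn ⟨⟨g1, g2⟩, g3, g4⟩
    · exact ⟨⟨h1, h2, h3, h4, h5⟩, hG, fun _ _ h => h⟩
  have key : J (handOut.run c 1 env s) ∧
      ∀ i < c.n, ∀ g < c.m, ¬ G i g (handOut.run c 1 env s) := by
    rw [handOut, Cmd.run_loop]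
    refine iter_induction (fun x t => J t ∧ ∀ i < x, ∀ g < c.m, ¬ G i g t) ?_ ?_
    · refine ⟨⟨rfl, rfl, h, fun _ _ _ => rfl, fun i _ => ⟨fun _ => rfl, fun h => Or.inl h⟩⟩,
        fun i hi => absurd hi (Nat.not_lt_zero i)⟩
    · intro x t hx ⟨hJ, hx'⟩
      have inner := iter_induction (f := f x) (N := c.m) (s := t) (fun y u => J u ∧
        (∀ i < x, ∀ g < c.m, ¬ G i g u) ∧ ∀ g < y, ¬ G x g u)
        ⟨hJ, hx', fun g hg => absurd hg (Nat.not_lt_zero g)⟩ (by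
          intro y u hy ⟨k1, k2, k3⟩
          obtain ⟨l1, l2, l3⟩ := hstep x hx y hy u k1
          refine ⟨l1, fun i hi g hg => l3 i g (k2 i hi g hg), fun g hg => ?_⟩
          rcases Nat.lt_succ_iff_lt_or_eq.1 hg with hg | rfl
          · exact l3 x g (k3 g hg)
          · exact l2)
      refine ⟨inner.1, fun i hi => ?_⟩
      rcases Nat.lt_succ_iff_lt_or_eq.1 hi with hi | rfl
      · exact inner.2.1 i hi
      · exact inner.2.2
  obtain ⟨⟨h1, h2, h3, h4, h5⟩, hG⟩ := key
  refine ⟨h3, fun i hi hci => ?_, h4, h5⟩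
  have := h3.card_lt hc (hS.congr h1 h2) (fun g hg ht ho => hG i hi g hg ⟨hci, ht, ho⟩) hi hci
  omega

/-- In the last round every remaining good is handed out, by the priority order. -/
theorem run_lastRound (hc : Models I c) (hS : Shows S s) (ho : ∀ g < c.m, s .owner g = 0)
    (hd : ∀ i < c.n, s .done (i + 1) = 0) (hcard : S.goods.card < (unfrozen S).card) :
    ∃ t, lastRound.run c 1 env s = t ∧ Handed c t ∧
      (∀ g < c.m, t .taken g = 0 → t .owner g ≠ 0) ∧
      ∀ i < c.n, ∀ j < c.n, t .frozen i = 0 → t .frozen j = 0 → t .done (i + 1) ≠ 0 →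
        t .done (j + 1) = 0 → s .last (j + 1) ≤ s .last (i + 1) := by
  classical
  refine ⟨_, rfl, ?_⟩
  rw [lastRound, Cmd.run_loop]
  have h0 : Handed c s := by
    refine ⟨fun g hg i hi => ?_, fun g hg _ _ _ hne => (hne (ho g hg)).elim, fun i hi _ => ?_⟩
    · rw [ho g hg] at hi
      exact (Nat.succ_ne_zero i hi.symm).elim
    · refine iff_of_false (fun h => h (hd i hi)) ?_
      rintro ⟨g, hg, h⟩
      rw [ho g hg] at h
      exact Nat.succ_ne_zero i h.symm
  refine And.imp_right (fun h => ⟨h.1, h.2.2.2⟩) (iter_induction (fun x (t : Store) => Handed c t ∧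
    (∀ g < x, t .taken g = 0 → t .owner g ≠ 0) ∧
    (∀ g < c.m, x ≤ g → t .owner g = 0) ∧
    (∀ a, a ≠ .best → a ≠ .owner → a ≠ .done → t a = s a) ∧
    ∀ i < c.n, ∀ j < c.n, t .frozen i = 0 → t .frozen j = 0 → t .done (i + 1) ≠ 0 →
      t .done (j + 1) = 0 → s .last (j + 1) ≤ s .last (i + 1)) ?_ ?_)
  · exact ⟨h0, fun g hg => absurd hg (Nat.not_lt_zero g), fun g hg _ => ho g hg,
      fun _ _ _ _ => rfl, fun i hi _ _ _ _ h => (h (hd i hi)).elim⟩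
  · intro x t hx ⟨h1, h2, h3, h4, h5⟩
    have hx : x < c.m := hx
    have hSt : Shows S t := hS.congr (h4 _ (by decide) (by decide) (by decide))
      (h4 _ (by decide) (by decide) (by decide))
    rw [Cmd.run_when]
    simp only [Bx.ev_all_singleton, Bx.ev_isZero, Ex.ev_read, Ex.ev_var, Function.update_self,
      Cmd.run_block_cons, Cmd.run_block_nil, Cmd.run_set, Ex.ev_get, Ex.ev_const]
    split_ifs with ht
    · have hpick := run_pick (c := c) (env := Function.update env 1 x) (s := t)
        (.lt (.read .last (.get .best)) (.read .last (.succ (.var 2))))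
        (fun b i => t .last (b + 1) < t .last (i + 1)) (by
          intro i _ b _ u hu hub
          simp [hub, hu .last (by decide)])
        (fun _ _ => lt_irrefl _) (fun _ _ _ _ _ _ => lt_trans)
      set u := (pick (.lt (.read .last (.get .best)) (.read .last (.succ (.var 2))))).run c 2
        (Function.update env 1 x) t with hu
      change Handed c ((u.write .owner x (u .best 0)).write .done
        ((u.write .owner x (u .best 0)) .best 0) 1) ∧ _
      have hbst : (u.write .owner x (u .best 0)) .best 0 = u .best 0 := by
        rw [Store.write_ne _ _ _ (by decide)]
      rw [hbst]
      have fu : ∀ a, a ≠ .best → u a = t a := fun a ha => Cmd.run_of_notMem c _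
        (by simpa [pick, Cmd.block, Cmd.when, Cmd.writes] using ha) _ _ _
      rcases hpick with ⟨_, hno⟩ | ⟨b, hb, hbest, hcb, hmax⟩
      · have := h1.card_le hc hSt hno
        omega
      · rw [hbest]
        set v := (u.write .owner x (b + 1)).write .done (b + 1) 1 with hv
        have va : ∀ a, a ≠ .best → a ≠ .owner → a ≠ .done → v a = t a := by
          intro a a1 a2 a3
          rw [hv, Store.write_ne _ _ _ a3, Store.write_ne _ _ _ a2, fu a a1]
        have vo : ∀ y, v .owner y = if y = x then b + 1 else t .owner y := by
          intro y
          rw [hv, Store.write_ne _ _ _ (by decide), Store.write_same, fu .owner (by decide)]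
        have vd : ∀ y, v .done y = if y = b + 1 then 1 else t .done y := by
          intro y
          rw [hv, Store.write_same, Store.write_ne _ _ _ (by decide), fu .done (by decide)]
        have vt := va .taken (by decide) (by decide) (by decide)
        have vf := va .frozen (by decide) (by decide) (by decide)
        have tl : t .last = s .last := h4 _ (by decide) (by decide) (by decide)
        refine ⟨h1.give hb hx one_ne_zero hcb ht (h3 x hx le_rfl) vt vf vo vd, ?_, ?_, ?_, ?_⟩
        · intro g hg htg
          rw [vt] at htg
          rw [vo]
          rcases Nat.lt_succ_iff_lt_or_eq.1 hg with hg | rfl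
          · rw [if_neg hg.ne]
            exact h2 g hg htg
          · rw [if_pos rfl]
            exact Nat.succ_ne_zero b
        · intro g hg hxg
          rw [vo, if_neg (by omega)]
          exact h3 g hg (by omega)
        · intro a a1 a2 a3
          rw [va a a1 a2 a3, h4 a a1 a2 a3]
        · intro i hi j hj hi0 hj0 hdi hdj
          rw [vf] at hi0 hj0
          rw [vd] at hdi hdj
          split_ifs at hdj with hjb
          split_ifs at hdi with hib
          · obtain rfl : i = b := by omega
            have := hmax j hj ⟨hj0, hdj⟩
            rw [tl] at this
            exact not_lt.1 this
          · exact h5 i hi j hj hi0 hj0 hdi hdj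
    · refine ⟨h1, fun g hg htg => ?_, fun g hg hxg => h3 g hg (by omega), h4, h5⟩
      rcases Nat.lt_succ_iff_lt_or_eq.1 hg with hg | rfl
      · exact h2 g hg htg
      · exact (ht htg).elim

theorem run_countAgents (hc : Models I c) (hS : Shows S s) :
    countAgents.run c 1 env s .agents 0 = (unfrozen S).card := by
  classical
  simp only [countAgents, Cmd.run_block_cons, Cmd.run_block_nil, Cmd.run_set, Ex.ev_const]
  have e : (unfrozen S).card = ∑ i ∈ Finset.range c.n, if s .frozen i = 0 then 1 else 0 := by
    rw [unfrozen, Finset.card_filter, hc.n_eq, ← Fin.sum_univ_eq_sum_range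
      (fun i => if s .frozen i = 0 then 1 else 0)]
    exact Finset.sum_congr rfl fun i _ => by rw [hS.frozen]
  rw [e, Cmd.run_loop]
  refine (iter_induction (fun x (t : Store) => t .frozen = s .frozen ∧
    t .agents 0 = ∑ i ∈ Finset.range x, if s .frozen i = 0 then 1 else 0)
    ⟨by rw [Store.write_ne _ _ _ (by decide)], by simp⟩ ?_).2
  intro x t _ ⟨h1, h2⟩
  rw [Cmd.run_when, Finset.sum_range_succ]
  simp only [Bx.ev_all_singleton, Bx.ev_isZero, Ex.ev_read, Ex.ev_var, Function.update_self,
    Cmd.run_block_cons, Cmd.run_block_nil, Cmd.run_set, Ex.ev_get, Ex.ev_const, Ex.ev_succ, h1]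
  split_ifs
  · exact ⟨by rw [Store.write_ne _ _ _ (by decide), h1], by rw [Store.write_self, h2]⟩
  · exact ⟨h1, h2⟩

theorem run_countGoods (hc : Models I c) (hS : Shows S s) :
    countGoods.run c 1 env s .goods 0 = S.goods.card := by
  classical
  simp only [countGoods, Cmd.run_block_cons, Cmd.run_block_nil, Cmd.run_set, Ex.ev_const]
  have e : S.goods.card = ∑ g ∈ Finset.range c.m, if s .taken g = 0 then 1 else 0 := by
    rw [hc.m_eq, ← Fin.sum_univ_eq_sum_range (fun i => if s .taken i = 0 then 1 else 0),
      ← Finset.card_filter]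
    congr 1
    ext g
    rw [Finset.mem_filter, hS.taken]
    simp
  rw [e, Cmd.run_loop]
  refine (iter_induction (fun x (t : Store) => t .taken = s .taken ∧
    t .goods 0 = ∑ i ∈ Finset.range x, if s .taken i = 0 then 1 else 0)
    ⟨by rw [Store.write_ne _ _ _ (by decide)], by simp⟩ ?_).2
  intro x t _ ⟨h1, h2⟩
  rw [Cmd.run_when, Finset.sum_range_succ]
  simp only [Bx.ev_all_singleton, Bx.ev_isZero, Ex.ev_read, Ex.ev_var, Function.update_self,
    Cmd.run_block_cons, Cmd.run_block_nil, Cmd.run_set, Ex.ev_get, Ex.ev_const, Ex.ev_succ, h1]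
  split_ifs
  · exact ⟨by rw [Store.write_ne _ _ _ (by decide), h1], by rw [Store.write_self, h2]⟩
  · exact ⟨h1, h2⟩

theorem run_commit : commit.run c 1 env s .round 0 = s .round 0 + 1 ∧ ∀ g < c.m,
    commit.run c 1 env s .out g = (if 0 < s .owner g then s .owner g - 1 else s .out g) ∧
    commit.run c 1 env s .taken g = if 0 < s .owner g then 1 else s .taken g := by
  simp only [commit, Cmd.run_block_cons, Cmd.run_block_nil, Cmd.run_set, Ex.ev_const, Ex.ev_succ,
    Ex.ev_get]
  rw [Cmd.run_loop]
  set u := iter (fun x => (Cmd.when [.pos (.read .owner (.var 1))]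
    [.set .out (.var 1) (.pred (.read .owner (.var 1))),
      .set .taken (.var 1) (.const 1)]).run c (1 + 1) (Function.update env 1 x)) (c.size .good) s
    with hu
  have key : (∀ a, a ≠ .out → a ≠ .taken → u a = s a) ∧
      (∀ g ≥ c.m, u .out g = s .out g ∧ u .taken g = s .taken g) ∧ ∀ g < c.m,
      u .out g = (if 0 < s .owner g then s .owner g - 1 else s .out g) ∧
      u .taken g = if 0 < s .owner g then 1 else s .taken g := by
    rw [hu]
    refine iter_induction (fun x (t : Store) => (∀ a, a ≠ .out → a ≠ .taken → t a = s a) ∧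
      (∀ g ≥ x, t .out g = s .out g ∧ t .taken g = s .taken g) ∧ ∀ g < x,
      t .out g = (if 0 < s .owner g then s .owner g - 1 else s .out g) ∧
      t .taken g = if 0 < s .owner g then 1 else s .taken g)
      ⟨fun _ _ _ => rfl, fun _ _ => ⟨rfl, rfl⟩, fun i hi => absurd hi (Nat.not_lt_zero i)⟩ ?_
    intro x t _ ⟨h1, h2, h3⟩
    rw [Cmd.run_when]
    simp only [Bx.ev_all_singleton, Bx.ev_pos, Ex.ev_read, Ex.ev_var, Function.update_self,
      Cmd.run_block_cons, Cmd.run_block_nil, Cmd.run_set, Ex.ev_pred, Ex.ev_const,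
      h1 .owner (by decide) (by decide)]
    split_ifs with hx
    · have wo : ∀ y, ((t.write .out x (s .owner x - 1)).write .taken x 1) .out y =
          if y = x then s .owner x - 1 else t .out y := by
        intro y
        rw [Store.write_ne _ _ _ (by decide), Store.write_same]
      have wt : ∀ y, ((t.write .out x (s .owner x - 1)).write .taken x 1) .taken y =
          if y = x then 1 else t .taken y := by
        intro y
        rw [Store.write_same, Store.write_ne _ _ _ (by decide)]
      refine ⟨fun a a1 a2 => ?_, fun g hg => ?_, fun g hg => ?_⟩
      · rw [Store.write_ne _ _ _ a2, Store.write_ne _ _ _ a1, h1 a a1 a2]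
      · rw [wo, wt, if_neg (by omega), if_neg (by omega)]
        exact h2 g (by omega)
      · rw [wo, wt]
        by_cases hgx : g = x
        · subst hgx
          simp [hx]
        · rw [if_neg hgx, if_neg hgx]
          exact h3 g (by omega)
    · refine ⟨h1, fun g hg => h2 g (by omega), fun g hg => ?_⟩
      by_cases hgx : g = x
      · subst hgx
        rw [if_neg hx, if_neg hx]
        exact h2 g le_rfl
      · exact h3 g (by omega)
  refine ⟨by rw [Store.write_self, key.1 .round (by decide) (by decide)], fun g hg => ?_⟩
  rw [Store.write_ne _ _ _ (by decide), Store.write_ne _ _ _ (by decide)]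
  exact key.2.2 g hg

/-! ### Correctness of the rounds -/

/-- The store represents the state between two rounds.  The entry `⊤` of an agent who was never frozen
is stored as `m + 1`, which is larger than the number of any round. -/
structure Rep (S : MMFState n m) (s : Store) : Prop extends Shows S s where
  out : ∀ g : Fin m, g ∉ S.goods → ∀ i : Fin n, g ∈ S.bundle i ↔ s .out g = i
  last : ∀ i : Fin n, s .last (i + 1) = (S.lastFrozen i).untopD (m + 1)
  round : s .round 0 = S.round

/-- Committing adds the goods handed out by `A` to the bundles. -/
theorem commit_goods (hc : Models I c) {A : Fin n → Option (Fin m)}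
    (ht : ∀ g : Fin m, s .taken g = 0 ↔ g ∈ S.goods)
    (hA : ∀ i g, A i = some g ↔ s .owner g = i + 1)
    (hown : ∀ g < c.m, ∀ i, s .owner g = i + 1 → i < c.n ∧ s .taken g = 0)
    (hf : ∀ i, ∀ g ∈ S.bundle i, g ∉ S.goods)
    (ho : ∀ g : Fin m, g ∉ S.goods → ∀ i : Fin n, g ∈ S.bundle i ↔ s .out g = i) :
    (∀ g : Fin m, commit.run c 1 env s .taken g = 0 ↔ g ∈ S.goods ∧ ∀ i, A i ≠ some g) ∧
    ∀ g : Fin m, ¬ (g ∈ S.goods ∧ ∀ i, A i ≠ some g) → ∀ i : Fin n,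
      g ∈ S.bundle i ∪ (A i).toFinset ↔ commit.run c 1 env s .out g = i := by
  have key : ∀ g : Fin m,
      (commit.run c 1 env s .taken g = 0 ↔ g ∈ S.goods ∧ ∀ i, A i ≠ some g) ∧
      (¬ (g ∈ S.goods ∧ ∀ i, A i ≠ some g) → ∀ i : Fin n,
        (g ∈ S.bundle i ∪ (A i).toFinset ↔ commit.run c 1 env s .out g = i)) := by
    intro g
    have hg : (g : ℕ) < c.m := hc.m_eq ▸ g.2
    obtain ⟨h1, h2⟩ := (run_commit (env := env) (s := s) (c := c)).2 g hg
    rw [h1, h2]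
    rcases hog : s .owner g with _ | j
    · have hno : ∀ i, A i ≠ some g := by
        intro i hi
        rw [hA, hog] at hi
        exact Nat.succ_ne_zero _ hi.symm
      simp only [Nat.lt_irrefl, if_false]
      refine ⟨by rw [ht]; exact ⟨fun h => ⟨h, hno⟩, fun h => h.1⟩, fun hn i => ?_⟩
      rw [Finset.mem_union, Option.mem_toFinset, Option.mem_def, or_iff_left (hno i)]
      exact ho g (fun h => hn ⟨h, hno⟩) i
    · obtain ⟨h3, h4⟩ := hown g hg j hog
      rw [ht] at h4
      simp only [Nat.succ_pos, if_true, one_ne_zero, false_iff, Nat.add_sub_cancel]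
      refine ⟨fun h => h.2 ⟨j, hc.n_eq ▸ h3⟩ ((hA _ _).2 hog), fun _ i => ?_⟩
      rw [Finset.mem_union, Option.mem_toFinset, Option.mem_def,
        or_iff_right (fun h => hf i g h h4), hA, hog]
      exact Nat.add_right_cancel_iff
  exact ⟨fun g => (key g).1, fun g => (key g).2⟩

/-- The order of rounds with `⊤` can be read off from the stored numbers. -/
theorem le_of_untopD_le {x y : WithTop ℕ} {a : ℕ} (hx : x ≠ ⊤ → x ≤ (a : ℕ))
    (h : y.untopD (a + 1) ≤ x.untopD (a + 1)) : y ≤ x := by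
  induction x with
  | top => exact le_top
  | coe x =>
    have hx : x ≤ a := WithTop.coe_le_coe.1 (hx WithTop.coe_ne_top)
    induction y with
    | top =>
      simp only [WithTop.untopD_top, WithTop.untopD_coe] at h
      omega
    | coe y => exact WithTop.coe_le_coe.2 h

/-- In the last case, when fewer goods than unfrozen agents are left. -/
theorem run_last_case (hc : Models I c) {k : ℕ} (hI : Inv I k S) (hR : Rep S s)
    (hg : S.goods.Nonempty) (hcard : S.goods.card < (unfrozen S).card)
    (ho : ∀ g < c.m, s .owner g = 0) (hd : ∀ i < c.n, s .done (i + 1) = 0) :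
    ∃ S', Round I S S' ∧ Rep S' (commit.run c 1 env (lastRound.run c 1 env s)) := by
  obtain ⟨t, ht, hH, hall, hprio⟩ := run_lastRound (env := env) hc hR.toShows ho hd hcard
  have ft : ∀ a, a ∉ lastRound.writes → t a = s a := fun a ha => by
    rw [← ht]; exact Cmd.run_of_notMem c _ ha _ _ _
  have hS : Shows S t := hR.toShows.congr (ft _ (by decide)) (ft _ (by decide))
  rw [ht]
  set A : Fin n → Option (Fin m) := assigned (t .owner) with hA
  have hAg : ∀ g ∈ S.goods, ∃ i, A i = some g := by
    intro g hgg
    have hgm : (g : ℕ) < c.m := hc.m_eq ▸ g.2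
    obtain ⟨i, hi⟩ := Nat.exists_eq_succ_of_ne_zero (hall g hgm ((hS.taken g).2 hgg))
    exact ⟨⟨i, hc.n_eq ▸ (hH.owned g hgm i hi).1⟩, (hH.assigned_eq_some hc _ g).2 hi⟩
  refine ⟨_, Or.inr ⟨hg, hcard, A, hH.isHandout hc hS, hAg, ?_, rfl⟩, ?_⟩
  · intro i hi j hj hAi hAj
    rw [hH.ne_none_iff hc hS hi] at hAi
    have hAj' : t .done (j + 1) = 0 := by
      by_contra h
      exact (hH.ne_none_iff hc hS hj).2 h hAj
    have h := hprio i (hc.n_eq ▸ i.2) j (hc.n_eq ▸ j.2) ((hS.frozen i).trans (mem_unfrozen.1 hi))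
      ((hS.frozen j).trans (mem_unfrozen.1 hj)) hAi hAj'
    rw [hR.last, hR.last] at h
    refine le_of_untopD_le (fun hx => (hI.last_le i hx).trans ?_) h
    have := hI.count
    exact_mod_cast (by omega : k ≤ m)
  · obtain ⟨h1, h2⟩ := commit_goods (env := env) (S := S) (A := A) hc hS.taken
      (fun i g => hH.assigned_eq_some hc i g)
      (fun g hg i hi => ⟨(hH.owned g hg i hi).1, (hH.owned g hg i hi).2.2⟩) hI.fresh
      (by rw [ft .out (by decide)]; exact hR.out)
    have hno : ∀ g, ¬ (g ∈ S.goods ∧ ∀ i, A i ≠ some g) := by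
      rintro g ⟨h3, h4⟩
      obtain ⟨i, hi⟩ := hAg g h3
      exact h4 i hi
    have fc : ∀ a, a ∉ commit.writes → commit.run c 1 env t a = t a := fun a ha =>
      Cmd.run_of_notMem c _ ha _ _ _
    refine ⟨⟨fun g => ?_, fun i => ?_⟩, fun g _ i => h2 g (hno g) i, fun i => ?_, ?_⟩
    · rw [h1]
      simp only [Finset.notMem_empty, iff_false]
      exact hno g
    · rw [fc _ (by decide)]
      exact hS.frozen i
    · rw [fc _ (by decide), ft _ (by decide)]
      exact hR.last i
    · rw [run_commit.1, ft _ (by decide), hR.round]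

/-- The case of a full round. -/
theorem run_full_case (hc : Models I c) {k : ℕ} (hI : Inv I k S) (hR : Rep S s)
    (hg : S.goods.Nonempty) (hcard : (unfrozen S).card ≤ S.goods.card)
    (ho : ∀ g < c.m, s .owner g = 0) (hd : ∀ i < c.n, s .done (i + 1) = 0) :
    ∃ S', Round I S S' ∧ Rep S' (commit.run c 1 env (fullRound.run c 1 env s)) := by
  classical
  simp only [fullRound, Cmd.run_block_cons, Cmd.run_block_nil]
  obtain ⟨hMI, hall⟩ := run_matchAll (env := env) hc.irrefl hc.trans ho hd
  set s₁ := matchAll.run c 1 env s with hs₁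
  set s₂ := markMatched.run c 1 env s₁ with hs₂
  set s₃ := setValues.run c 1 env s₂ with hs₃
  have f₁ : ∀ a, a ∉ matchAll.writes → s₁ a = s a := fun a ha => Cmd.run_of_notMem c _ ha _ _ _
  have f₂ : ∀ a, a ∉ markMatched.writes → s₂ a = s₁ a := fun a ha =>
    Cmd.run_of_notMem c _ ha _ _ _
  have f₃ : ∀ a, a ∉ setValues.writes → s₃ a = s₂ a := fun a ha => Cmd.run_of_notMem c _ ha _ _ _
  have hS₁ : Shows S s₁ := hR.toShows.congr (f₁ _ (by decide)) (f₁ _ (by decide))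
  have hS₂ : Shows S s₂ := hS₁.congr (f₂ _ (by decide)) (f₂ _ (by decide))
  have hS₃ : Shows S s₃ := hS₂.congr (f₃ _ (by decide)) (f₃ _ (by decide))
  have o₂ : s₂ .owner = s₁ .owner := f₂ _ (by decide)
  have o₃ : s₃ .owner = s₁ .owner := (f₃ _ (by decide)).trans o₂
  have t₂ : s₂ .taken = s₁ .taken := f₂ _ (by decide)
  have d₃ : s₃ .done = s₂ .done := f₃ _ (by decide)
  have hmark : ∀ i < c.n, (s₂ .done (i + 1) = 1 ∧ ∃ g < c.m, s₁ .owner g = i + 1) ∨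
      (s₂ .done (i + 1) = 0 ∧ ∀ g < c.m, s₁ .owner g ≠ i + 1) := run_markMatched
  have hmax := hMI.isMaxMatching hc hS₁ hall
  have hadj := hMI.not_adjustStep hc hS₁ hall
  set T : Fin n → Option (Fin m) := assigned (s₁ .owner) with hT
  have hTs : ∀ i g, T i = some g ↔ s₁ .owner g = i + 1 := fun i g =>
    hMI.matched.assigned_eq_some hc.m_eq i g
  have hval : ∀ (i : Fin n) (g : Fin m), T i = some g → (s₃ .value (i + 1) = 0 ∧
      ∀ i₀, ¬ OnPathFrom I S T i₀ i) ∨ ((∃ i₀, OnPathFrom I S T i₀ i) ∧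
        s₃ .value (i + 1) = freezeRounds I S T i + 1) := by
    intro i g hig
    have := run_setValues (env := env) hc hS₂ (hMI.matched.congr t₂ o₂)
      (by rw [o₂]; exact hmax.1) (by rw [o₂]; exact hmark) i (g := g) (by rw [o₂]; exact hig)
    rw [o₂] at this
    exact this
  have hH₃ : Handed c s₃ := by
    refine ⟨fun g hg i hi => ?_, by rw [o₃]; exact hMI.matched.inj, fun i hi _ => ?_⟩
    · rw [o₃] at hi
      rw [f₃ .frozen (by decide), f₂ .frozen (by decide), f₃ .taken (by decide), t₂]
      have := hMI.matched.edge g hg i hi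
      exact ⟨this.1, (hMI.owned g hg i hi).1, this.2.1⟩
    · rw [d₃, o₃]
      rcases hmark i hi with ⟨h1, h2⟩ | ⟨h1, h2⟩
      · exact iff_of_true (by rw [h1]; exact one_ne_zero) h2
      · refine iff_of_false (fun h => h h1) ?_
        rintro ⟨g, hg, h3⟩
        exact h2 g hg h3
  obtain ⟨s₄, hs₄, hH₄, hall₄, hext, hdone₄⟩ := run_handOut (env := env) hc hS₃ hH₃ hcard
  rw [hs₄]
  have f₄ : ∀ a, a ∉ handOut.writes → s₄ a = s₃ a := fun a ha => by
    rw [← hs₄]; exact Cmd.run_of_notMem c _ ha _ _ _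
  have hS₄ : Shows S s₄ := hS₃.congr (f₄ _ (by decide)) (f₄ _ (by decide))
  have hfr : ∀ i : Fin n, _ := fun i => run_freeze (c := c) (env := env) (s := s₄) (i : ℕ)
    (by rw [hc.n_eq]; exact i.2)
  set s₅ := freeze.run c 1 env s₄ with hs₅
  have f₅ : ∀ a, a ∉ freeze.writes → s₅ a = s₄ a := fun a ha => Cmd.run_of_notMem c _ ha _ _ _
  set A : Fin n → Option (Fin m) := assigned (s₄ .owner) with hA
  have hTA : ∀ i g, T i = some g → A i = some g := by
    intro i g hi
    rw [hTs] at hi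
    rw [hH₄.assigned_eq_some hc, hext g (hc.m_eq ▸ g.2), o₃, hi]
    rw [o₃, hi]
    exact Nat.succ_ne_zero _
  -- the values computed by the program are those of the algorithm
  have hfz : ∀ i : Fin n, S.frozen i = 0 →
      ((s₄ .done (i + 1) < 2 ∧ 0 < s₄ .value (i + 1)) ∧ (∃ i₀, OnPathFrom I S T i₀ i) ∧
        s₄ .value (i + 1) = freezeRounds I S T i + 1) ∨
      (¬ (s₄ .done (i + 1) < 2 ∧ 0 < s₄ .value (i + 1)) ∧ ∀ i₀, ¬ OnPathFrom I S T i₀ i) := by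
    intro i hi
    have hin : (i : ℕ) < c.n := hc.n_eq ▸ i.2
    rw [f₄ .value (by decide)]
    rcases hmark i hin with ⟨h1, g, hg, h2⟩ | ⟨h1, h2⟩
    · have h3 := (hdone₄ i hin).1 (by rw [d₃, h1]; exact one_ne_zero)
      rw [d₃, h1] at h3
      rcases hval i ⟨g, hc.m_eq ▸ hg⟩ ((hTs _ _).2 h2) with ⟨h4, h5⟩ | ⟨h4, h5⟩
      · exact Or.inr ⟨fun h => by omega, h5⟩
      · exact Or.inl ⟨by omega, h4, h5⟩
    · right
      refine ⟨?_, fun i₀ hp => ?_⟩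
      · have h3 := (hdone₄ i hin).2 (by rw [d₃, h1])
        have h4 : ¬ s₄ .done (i + 1) = 0 := fun h =>
          hall₄ i hin ⟨(hS₄.frozen i).trans hi, h⟩
        omega
      · obtain ⟨g, hg⟩ := hp.matched
        exact h2 g (hc.m_eq ▸ g.2) ((hTs i g).1 hg)
  have hround : s₄ .round 0 = S.round := by
    rw [f₄ .round (by decide), f₃ .round (by decide), f₂ .round (by decide),
      f₁ .round (by decide), hR.round]
  have hlast : s₄ .last = s .last := by
    rw [f₄ .last (by decide), f₃ .last (by decide), f₂ .last (by decide), f₁ .last (by decide)]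
  have hout : s₅ .out = s .out := by
    rw [f₅ .out (by decide), f₄ .out (by decide), f₃ .out (by decide), f₂ .out (by decide),
      f₁ .out (by decide)]
  have o₅ : s₅ .owner = s₄ .owner := f₅ _ (by decide)
  have t₅ : s₅ .taken = s₄ .taken := f₅ _ (by decide)
  obtain ⟨h1, h2⟩ := commit_goods (env := env) (s := s₅) (S := S) (A := A) hc
    (by rw [t₅]; exact hS₄.taken) (fun i g => by rw [o₅]; exact hH₄.assigned_eq_some hc i g)
    (fun g hg i hi => by
      rw [o₅] at hi
      rw [t₅]
      exact ⟨(hH₄.owned g hg i hi).1, (hH₄.owned g hg i hi).2.2⟩) hI.fresh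
    (by rw [hout]; exact hR.out)
  have fc : ∀ a, a ∉ commit.writes → commit.run c 1 env s₅ a = s₅ a := fun a ha =>
    Cmd.run_of_notMem c _ ha _ _ _
  refine ⟨_, Or.inl ⟨hg, hcard, T, T, A, hmax, ⟨⟨0, .zero T⟩, hadj⟩, hH₄.isHandout hc hS₄, ?_, hTA,
    rfl⟩, ⟨⟨fun g => ?_, fun i => ?_⟩, fun g hgn i => ?_, fun i => ?_, ?_⟩⟩
  · intro i hi
    rw [hH₄.ne_none_iff hc hS₄ hi]
    exact fun h => hall₄ i (hc.n_eq ▸ i.2) ⟨(hS₄.frozen i).trans (mem_unfrozen.1 hi), h⟩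
  · rw [h1]
    simp [afterRound]
  · rw [fc _ (by decide), (hfr i).1, hS₄.frozen]
    simp only [afterRound]
    split_ifs with hi hv
    · rcases hfz i hi with ⟨_, _, h⟩ | ⟨h, _⟩
      · rw [h, Nat.add_sub_cancel]
      · exact (h hv).elim
    · rcases hfz i hi with ⟨h, _⟩ | ⟨_, h⟩
      · exact (hv h).elim
      · rw [freezeRounds_eq_zero h]
    · rfl
  · refine h2 g (fun h => hgn ?_) i
    simpa [afterRound] using h
  · rw [fc _ (by decide), (hfr i).2, hS₄.frozen, hround, hlast]
    simp only [afterRound]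
    by_cases hi : S.frozen i = 0
    · rcases hfz i hi with ⟨h3, h4, _⟩ | ⟨h3, h4⟩
      · rw [if_pos ⟨hi, h3⟩, if_pos h4]
        rfl
      · rw [if_neg (fun h => h3 h.2), if_neg (not_exists.2 h4)]
        exact hR.last i
    · rw [if_neg (fun h => hi h.1), if_neg]
      · exact hR.last i
      · rintro ⟨i₀, hp⟩
        exact hi (mem_unfrozen.1 (Reach.mem_unfrozen hmax.1 hp.reach))
  · rw [run_commit.1, f₅ _ (by decide), hround]
    rfl

/-- While goods are left, the program performs a round of the algorithm. -/
theorem run_oneRound (hc : Models I c) {k : ℕ} (hI : Inv I k S) (hR : Rep S s)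
    (hg : S.goods.Nonempty) : ∃ S', Round I S S' ∧ Rep S' (oneRound.run c 1 env s) := by
  have hgoods := run_countGoods (env := env) hc hR.toShows
  simp only [oneRound, Cmd.run_block_cons, Cmd.run_block_nil]
  set s₁ := countGoods.run c 1 env s with hs₁
  have f₁ : ∀ a, a ∉ countGoods.writes → s₁ a = s a := fun a ha => Cmd.run_of_notMem c _ ha _ _ _
  have hagents := run_countAgents (env := env) (s := s₁) hc
    (hR.toShows.congr (f₁ _ (by decide)) (f₁ _ (by decide)))
  rw [Cmd.run_when, if_pos (by simpa [hgoods] using hg)]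
  simp only [roundBody, Cmd.run_block_cons, Cmd.run_block_nil]
  set s₂ := countAgents.run c 1 env s₁ with hs₂
  have f₂ : ∀ a, a ∉ countAgents.writes → s₂ a = s₁ a := fun a ha =>
    Cmd.run_of_notMem c _ ha _ _ _
  set s₃ := reset.run c 1 env s₂ with hs₃
  have f₃ : ∀ a, a ∉ reset.writes → s₃ a = s₂ a := fun a ha => Cmd.run_of_notMem c _ ha _ _ _
  have hd : ∀ i < c.n, s₃ .done (i + 1) = 0 := by
    rw [hs₃]
    simp only [reset, Cmd.run_block_cons, Cmd.run_block_nil]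
    exact run_fill_agents .done 0
  have ho : ∀ g < c.m, s₃ .owner g = 0 := by
    rw [hs₃]
    simp only [reset, Cmd.run_block_cons, Cmd.run_block_nil]
    intro g hg
    rw [Cmd.run_of_notMem c _ (by decide)]
    exact run_fill_goods .owner 0 g hg
  have hR₃ : Rep S s₃ := by
    have e : ∀ a, a ∉ countGoods.writes ++ countAgents.writes ++ reset.writes → s₃ a = s a := by
      intro a ha
      simp only [List.mem_append, not_or] at ha
      rw [f₃ a ha.2, f₂ a ha.1.2, f₁ a ha.1.1]
    refine ⟨hR.toShows.congr (e _ (by decide)) (e _ (by decide)), ?_, ?_, ?_⟩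
    · rw [e _ (by decide)]; exact hR.out
    · rw [e _ (by decide)]; exact hR.last
    · rw [e _ (by decide)]; exact hR.round
  have hlt : (Bx.lt (.get .goods) (.get .agents)).ev c env s₃ ↔
      S.goods.card < (unfrozen S).card := by
    rw [Bx.ev_lt, Ex.ev_get, Ex.ev_get, f₃ .agents (by decide), f₃ .goods (by decide),
      f₂ .goods (by decide), hagents, hgoods]
  rw [Cmd.run_ite]
  by_cases hcard : S.goods.card < (unfrozen S).card
  · rw [if_pos (hlt.2 hcard)]
    exact run_last_case hc hI hR₃ hg hcard ho hd
  · rw [if_neg (fun h => hcard (hlt.1 h))]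
    exact run_full_case hc hI hR₃ hg (not_lt.1 hcard) ho hd

/-- When all goods are allocated, nothing changes any more. -/
theorem run_oneRound_of_empty (hc : Models I c) (hR : Rep S s) (hg : S.goods = ∅) :
    Rep S (oneRound.run c 1 env s) := by
  have hgoods := run_countGoods (env := env) hc hR.toShows
  rw [hg, Finset.card_empty] at hgoods
  simp only [oneRound, Cmd.run_block_cons, Cmd.run_block_nil]
  rw [Cmd.run_when, if_neg (by simp [hgoods])]
  have f : ∀ a, a ∉ countGoods.writes → countGoods.run c 1 env s a = s a := fun a ha =>
    Cmd.run_of_notMem c _ ha _ _ _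
  refine ⟨hR.toShows.congr (f _ (by decide)) (f _ (by decide)), ?_, ?_, ?_⟩
  · rw [f _ (by decide)]; exact hR.out
  · rw [f _ (by decide)]; exact hR.last
  · rw [f _ (by decide)]; exact hR.round

/-- The program performs an execution of the algorithm. -/
theorem run_main (hn : 0 < n) (hc : Models I c) : ∃ k S, ReachedIn I k S ∧ S.goods = ∅ ∧
    Rep S (main.run c 0 env fun _ _ => 0) := by
  simp only [main, Cmd.run_block_cons, Cmd.run_block_nil]
  set s₁ := (Cmd.loop .agent (.set .last (.succ (.var 0)) (.succ (.size .good)))).run c 0 env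
    (fun _ _ => 0) with hs₁
  have f₁ : ∀ a, a ≠ .last → s₁ a = fun _ => 0 := fun a ha =>
    Cmd.run_of_notMem c _ (by simpa [Cmd.writes] using ha) _ _ _
  have hlast : ∀ i < c.n, s₁ .last (i + 1) = c.m + 1 := by
    rw [hs₁, Cmd.run_loop]
    refine iter_induction (fun x (t : Store) => ∀ i < x, t .last (i + 1) = c.m + 1)
      (fun i hi => absurd hi (Nat.not_lt_zero i)) fun x t _ h i hi => ?_
    rw [Cmd.run_set, Store.write_same]
    simp only [Ex.ev_succ, Ex.ev_var, Function.update_self, Ex.ev_size, Inp.size,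
      Nat.add_right_cancel_iff]
    split_ifs
    · rfl
    · exact h i (by omega)
  have hR : Rep (start n m) s₁ := by
    refine ⟨⟨fun g => ?_, fun i => ?_⟩, fun g hg => ?_, fun i => ?_, ?_⟩
    · rw [f₁ .taken (by decide)]
      simp [start]
    · rw [f₁ .frozen (by decide)]
      rfl
    · simp [start] at hg
    · rw [hlast i (hc.n_eq ▸ i.2), hc.m_eq]
      rfl
    · rw [f₁ .round (by decide)]
      rfl
  rw [Cmd.run_loop]
  have key := iter_induction (f := fun x => oneRound.run c (0 + 1) (Function.update env 0 x))
    (N := c.size .good) (s := s₁) (fun x t => ∃ k S, ReachedIn I k S ∧ Rep S t ∧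
      (S.goods = ∅ ∨ k = x)) ⟨0, _, .zero _, hR, Or.inr rfl⟩ (by
    rintro x t _ ⟨k, S, hk, hRt, h⟩
    by_cases hg : S.goods = ∅
    · exact ⟨k, S, hk, run_oneRound_of_empty hc hRt hg, Or.inl hg⟩
    · rcases hk.inv_or_final hn with hI | hF
      · obtain ⟨S', hr, hR'⟩ := run_oneRound (env := Function.update env 0 x) hc hI hRt
          (Finset.nonempty_iff_ne_empty.2 hg)
        exact ⟨k + 1, S', .succ hk hr, hR', Or.inr (by rw [h.resolve_left hg])⟩
      · exact (hg hF.goods_eq).elim)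
  obtain ⟨k, S, hk, hRt, h⟩ := key
  refine ⟨k, S, hk, ?_, hRt⟩
  rcases h with h | h
  · exact h
  · rcases hk.inv_or_final hn with hI | hF
    · have h1 := hI.count
      have h2 : k = c.m := h
      rw [hc.m_eq] at h2
      exact Finset.card_eq_zero.1 (by omega)
    · exact hF.goods_eq

/-- Every instance, even with irrational ratios, is described by some input. -/
theorem exists_models (I : BiInstance n m) : ∃ c, Models I c := by
  classical
  exact ⟨⟨n, m, fun i g => ∃ (h : i < n) (h' : g < m), I.Large ⟨i, h⟩ ⟨g, h'⟩,
    fun i j => ∃ (h : i < n) (h' : j < n), I.ratio ⟨i, h⟩ < I.ratio ⟨j, h'⟩,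
    fun i => if h : i < n then ⌊I.ratio ⟨i, h⟩⌋₊ else 0⟩, rfl, rfl, by simp, by simp, by simp⟩

/-- Every state between two rounds is represented by some store. -/
theorem exists_rep {k : ℕ} (hI : Inv I k S) : ∃ s, Rep S s := by
  classical
  let s : Store := fun a x => match a with
    | .taken => if ∃ h : x < m, ⟨x, h⟩ ∈ S.goods then 0 else 1
    | .frozen => if h : x < n then S.frozen ⟨x, h⟩ else 0
    | .out => if h : ∃ (i : Fin n) (h : x < m), ⟨x, h⟩ ∈ S.bundle i then h.choose else 0
    | .last => if h : x - 1 < n then (S.lastFrozen ⟨x - 1, h⟩).untopD (m + 1) else 0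
    | .round => S.round
    | _ => 0
  refine ⟨s, ⟨fun g => ?_, fun i => ?_⟩, fun g hg i => ?_, fun i => ?_, rfl⟩
  · by_cases hg : g ∈ S.goods <;> simp [s, hg]
  · simp [s]
  · obtain ⟨j, hj⟩ := hI.cover g hg
    have hex : ∃ (i : Fin n) (h : (g : ℕ) < m), ⟨g, h⟩ ∈ S.bundle i := ⟨j, g.2, hj⟩
    have huniq : ∀ i, g ∈ S.bundle i → i = hex.choose := by
      intro i hi
      by_contra hne
      obtain ⟨_, h⟩ := hex.choose_spec
      exact Finset.disjoint_left.1 (hI.disj _ _ hne) hi h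
    have hs : s .out g = hex.choose := dif_pos hex
    rw [hs]
    refine ⟨fun hi => by rw [← huniq i hi], fun h => ?_⟩
    obtain ⟨_, h'⟩ := hex.choose_spec
    rw [← Fin.ext h]
    exact h'
  · simp [s]

/-! ### The input of the machine -/

/-- The input that a memory holds.  Ratios are compared by cross multiplication; the row index of the
table is cut off at `n`, as in the compiled conditions. -/
def memInp (n m : ℕ) (μ : RAM.Memory) : Inp where
  n := n
  m := m
  edge := fun i g => 0 < μ 3 (min i n * m + g)
  ratioLT := fun i j => μ 1 i * μ 2 j < μ 1 j * μ 2 i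
  floor := fun i => μ 1 i / μ 2 i

theorem input_one (I : BiInstance n m) (p q : Fin n → ℕ) (i : Fin n) :
    RAM.input I p q 1 i = p i := by
  simp [RAM.input]

theorem input_two (I : BiInstance n m) (p q : Fin n → ℕ) (i : Fin n) :
    RAM.input I p q 2 i = q i := by
  simp [RAM.input]

theorem models_memInp (I : BiInstance n m) (p q : Fin n → ℕ)
    (hpq : ∀ i, 0 < q i ∧ I.ratio i = (p i : ℝ) / (q i : ℝ)) :
    Models I (memInp n m (RAM.input I p q)) where
  n_eq := rfl
  m_eq := rfl
  edge_iff := fun i g => by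
    have hin : min (i : ℕ) n = i := min_eq_left i.2.le
    have h : (∃ (i' : Fin n) (g' : Fin m), (i : ℕ) * m + g = i' * m + g' ∧ I.Large i' g') ↔
        I.Large i g := by
      refine ⟨?_, fun h => ⟨i, g, rfl, h⟩⟩
      rintro ⟨i', g', h, hl⟩
      have hm : 0 < m := (Nat.zero_le _).trans_lt g.2
      have h1 := congrArg (· / m) h
      simp only [Nat.mul_comm _ m, Nat.mul_add_div hm, Nat.div_eq_of_lt g.2,
        Nat.div_eq_of_lt g'.2, Nat.add_zero] at h1
      rw [h1] at h
      have hi : i = i' := Fin.ext h1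
      have hg : g = g' := Fin.ext (Nat.add_left_cancel h)
      rwa [hi, hg]
    simp only [memInp, hin]
    rw [← h]
    simp only [RAM.input]
    split_ifs with h'
    · simpa using h'
    · simpa using h'
  ratio_iff := fun i j => by
    have hi : (0 : ℝ) < q i := by exact_mod_cast (hpq i).1
    have hj : (0 : ℝ) < q j := by exact_mod_cast (hpq j).1
    rw [(hpq i).2, (hpq j).2, div_lt_div_iff₀ hi hj]
    simp only [memInp, input_one, input_two]
    exact_mod_cast Iff.rfl
  floor_eq := fun i => by
    rw [(hpq i).2, Nat.floor_div_eq_div]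
    simp only [memInp, input_one, input_two]

theorem size_mul_le (x y : ℕ) : (x * y).size ≤ x.size + y.size := by
  rw [Nat.size_le, pow_add]
  exact Nat.mul_lt_mul'' (Nat.lt_size_self x) (Nat.lt_size_self y)

/-- The initial memory of the machine represents the input and the empty store. -/
theorem agree_input (I : BiInstance n m) (p q : Fin n → ℕ) (env : ℕ → ℕ) :
    Agree (memInp n m (RAM.input I p q)) (RAM.inputLength m p q) 0 env (fun _ _ => 0)
      (RAM.input I p q) where
  fits := by
    refine ⟨rfl, rfl, fun _ => rfl, fun _ _ => Iff.rfl, fun _ _ => Iff.rfl, ?_, ?_, ?_, ?_⟩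
    · simp only [memInp, RAM.inputLength]; omega
    · simp only [memInp, RAM.inputLength]; omega
    · simp only [memInp, RAM.inputLength]; omega
    · intro i j
      by_cases hi : i < n
      · by_cases hj : j < n
        · have h1 := input_one I p q ⟨i, hi⟩
          have h2 := input_two I p q ⟨j, hj⟩
          simp only at h1 h2
          rw [h1, h2]
          have h3 := Finset.single_le_sum (f := fun i => (p i).size) (fun _ _ => Nat.zero_le _)
            (Finset.mem_univ (⟨i, hi⟩ : Fin n))
          have h4 := Finset.single_le_sum (f := fun i => (q i).size) (fun _ _ => Nat.zero_le _)
            (Finset.mem_univ (⟨j, hj⟩ : Fin n))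
          have h5 := size_mul_le (p ⟨i, hi⟩) (q ⟨j, hj⟩)
          rw [RAM.inputLength, Finset.sum_add_distrib]
          omega
        · simp [RAM.input, hj]
      · simp [RAM.input, hi]
  store := fun a x => by cases a <;> rfl
  counter := fun k hk => absurd hk (Nat.not_lt_zero k)

end Mini

theorem theorem3 :
    -- every execution of the algorithm, on an arbitrary instance with at least one agent
    (∀ (n m : ℕ) (_hn : 0 < n) (I : BiInstance n m),
      -- an EFX allocation exists
      (∃ X : Fin n → Finset (Fin m), IsAllocation X ∧ I.EFX X) ∧
      -- every allocation that the algorithm can return is EFX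
      (∀ X : Fin n → Finset (Fin m), MMF.Returns I X → IsAllocation X ∧ I.EFX X) ∧
      -- the algorithm never gets stuck before all goods are allocated
      (∀ (k : ℕ) (S : MMFState n m), MMF.ReachedIn I k S → S.goods.Nonempty →
        ∃ S', MMF.Round I S S') ∧
      -- it makes at most `m` rounds
      (∀ (k : ℕ) (S : MMFState n m), MMF.ReachedIn I k S → k ≤ m) ∧
      -- it modifies the matching at most `n ^ 2` times per round
      (∀ (k : ℕ) (S : MMFState n m), MMF.ReachedIn I k S →
        ∀ (T₀ T : Fin n → Option (Fin m)) (l : ℕ), MMF.IsMaxMatching I S T₀ →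
          Steps (MMF.AdjustStep I S) l T₀ T → l ≤ n ^ 2) ∧
      -- an agent is never set to be frozen for more than `⌊r_i⌋ - 1` further rounds
      (∀ (k : ℕ) (S : MMFState n m), MMF.ReachedIn I k S →
        ∀ i, (S.frozen i : ℤ) ≤ ⌊I.ratio i⌋ - 1) ∧
      -- in total, freezing makes her miss at most `⌊r_i⌋ - 1` of the rounds before the goods run out
      (∀ (k : ℕ) (S : MMFState n m), MMF.ReachedIn I k S → S.goods.Nonempty →
        ∀ i, (k : ℤ) - ((S.bundle i).card : ℤ) ≤ ⌊I.ratio i⌋ - 1)) ∧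
    -- the algorithm is implemented by one program with a polynomial running time
    ∃ (prog : RAM.Program) (P : Polynomial ℕ),
      ∀ (n m : ℕ) (_hn : 0 < n) (I : BiInstance n m) (p q : Fin n → ℕ)
        (_hpq : ∀ i, 0 < q i ∧ I.ratio i = (p i : ℝ) / (q i : ℝ)),
        ∃ (t : ℕ) (μ : RAM.Memory) (X : Fin n → Finset (Fin m)),
          RAM.Exec prog (RAM.input I p q) t μ ∧ t ≤ P.eval (RAM.inputLength m p q) ∧
          RAM.Outputs μ X ∧ MMF.Returns I X ∧ IsAllocation X ∧ I.EFX X := by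
  have hret : ∀ (n m : ℕ) (_hn : 0 < n) (I : BiInstance n m) (X : Fin n → Finset (Fin m)),
      MMF.Returns I X → IsAllocation X ∧ I.EFX X := by
    rintro n m hn I X ⟨k, S, hk, hg, rfl⟩
    rcases hk.inv_or_final hn with hI | hF
    · exact ⟨hI.isAllocation hg, hI.efx⟩
    · exact ⟨hF.isAllocation, hF.efx⟩
  refine ⟨fun n m hn I => ⟨?_, hret n m hn I, ?_, ?_, ?_, ?_, ?_⟩, ?_⟩
  · obtain ⟨c, hc⟩ := Mini.exists_models I
    obtain ⟨k, S, hk, hg, _⟩ := Mini.run_main (env := fun _ => 0) hn hc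
    exact ⟨S.bundle, hret n m hn I _ ⟨k, S, hk, hg, rfl⟩⟩
  · intro k S hk hg
    rcases hk.inv_or_final hn with hI | hF
    · obtain ⟨c, hc⟩ := Mini.exists_models I
      obtain ⟨s, hs⟩ := Mini.exists_rep hI
      obtain ⟨S', hS', _⟩ := Mini.run_oneRound (env := fun _ => 0) hc hI hs hg
      exact ⟨S', hS'⟩
    · exact absurd hF.goods_eq hg.ne_empty
  · intro k S hk
    rcases hk.inv_or_final hn with hI | hF
    · exact (Nat.le_add_right _ _).trans hI.count
    · exact hF.le
  · intro k S _ T₀ T l _ hl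
    exact MMF.steps_adjust_le hl
  · intro k S hk
    rcases hk.inv_or_final hn with hI | hF
    · exact hI.frozen_le
    · exact hF.frozen_le
  · intro k S hk hg
    rcases hk.inv_or_final hn with hI | hF
    · exact hI.missed_le
    · exact absurd hF.goods_eq hg.ne_empty
  · obtain ⟨P, hP⟩ := Mini.exists_exec Mini.main 0 Mini.main_wf
    refine ⟨Mini.main.compile 0, P, fun n m hn I p q hpq => ?_⟩
    obtain ⟨t, μ, hex, ht, hagree⟩ := hP _ _ (fun _ => 0) _ _ (Mini.agree_input I p q _)
    obtain ⟨k, S, hk, hg, hR⟩ := Mini.run_main (env := fun _ => 0) hn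
      (Mini.models_memInp I p q hpq)
    refine ⟨t, μ, S.bundle, hex, ht, fun g i => ?_, ⟨k, S, hk, hg, rfl⟩,
      hret n m hn I _ ⟨k, S, hk, hg, rfl⟩⟩
    rw [hR.out g (by simp [hg]) i, ← hagree.store]
    rfl
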